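/- **Setting.** Identify $\mathbb R^4$ with the real quaternions, $u_0=1,u_1,u_2,u_3$ being the standard units. Let $L_P=\mathbb Z^4$, let $L_F=D_4$ be the integer vectors of even squared length, and let $G_P,G_F\subset SO(4)$ be their rotation symmetry groups. For a rotation $R$ let $\Sigma_X(R)=[L_X:L_X\cap RL_X]$, $X\in\{P,F\}$. For integral quaternions $p,q\neq0$ let $R(p,q)x=px\bar q/|pq|$; the pair is *admissible* if $|pq|\in\mathbb Z$, and then $\Sigma_X(p,q):=\Sigma_X(R(p,q))$. Pairs are multiplied componentwise and, where groups are concerned, normalised to norm one; only the directions of $p$ and $q$ matter. Let $\mathcal G_P,\mathcal G_F\subset SU(2)\times SU(2)$ be the double covers of $G_P,G_F$, and for $g=(p,q)$ let $\mathcal H_P(g)=\mathcal G_P\cap g\,\mathcal G_P\,g^{-1}$. Two admissible pairs (or the rotations, or the CSLs belonging to them) are P-equivalent (F-equivalent) if $R(p,q),R(p',q')$ lie in the same double coset of $G_P$ (of $G_F$). Quaternions $q,q'$ are *equivalent* if $q'=s q s'$ up to a positive factor, with $s,s'$ in the group of order 48 generated by $(\pm1,0,0,0)$, $\frac1{\sqrt2}(\pm1,\pm1,0,0)$,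 $\frac12(\pm1,\pm1,\pm1,\pm1)$ and their permutations. The quaternion $q$ has *type* $i\in\{0,\dots,5\}$ if the $i$-th of the forms $(1,0,0,0)$, $(0,1,1,1)$, $(m,n,n,n)$, $(m,n,0,0)$, $(m,n,n,0)$, $(m,n,r,s)$ ($m,n,r,s\in\mathbb Z$) is the first one that occurs among the nonzero integral quaternions equivalent to $q$. A form written in a table below stands for its members of the indicated type. Let $n_{Fij}=n_{Fij}(\sigma)$ be the number of F-classes of admissible pairs $(p,q)$ of type $(i,j)$ with $\Sigma_F=\sigma$. Put $\omega=\frac12(1,1,1,1)$, $s_1=(u_0,\omega)$, $s_2=(u_0,\frac12(-1,1,1,1))$. **Theorem.** (1) $\mathcal G_P\le\mathcal G_F$ has index $3$, and $\mathcal G_F=\mathcal G_P\cup(u_0,\frac12(1,1,1,1))\mathcal G_P\cup(u_0,\frac12(1,-1,-1,-1))\mathcal G_P$. (2) Every admissible pair is F-equivalent to a pair $g=(p,q)$, or to the interchange of such a pair, with $p$ of the $i$-th form and type and $q$ of the $j$-th form and type for one of the $(i,j)$ listed here. For every such $g$ (admissible or not), $\mathcal G_F\,g\,\mathcal G_F$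 is the disjoint union of the double cosets $\mathcal G_P\,x\,\mathcal G_P$ with * $x=g,\;gs_1$ for $(i,j)=(0,0),(0,3),(0,4),(1,1),(1,3),(1,4)$; * $x=g,\;gs_1,\;gs_2$ for $(0,2),(0,5),(1,2),(1,5),(2,2),(2,3),(2,4),(2,5)$; * $x=g,\;gs_1,\;s_1g,\;s_1gs_1,\;s_1gs_2$ for $(3,3),(4,4)$; * $x=g,\;gs_1,\;gs_2,\;s_1g,\;s_1gs_2$ for $(3,4)$; * $x=g,\;gs_a,\;s_ag,\;s_ags_b$ $(a,b\in\{1,2\})$ for $(3,5),(4,5),(5,5)$. The same holds with the components of $g,s_1,s_2$ interchanged. (3) In the following table each row gives forms of $p$ and of $q$ (up to a factor $2$), of types $i$ and $j$; generators of $\mathcal H_P(p,q)$ besides $(-1,1)$ and $(1,-1)$; the order of $\mathcal H_P(p,q)$; $|G_PR(p,q)G_P|/192$; and the numbers $N_1,N_2$ used in (4). The third to fifth columns are valid for all pairs of these forms and types (admissible or not). Here $a=(u_1,u_0)$, $b=(u_2,u_0)$, $c=(u_0,u_1)$, $w=(\omega,\omega)$, and $[x\,|\,y]$ is the pair $(x/|x|,y/|y|)$.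 | $p$ | $q$ | generators | order | mult. | $N_1$ | $N_2$ | |---|---|---|---|---|---|---| | $(1,0,0,0)$ | $(1,0,0,0)$ | all of $\mathcal G_P$ | 384 | 1 | $n_{F00}$ | 0 | | $(1,0,0,0)$ | $(1,1,1,1)$ | $a,b,c,(u_0,u_2),w$ | 192 | 2 | 0 | $n_{F00}$ | | $(1,0,0,0)$ | $(m,n,n,n)$ | $a,b,w$ | 48 | 8 | $n_{F02}$ | $2n_{F02}$ | | $(1,0,0,0)$ | $(m,n,0,0)$ | $a,b,[1,1,0,0\mid1,1,0,0]$ | 64 | 6 | $n_{F03}$ | 0 | | $(1,0,0,0)$ | $(m-n,m+n,m-n,m+n)$ | $a,b,c$ | 32 | 12 | 0 | $n_{F03}$ | | $(1,0,0,0)$ | $(m,n,n,0)$ | $a,b,[0,1,1,0\mid0,1,1,0]$ | 32 | 12 | $n_{F04}$ | 0 | | $(1,0,0,0)$ | $(m-2n,m+2n,m,m)$ | $a,b$ | 16 | 24 | 0 | $n_{F04}$ | | $(1,0,0,0)$ | general | $a,b$ | 16 | 24 | $n_{F05}$ | $2n_{F05}$ | | $(0,1,1,1)$ | $(0,1,1,1)$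 | $w,[0,1,-1,0\mid0,1,-1,0]$ | 24 | 16 | $n_{F11}$ | 0 | | $(0,1,1,1)$ | $(3,1,1,1)$ | $w$ | 12 | 32 | 0 | $n_{F11}$ | | $(0,1,1,1)$ | $(m,n,n,n)$ | $w$ | 12 | 32 | $n_{F12}$ | $2n_{F12}$ | | $(0,1,1,1)$ | $(m,n,0,0)$ | $[0,0,1,-1\mid1,1,0,0]$ | 16 | 24 | 0 | 0 | | $(0,1,1,1)$ | $(m-n,m+n,m-n,m+n)$ | $c$ | 8 | 48 | 0 | 0 | | $(0,1,1,1)$ | $(m,n,n,0)$ | $[0,1,-1,0\mid0,1,1,0]$ | 8 | 48 | $n_{F14}$ | 0 | | $(0,1,1,1)$ | $(m-2n,m+2n,m,m)$ | – | 4 | 96 | 0 | $n_{F14}$ | | $(0,1,1,1)$ | general | – | 4 | 96 | $n_{F15}$ | $2n_{F15}$ | | $(m,n,n,n)$ | $(m',n',n',n')$ | $w$ | 12 | 32 | $n_{F22}$ | $2n_{F22}$ | | $(m,n,n,n)$ | $(m',n',0,0)$ | $c$ | 8 | 48 | $n_{F23}$ | $2n_{F23}$ | | $(m,n,n,n)$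 | $(m',n',n',0)$ | – | 4 | 96 | $n_{F24}$ | $2n_{F24}$ | | $(m,n,n,n)$ | general | – | 4 | 96 | $n_{F25}$ | $2n_{F25}$ | | $(m,n,0,0)$ | $(m',n',0,0)$ | $[1,1,0,0\mid1,1,0,0],[1,1,0,0\mid1,-1,0,0]$ | 32 | 12 | $n_{F33}$ | 0 | | $(m,n,0,0)$ | $(m',0,n',0)$ | $a,(u_0,u_2)$ | 16 | 24 | $n_{F33}$ | 0 | | $(m,n,0,0)$ | $(m'-n',m'+n',m'-n',m'+n')$ | $a,c$ | 16 | 24 | 0 | $n_{F33}$ | | $(m,n,0,0)$ | $(m'-n',m'+n',m'+n',m'-n')$ | $a,(u_0,u_2)$ | 16 | 24 | 0 | $n_{F33}$ | | $(m,n,0,0)$ | $(m'-n',m'-n',m'+n',m'+n')$ | $a,(u_0,u_3)$ | 16 | 24 | 0 | $n_{F33}$ | | $(m,n,0,0)$ | $(m',n',n',0)$ | $a$ | 8 | 48 | $n_{F34}$ | 0 | | $(m,n,0,0)$ | $(m',0,n',n')$ | $[1,1,0,0\mid0,0,1,1]$ | 16 | 24 | $n_{F34}$ | 0 | | $(m,n,0,0)$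 | $(m'-2n',m'+2n',m',m')$ | $a$ | 8 | 48 | 0 | $n_{F34}$ | | $(m,n,0,0)$ | $(-m'-2n',m',m'-2n',m')$ | $a$ | 8 | 48 | 0 | $n_{F34}$ | | $(m,n,0,0)$ | $(m'-2n',m',m'+2n',m')$ | $a$ | 8 | 48 | 0 | $n_{F34}$ | | $(m,n,0,0)$ | general | $a$ | 8 | 48 | $3n_{F35}$ | $6n_{F35}$ | | $(m,n,n,0)$ | $(m',n',n',0)$ | $[0,1,1,0\mid0,1,1,0]$ | 8 | 48 | $n_{F44}$ | 0 | | $(m,n,n,0)$ | $(m',0,n',n')$ | – | 4 | 96 | $n_{F44}$ | 0 | | $(m,n,n,0)$ | $(m'-2n',m'+2n',m',m')$ | – | 4 | 96 | 0 | $n_{F44}$ | | $(m,n,n,0)$ | $(-m'-2n',m',m',m'-2n')$ | – | 4 | 96 | 0 | $n_{F44}$ | | $(m,n,n,0)$ | $(m'-2n',m',m'+2n',m')$ | – | 4 | 96 | 0 | $n_{F44}$ | | $(m,n,n,0)$ | general | – | 4 | 96 | $3n_{F45}$ | $6n_{F45}$ | | general | general | – | 4 | 96 | $3n_{F55}$ |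 $6n_{F55}$ | The same holds with $p,q$ and the components of the generators interchanged. Call $(p,q)$ *normalised* if the exponents of $2$ in $|p|^2$ and in $|q|^2$ are even. Every admissible pair is P-equivalent to a normalised pair of one of the rows, or to the interchange of one. (4) For every admissible pair $\Sigma_F$ is odd and $\Sigma_P\in\{\Sigma_F,2\Sigma_F\}$. For every $\sigma$ there are only finitely many F-classes and P-classes with $\Sigma_F=\sigma$. One has $n_{Fij}=n_{Fji}$; $n_{F00}$ is $1$ for $\sigma=1$ and $0$ otherwise; $n_{F11}$ is $1$ for $\sigma=3$ and $0$ otherwise. For each row, the number of P-classes that contain a normalised admissible pair of that row and have $\Sigma_F=\sigma$ is $N_1(\sigma)$ for $\Sigma_P=\Sigma_F$ and $N_2(\sigma)$ for $\Sigma_P=2\Sigma_F$; the same holds for the interchanged pairs. For each type $(i,j)$ with $i\le j$, the number of all P-classes of admissible pairs of type $(i,j)$ with $\Sigma_F=\sigma$ and $\Sigma_P=\Sigma_F$ (respectively $\Sigma_P=2\Sigma_F$) is the sum of $N_1(\sigma)$ (respectively $N_2(\sigma)$) over the rows of that type, and likewise for type $(j,i)$. -/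

import Mathlib

open scoped Quaternion

namespace Hypercubic

noncomputable section

/-! ### The lattices, rotations and coincidence indices

Four-dimensional Euclidean space is the space `ℍ[ℝ]` of real quaternions with its inner product,
`(a, b, c, d)` standing for `a + b i + c j + d k`. -/

/-- An integral quaternion regarded as a point of `ℝ⁴`. -/
def ofInt (q : ℍ[ℤ]) : ℍ[ℝ] := ⟨q.re, q.imI, q.imJ, q.imK⟩

theorem ofInt_re (q : ℍ[ℤ]) : (ofInt q).re = q.re := rfl

theorem ofInt_imI (q : ℍ[ℤ]) : (ofInt q).imI = q.imI := rfl

theorem ofInt_imJ (q : ℍ[ℤ]) : (ofInt q).imJ = q.imJ := rfl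

theorem ofInt_imK (q : ℍ[ℤ]) : (ofInt q).imK = q.imK := rfl

theorem ofInt_zero : ofInt 0 = 0 := by
  ext <;> simp [ofInt_re, ofInt_imI, ofInt_imJ, ofInt_imK]

theorem ofInt_add (a b : ℍ[ℤ]) : ofInt (a + b) = ofInt a + ofInt b := by
  ext <;> simp [ofInt_re, ofInt_imI, ofInt_imJ, ofInt_imK]

theorem ofInt_neg (a : ℍ[ℤ]) : ofInt (-a) = -ofInt a := by
  ext <;> simp [ofInt_re, ofInt_imI, ofInt_imJ, ofInt_imK]

/-- The primitive hypercubic lattice `ℤ⁴`. -/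
def latP : AddSubgroup ℍ[ℝ] where
  carrier := {x | ∃ q : ℍ[ℤ], x = ofInt q}
  zero_mem' := ⟨0, ofInt_zero.symm⟩
  add_mem' := by
    rintro _ _ ⟨a, rfl⟩ ⟨b, rfl⟩
    exact ⟨a + b, (ofInt_add a b).symm⟩
  neg_mem' := by
    rintro _ ⟨a, rfl⟩
    exact ⟨-a, (ofInt_neg a).symm⟩

/-- The centred hypercubic lattice `D₄`: the integral vectors of even squared length. -/
def latF : AddSubgroup ℍ[ℝ] where
  carrier := {x | ∃ q : ℍ[ℤ], Even (Quaternion.normSq q) ∧ x = ofInt q}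
  zero_mem' := ⟨0, by simp, ofInt_zero.symm⟩
  add_mem' := by
    rintro _ _ ⟨a, ⟨k, ha⟩, rfl⟩ ⟨b, ⟨l, hb⟩, rfl⟩
    refine ⟨a + b, ⟨k + l + (a.re * b.re + a.imI * b.imI + a.imJ * b.imJ + a.imK * b.imK), ?_⟩,
      (ofInt_add a b).symm⟩
    rw [Quaternion.normSq_def'] at ha hb ⊢
    simp only [Quaternion.re_add, Quaternion.imI_add, Quaternion.imJ_add, Quaternion.imK_add]
    linear_combination ha + hb
  neg_mem' := by
    rintro _ ⟨a, ha, rfl⟩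
    exact ⟨-a, by simpa using ha, (ofInt_neg a).symm⟩

/-- Linear isometries of `ℝ⁴`, a group under composition. -/
abbrev Iso4 := ℍ[ℝ] ≃ₗᵢ[ℝ] ℍ[ℝ]

/-- The image `R L` of a lattice. -/
def image (R : Iso4) (L : AddSubgroup ℍ[ℝ]) : AddSubgroup ℍ[ℝ] :=
  L.map (R.toLinearEquiv.toLinearMap.toAddMonoidHom)

theorem mem_image {R : Iso4} {L : AddSubgroup ℍ[ℝ]} {y : ℍ[ℝ]} :
    y ∈ image R L ↔ ∃ x ∈ L, R x = y := Iff.rfl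

theorem image_one (L : AddSubgroup ℍ[ℝ]) : image 1 L = L := by
  ext y
  simp [mem_image]

theorem image_mul (Q R : Iso4) (L : AddSubgroup ℍ[ℝ]) :
    image (Q * R) L = image Q (image R L) := by
  ext y
  simp [mem_image]

/-- The group of rotations (orientation preserving linear isometries) mapping `L` onto itself. -/
def symGroup (L : AddSubgroup ℍ[ℝ]) : Subgroup Iso4 where
  carrier := {Q | LinearMap.det Q.toLinearEquiv.toLinearMap = 1 ∧ image Q L = L}
  one_mem' := ⟨LinearMap.det_id, image_one L⟩
  mul_mem' := by
    rintro Q R ⟨hQ, hQL⟩ ⟨hR, hRL⟩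
    refine ⟨?_, by rw [image_mul, hRL, hQL]⟩
    have : (Q * R).toLinearEquiv.toLinearMap =
        Q.toLinearEquiv.toLinearMap * R.toLinearEquiv.toLinearMap := rfl
    rw [this, map_mul, hQ, hR, one_mul]
  inv_mem' := by
    rintro Q ⟨hQ, hQL⟩
    constructor
    · have h : Q⁻¹.toLinearEquiv.toLinearMap * Q.toLinearEquiv.toLinearMap = 1 := by
        ext1 x
        exact Q.symm_apply_apply x
      have h2 := congrArg LinearMap.det h
      rw [map_mul, hQ, mul_one, map_one] at h2
      exact h2
    · conv_lhs => rw [← hQL]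
      rw [← image_mul, inv_mul_cancel, image_one]

/-- The rotation symmetry group `G_P` of `ℤ⁴`. -/
def rotP : Subgroup Iso4 := symGroup latP

/-- The rotation symmetry group `G_F` of `D₄`. -/
def rotF : Subgroup Iso4 := symGroup latF

/-- The coincidence index `Σ(R)`: the index of `L ∩ R L` in `L` (`0` if the index is infinite). -/
def coincIndex (L : AddSubgroup ℍ[ℝ]) (R : Iso4) : ℕ := (L ⊓ image R L).relIndex L

/-- The double coset `G R G`, that is, the class of all `R'` with `R' = Q R Q'`, `Q, Q' ∈ G`. -/
def dcoset {A : Type*} [Group A] (G : Subgroup A) (a : A) : Set A :=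
  DoubleCoset.doubleCoset a (G : Set A) (G : Set A)

/-! ### Quaternion pairs -/

/-- `SU(2) × SU(2)`: pairs of quaternions of norm one. -/
abbrev Spin := unitary ℍ[ℝ] × unitary ℍ[ℝ]

/-- The double cover of `SO(4)`: the pair `(p, q)` acts by `x ↦ p x q̄`. -/
def rot : Spin →* Iso4 where
  toFun g := Unitary.mulLeft ℝ ℍ[ℝ] g.1 * Unitary.mulRight ℝ (star g.2)
  map_one' := by
    ext1 x
    simp
  map_mul' g h := by
    ext1 x
    simp [mul_assoc]

theorem rot_apply (g : Spin) (x : ℍ[ℝ]) : rot g x = (g.1 : ℍ[ℝ]) * x * star (g.2 : ℍ[ℝ]) := by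
  simp [rot, mul_assoc]

theorem normalize_mem {x : ℍ[ℝ]} (hx : x ≠ 0) : ‖x‖⁻¹ • x ∈ unitary ℍ[ℝ] := by
  have h : ‖x‖ ≠ 0 := norm_ne_zero_iff.mpr hx
  have h1 : Quaternion.normSq (‖x‖⁻¹ • x) = 1 := by
    rw [Quaternion.normSq_eq_norm_mul_self, norm_smul, norm_inv, norm_norm, inv_mul_cancel₀ h,
      one_mul]
  constructor
  · rw [Quaternion.star_mul_self, h1, Quaternion.coe_one]
  · rw [Quaternion.self_mul_star, h1, Quaternion.coe_one]

theorem ofInt_ne_zero {q : ℍ[ℤ]} (hq : q ≠ 0) : ofInt q ≠ 0 := by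
  intro h
  apply hq
  have h1 := congrArg QuaternionAlgebra.re h
  have h2 := congrArg QuaternionAlgebra.imI h
  have h3 := congrArg QuaternionAlgebra.imJ h
  have h4 := congrArg QuaternionAlgebra.imK h
  simp [ofInt] at h1 h2 h3 h4
  ext <;> simp [h1, h2, h3, h4]

open Classical in
/-- The integral quaternion `q ≠ 0` normalised to norm one (and `1` for `q = 0`). -/
def unit (q : ℍ[ℤ]) : unitary ℍ[ℝ] :=
  if h : q = 0 then 1 else ⟨‖ofInt q‖⁻¹ • ofInt q, normalize_mem (ofInt_ne_zero h)⟩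

/-- The normalised pair `(p / |p|, q / |q|)`. -/
def pair (p q : ℍ[ℤ]) : Spin := (unit p, unit q)

/-- The rotation `R(p, q) : x ↦ p x q̄ / |p q|`. -/
def R (p q : ℍ[ℤ]) : Iso4 := rot (pair p q)

/-- A pair of nonzero integral quaternions is admissible if `|p q|` is an integer. -/
def Admissible (p q : ℍ[ℤ]) : Prop :=
  p ≠ 0 ∧ q ≠ 0 ∧ IsSquare (Quaternion.normSq p * Quaternion.normSq q)

/-- The group of quaternion pairs that doubly covers `G_P`. -/
def coverP : Subgroup Spin := rotP.comap rot

/-- The group of quaternion pairs that doubly covers `G_F`. -/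
def coverF : Subgroup Spin := rotF.comap rot

/-- The double cover of `G_P ∩ R G_P R⁻¹`, where `R` is the rotation given by the pair `g`. -/
def stabP (g : Spin) : Subgroup Spin :=
  (rotP ⊓ rotP.map (MulAut.conj (rot g)).toMonoidHom).comap rot

/-! ### Equivalence types of quaternions -/

/-- The group of order 48 generated by the quaternions `(±1, 0, 0, 0)`, `(±1, ±1, 0, 0)/√2`,
`(±1, ±1, ±1, ±1)/2` and the permutations thereof. -/
def octa : Subgroup (unitary ℍ[ℝ]) :=
  Subgroup.closure {u | ∃ q : ℍ[ℤ], |q.re| ≤ 1 ∧ |q.imI| ≤ 1 ∧ |q.imJ| ≤ 1 ∧ |q.imK| ≤ 1 ∧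
    (Quaternion.normSq q = 1 ∨ Quaternion.normSq q = 2 ∨ Quaternion.normSq q = 4) ∧ u = unit q}

/-- Equivalence of (nonzero integral) quaternions, up to positive real factors. -/
def Sim (p q : ℍ[ℤ]) : Prop := ∃ s ∈ octa, ∃ s' ∈ octa, unit q = s * unit p * s'

/-- A two-parameter family of integral quaternions. -/
def fam (f : ℤ → ℤ → ℍ[ℤ]) : Set ℍ[ℤ] := {q | ∃ m n : ℤ, q = f m n}

/-- The canonical forms `(1,0,0,0)`, `(0,1,1,1)`, `(m,n,n,n)`, `(m,n,0,0)`, `(m,n,n,0)` and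
`(m,n,p,q)`, numbered from `0` to `5`. -/
def form : Fin 6 → Set ℍ[ℤ]
  | 0 => {⟨1, 0, 0, 0⟩}
  | 1 => {⟨0, 1, 1, 1⟩}
  | 2 => fam fun m n => ⟨m, n, n, n⟩
  | 3 => fam fun m n => ⟨m, n, 0, 0⟩
  | 4 => fam fun m n => ⟨m, n, n, 0⟩
  | 5 => Set.univ

/-- `q` has type `i` if `i` is the first canonical form that occurs among the quaternions
equivalent to `q`; so the degenerate members of a family are not counted to its type, and
type `5` consists of the quaternions that are not equivalent to any of the special forms. -/
def HasType (q : ℍ[ℤ]) (i : Fin 6) : Prop :=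
  q ≠ 0 ∧ IsLeast {k : Fin 6 | ∃ c ∈ form k, c ≠ 0 ∧ Sim q c} i

/-- The exponent of `2` in `|q|²` is even. For primitive `q` this says that `|q|²` is
odd or divisible by `4`. -/
def EvenTwo (q : ℍ[ℤ]) : Prop := Even (padicValInt 2 (Quaternion.normSq q))

/-! ### Equivalence classes -/

/-- The F-equivalence classes of the coincidence rotations `R(p, q)` with `p` of type `i`, `q` of
type `j` and `Σ_F = σ`. -/
def classesF (i j : Fin 6) (σ : ℕ) : Set (Set Iso4) :=
  {C | ∃ p q : ℍ[ℤ], Admissible p q ∧ HasType p i ∧ HasType q j ∧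
    coincIndex latF (R p q) = σ ∧ C = dcoset rotF (R p q)}

/-- The number `n_{Fij}` of F-inequivalent admissible pairs of type `(i, j)` with `Σ_F = σ`. -/
def nF (i j : Fin 6) (σ : ℕ) : ℕ := (classesF i j σ).ncard

/-- The P-equivalence classes of the coincidence rotations `R(p, q)` with `(p, q)` an admissible
pair in `S`, with `Σ_F = σ` and `Σ_P = τ`. -/
def classesP (S : Set (ℍ[ℤ] × ℍ[ℤ])) (σ τ : ℕ) : Set (Set Iso4) :=
  {C | ∃ p q : ℍ[ℤ], (p, q) ∈ S ∧ Admissible p q ∧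
    coincIndex latF (R p q) = σ ∧ coincIndex latP (R p q) = τ ∧ C = dcoset rotP (R p q)}

/-- All pairs `(p, q)` with `p` of type `i` and `q` of type `j`. -/
def typePairs (i j : Fin 6) : Set (ℍ[ℤ] × ℍ[ℤ]) := {x | HasType x.1 i ∧ HasType x.2 j}

/-! ### The tables -/

/-- The pairs `s_0 = 1`, `s_1 = (u₀, (1,1,1,1)/2)`, `s_2 = (u₀, (-1,1,1,1)/2)`. -/
def s : Fin 3 → Spin
  | 0 => 1
  | 1 => pair 1 ⟨1, 1, 1, 1⟩
  | 2 => pair 1 ⟨-1, 1, 1, 1⟩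

/-- A row of the splitting table: for `g = (p, q)` with `p` of canonical form `i` and `q` of
canonical form `j`, the entry `(a, b)` of `words` stands for the double coset of `s_a g s_b`. -/
structure SplitRow where
  i : Fin 6
  j : Fin 6
  words : List (Fin 3 × Fin 3)

def splitTable : List SplitRow :=
  let two := [(0, 0), (0, 1)]
  let three := [(0, 0), (0, 1), (0, 2)]
  let five := [(0, 0), (0, 1), (1, 0), (1, 1), (1, 2)]
  let nine := [(0, 0), (0, 1), (0, 2), (1, 0), (2, 0), (1, 1), (1, 2), (2, 1), (2, 2)]
  [⟨0, 0, two⟩, ⟨0, 2, three⟩, ⟨0, 3, two⟩, ⟨0, 4, two⟩, ⟨0, 5, three⟩,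
   ⟨1, 1, two⟩, ⟨1, 2, three⟩, ⟨1, 3, two⟩, ⟨1, 4, two⟩, ⟨1, 5, three⟩,
   ⟨2, 2, three⟩, ⟨2, 3, three⟩, ⟨2, 4, three⟩, ⟨2, 5, three⟩,
   ⟨3, 3, five⟩, ⟨3, 4, [(0, 0), (0, 1), (0, 2), (1, 0), (1, 2)]⟩, ⟨3, 5, nine⟩,
   ⟨4, 4, five⟩, ⟨4, 5, nine⟩, ⟨5, 5, nine⟩]

/-- The canonical pairs to which a row of the splitting table applies. -/
def SplitRow.pairs (r : SplitRow) : Set (ℍ[ℤ] × ℍ[ℤ]) :=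
  {x | x.1 ∈ form r.i ∧ x.2 ∈ form r.j} ∩ typePairs r.i r.j

/-- `G_F g G_F` (lifted to quaternion pairs) is the disjoint union of the double cosets of
`G_P` that contain `t_a g t_b`, where `(a, b)` runs through the list. -/
def SplitsAs (g : Spin) (t : Fin 3 → Spin) (words : List (Fin 3 × Fin 3)) : Prop :=
  dcoset coverF g = {x | ∃ w ∈ words, x ∈ dcoset coverP (t w.1 * g * t w.2)} ∧
  ∀ w ∈ words, ∀ w' ∈ words, w ≠ w' →
    Disjoint (dcoset coverP (t w.1 * g * t w.2)) (dcoset coverP (t w'.1 * g * t w'.2))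

/-- A row of the table of P-classes. `formP`, `formQ`: the forms of `p` and `q`, of types `i` and
`j`; `gens`: the non-trivial generators of the stabiliser, whose order is `order`;
`192 * mult`: the number of equivalent rotations; `countEq`, `countDouble`: the numbers of
inequivalent pairs with `Σ_P = Σ_F` and `Σ_P = 2 Σ_F`, as multiples of `n_{Fij}`. -/
structure PRow where
  i : Fin 6
  j : Fin 6
  formP : Set ℍ[ℤ]
  formQ : Set ℍ[ℤ]
  gens : Set Spin
  order : ℕ
  mult : ℕ
  countEq : ℕ
  countDouble : ℕ

/-- Since only directions matter, forms with half-integral entries are multiplied by `2`. -/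
def tableP : List PRow :=
  let u1 : ℍ[ℤ] := ⟨0, 1, 0, 0⟩
  let u2 : ℍ[ℤ] := ⟨0, 0, 1, 0⟩
  let u3 : ℍ[ℤ] := ⟨0, 0, 0, 1⟩
  let w : ℍ[ℤ] := ⟨1, 1, 1, 1⟩
  let a := pair u1 1
  let b := pair u2 1
  let ww := pair w w
  let form3a := fam fun m n => ⟨m - n, m + n, m - n, m + n⟩
  let form4a := fam fun m n => ⟨m - 2 * n, m + 2 * n, m, m⟩
  -- p = (1,0,0,0)
  [⟨0, 0, form 0, form 0, coverP, 384, 1, 1, 0⟩,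
   ⟨0, 0, form 0, {w}, {a, b, pair 1 u1, pair 1 u2, ww}, 192, 2, 0, 1⟩,
   ⟨0, 2, form 0, form 2, {a, b, ww}, 48, 8, 1, 2⟩,
   ⟨0, 3, form 0, form 3, {a, b, pair ⟨1, 1, 0, 0⟩ ⟨1, 1, 0, 0⟩}, 64, 6, 1, 0⟩,
   ⟨0, 3, form 0, form3a, {a, b, pair 1 u1}, 32, 12, 0, 1⟩,
   ⟨0, 4, form 0, form 4, {a, b, pair ⟨0, 1, 1, 0⟩ ⟨0, 1, 1, 0⟩}, 32, 12, 1, 0⟩,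
   ⟨0, 4, form 0, form4a, {a, b}, 16, 24, 0, 1⟩,
   ⟨0, 5, form 0, form 5, {a, b}, 16, 24, 1, 2⟩,
   -- p = (0,1,1,1); no pair of type (1,3) is admissible, so that the counts there are zero
   ⟨1, 1, form 1, form 1, {ww, pair ⟨0, 1, -1, 0⟩ ⟨0, 1, -1, 0⟩}, 24, 16, 1, 0⟩,
   ⟨1, 1, form 1, {⟨3, 1, 1, 1⟩}, {ww}, 12, 32, 0, 1⟩,
   ⟨1, 2, form 1, form 2, {ww}, 12, 32, 1, 2⟩,
   ⟨1, 3, form 1, form 3, {pair ⟨0, 0, 1, -1⟩ ⟨1, 1, 0, 0⟩}, 16, 24, 0, 0⟩,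
   ⟨1, 3, form 1, form3a, {pair 1 u1}, 8, 48, 0, 0⟩,
   ⟨1, 4, form 1, form 4, {pair ⟨0, 1, -1, 0⟩ ⟨0, 1, 1, 0⟩}, 8, 48, 1, 0⟩,
   ⟨1, 4, form 1, form4a, ∅, 4, 96, 0, 1⟩,
   ⟨1, 5, form 1, form 5, ∅, 4, 96, 1, 2⟩,
   -- p = (m,n,n,n)
   ⟨2, 2, form 2, form 2, {ww}, 12, 32, 1, 2⟩,
   ⟨2, 3, form 2, form 3, {pair 1 u1}, 8, 48, 1, 2⟩,
   ⟨2, 4, form 2, form 4, ∅, 4, 96, 1, 2⟩,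
   ⟨2, 5, form 2, form 5, ∅, 4, 96, 1, 2⟩,
   -- p = (m,n,0,0)
   ⟨3, 3, form 3, form 3,
     {pair ⟨1, 1, 0, 0⟩ ⟨1, 1, 0, 0⟩, pair ⟨1, 1, 0, 0⟩ ⟨1, -1, 0, 0⟩}, 32, 12, 1, 0⟩,
   ⟨3, 3, form 3, fam fun m n => ⟨m, 0, n, 0⟩, {a, pair 1 u2}, 16, 24, 1, 0⟩,
   ⟨3, 3, form 3, form3a, {a, pair 1 u1}, 16, 24, 0, 1⟩,
   ⟨3, 3, form 3, fam fun m n => ⟨m - n, m + n, m + n, m - n⟩, {a, pair 1 u2}, 16, 24, 0, 1⟩,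
   ⟨3, 3, form 3, fam fun m n => ⟨m - n, m - n, m + n, m + n⟩, {a, pair 1 u3}, 16, 24, 0, 1⟩,
   ⟨3, 4, form 3, form 4, {a}, 8, 48, 1, 0⟩,
   ⟨3, 4, form 3, fam fun m n => ⟨m, 0, n, n⟩, {pair ⟨1, 1, 0, 0⟩ ⟨0, 0, 1, 1⟩}, 16, 24, 1, 0⟩,
   ⟨3, 4, form 3, form4a, {a}, 8, 48, 0, 1⟩,
   ⟨3, 4, form 3, fam fun m n => ⟨-m - 2 * n, m, m - 2 * n, m⟩, {a}, 8, 48, 0, 1⟩,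
   ⟨3, 4, form 3, fam fun m n => ⟨m - 2 * n, m, m + 2 * n, m⟩, {a}, 8, 48, 0, 1⟩,
   ⟨3, 5, form 3, form 5, {a}, 8, 48, 3, 6⟩,
   -- p = (m,n,n,0)
   ⟨4, 4, form 4, form 4, {pair ⟨0, 1, 1, 0⟩ ⟨0, 1, 1, 0⟩}, 8, 48, 1, 0⟩,
   ⟨4, 4, form 4, fam fun m n => ⟨m, 0, n, n⟩, ∅, 4, 96, 1, 0⟩,
   ⟨4, 4, form 4, form4a, ∅, 4, 96, 0, 1⟩,
   ⟨4, 4, form 4, fam fun m n => ⟨-m - 2 * n, m, m, m - 2 * n⟩, ∅, 4, 96, 0, 1⟩,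
   ⟨4, 4, form 4, fam fun m n => ⟨m - 2 * n, m, m + 2 * n, m⟩, ∅, 4, 96, 0, 1⟩,
   ⟨4, 5, form 4, form 5, ∅, 4, 96, 3, 6⟩,
   -- both general
   ⟨5, 5, form 5, form 5, ∅, 4, 96, 3, 6⟩]

/-- The pairs described by a row (degenerate members of the families being excluded). -/
def PRow.pairs (r : PRow) : Set (ℍ[ℤ] × ℍ[ℤ]) :=
  {x | x.1 ∈ r.formP ∧ x.2 ∈ r.formQ} ∩ typePairs r.i r.j

/-- The pairs of a row whose members have an even power of `2` in their squared norms. -/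
def PRow.normPairs (r : PRow) : Set (ℍ[ℤ] × ℍ[ℤ]) :=
  {x | x ∈ r.pairs ∧ EvenTwo x.1 ∧ EvenTwo x.2}

/-- The generators of a row together with the trivial ones, `(-1, 1)` and `(1, -1)`. -/
def PRow.allGens (r : PRow) : Set Spin := r.gens ∪ {pair (-1) 1, pair 1 (-1)}

/-- The number of P-classes of type `(i, j)` with `Σ_P = Σ_F`, as a multiple of `n_{Fij}`:
the sum over the rows of that type. -/
def totalEq (i j : Fin 6) : ℕ :=
  ((tableP.filter fun r => r.i = i ∧ r.j = j).map PRow.countEq).sum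

/-- The same for `Σ_P = 2 Σ_F`. -/
def totalDouble (i j : Fin 6) : ℕ :=
  ((tableP.filter fun r => r.i = i ∧ r.j = j).map PRow.countDouble).sum

end

end Hypercubic

namespace Hypercubic

/-! ### Directions of integral quaternions -/

/-! Modulo the quaternion group Q₈ the group `octa` of order 48 has quotient S₃, realised by
`octaClass` on integral representatives: norms 1 and 4 give the rotations of S₃, norm 2 the
reflections. A symmetry of ℤ⁴ or D₄ is determined by the images of the four units (of their doubles,
for D₄). This gives that `coverP` consists of the pairs in `octa × octa` with equal classes in S₃,
and `coverF` of those with classes of equal parity (`mem_coverP_iff`, `mem_coverF_iff`). Hence the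
index is 3, with the powers of ω as coset representatives.

Splitting and stabilisers. For a canonical c of type i, the elements s of `octa` with c⁻¹ s c again
in `octa` depend only on i, and the conjugate has the same class as s (`mem_stabList_of_unit`,
`stabClass_of_unit`). The reason: s c = c t is a linear condition on the parameters of c, and every
solution beyond the generic ones forces a ratio of parameters for which c is equivalent to a simpler
form. Two words s_a g s_b and s_a' g s_b' therefore generate the same P-double coset exactly when an
equation in S₃ is solvable (`WordEquiv`), so that splitting becomes a finite check
(`splitTable_words`). The same information lists each stabiliser, and orbit counting gives the size
of the double coset (`ncard_dcoset_mul_card`).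

Indices. If m = |pq| = 2^k N with N odd, then N R(p,q) maps D₄ into itself, because a quaternion
whose norm is divisible by 2·4^k is 2^k times one of even norm. So Σ_F is odd. Computing the index
of D₄ ∩ R D₄ in ℤ⁴ in two ways gives Σ_P = Σ_F or 2Σ_F, the former exactly when ℤ⁴ ∩ Rℤ⁴ contains a
vector of odd norm (`coincIndex_latP_mul`). To decide which, the direction of a quaternion with even
2-exponent is written as z ω^k with z of odd norm (`exists_par`). The indices agree iff the
exponents of the two components agree (`coincIndex_latP_of_par`). A word adds a + b to the second
exponent, so one of the three values of a + b modulo 3 gives Σ_P = Σ_F and the other two give 2Σ_F.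

Counting. Every admissible pair is F-equivalent to a pair of canonical quaternions with even
2-exponents (`exists_canon_pair`). The P-classes inside an F-class are the words of the splitting
table. For types 2 and 5 (`FreeType`) a word can be absorbed into the canonical quaternion, so the
single row of that type meets every P-class. For the other types the words are rigid
(`Canon.class_eq`), and each row meets only the words equivalent to its label. Counting the fibres
of the map from P-classes to F-classes (`ncard_classesP`) yields the multiples of n_F in the table.
Finiteness follows because σR⁻¹ sends each doubled unit to a vector of D₄ of norm 4σ². -/

theorem ofInt_mul (a b : ℍ[ℤ]) : ofInt (a * b) = ofInt a * ofInt b := by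
  ext <;> simp [ofInt_re, ofInt_imI, ofInt_imJ, ofInt_imK]

theorem ofInt_one : ofInt 1 = 1 := by
  ext <;> simp [ofInt_re, ofInt_imI, ofInt_imJ, ofInt_imK]

theorem ofInt_star (a : ℍ[ℤ]) : ofInt (star a) = star (ofInt a) := by
  ext <;> simp [ofInt_re, ofInt_imI, ofInt_imJ, ofInt_imK]

theorem ofInt_zsmul (n : ℤ) (a : ℍ[ℤ]) : ofInt (n • a) = (n : ℝ) • ofInt a := by
  ext <;> simp [ofInt_re, ofInt_imI, ofInt_imJ, ofInt_imK]

theorem ofInt_injective : Function.Injective ofInt := by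
  intro a b h
  have h1 := congrArg QuaternionAlgebra.re h
  have h2 := congrArg QuaternionAlgebra.imI h
  have h3 := congrArg QuaternionAlgebra.imJ h
  have h4 := congrArg QuaternionAlgebra.imK h
  simp only [ofInt_re, ofInt_imI, ofInt_imJ, ofInt_imK, Int.cast_inj] at h1 h2 h3 h4
  exact QuaternionAlgebra.ext h1 h2 h3 h4

theorem normSq_ofInt (q : ℍ[ℤ]) :
    Quaternion.normSq (ofInt q) = (Quaternion.normSq q : ℤ) := by
  rw [Quaternion.normSq_def', Quaternion.normSq_def']
  simp [ofInt_re, ofInt_imI, ofInt_imJ, ofInt_imK]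

theorem norm_ofInt_sq (q : ℍ[ℤ]) : ‖ofInt q‖ ^ 2 = (Quaternion.normSq q : ℤ) := by
  rw [← normSq_ofInt, Quaternion.normSq_eq_norm_mul_self, sq]

theorem normSq_pos {q : ℍ[ℤ]} (hq : q ≠ 0) : 0 < Quaternion.normSq q := by
  have := norm_pos_iff.mpr (ofInt_ne_zero hq)
  have h2 : (0 : ℝ) < (Quaternion.normSq q : ℤ) := by
    rw [← norm_ofInt_sq]; positivity
  exact_mod_cast h2

theorem normSq_eq_zero_iff {q : ℍ[ℤ]} : Quaternion.normSq q = 0 ↔ q = 0 := by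
  constructor
  · intro h
    by_contra hq
    exact (normSq_pos hq).ne' h
  · rintro rfl
    simp

theorem quat_mul_ne_zero {p q : ℍ[ℤ]} (hp : p ≠ 0) (hq : q ≠ 0) : p * q ≠ 0 := by
  intro h
  have := normSq_eq_zero_iff.2 h
  rw [map_mul] at this
  exact mul_ne_zero (normSq_pos hp).ne' (normSq_pos hq).ne' this

theorem quat_smul_ne_zero {n : ℤ} {q : ℍ[ℤ]} (hn : n ≠ 0) (hq : q ≠ 0) : n • q ≠ 0 := by
  intro h
  have := congrArg ofInt h
  rw [ofInt_zsmul, ofInt_zero, smul_eq_zero] at this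
  rcases this with h | h
  · exact hn (by exact_mod_cast h)
  · exact ofInt_ne_zero hq h

theorem zsmul_eq_mk (n : ℤ) (q : ℍ[ℤ]) :
    n • q = ⟨n * q.re, n * q.imI, n * q.imJ, n * q.imK⟩ := by
  ext <;> simp

theorem normSq_zsmul (n : ℤ) (q : ℍ[ℤ]) :
    Quaternion.normSq (n • q) = n ^ 2 * Quaternion.normSq q := by
  rw [Quaternion.normSq_def', Quaternion.normSq_def']
  simp
  ring

theorem star_quat_ne_zero {q : ℍ[ℤ]} (hq : q ≠ 0) : star q ≠ 0 := by
  simpa using hq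

theorem coe_unit {q : ℍ[ℤ]} (hq : q ≠ 0) : (unit q : ℍ[ℝ]) = ‖ofInt q‖⁻¹ • ofInt q := by
  rw [unit, dif_neg hq]

theorem norm_smul_unit {q : ℍ[ℤ]} (hq : q ≠ 0) : ‖ofInt q‖ • (unit q : ℍ[ℝ]) = ofInt q := by
  rw [coe_unit hq, smul_smul, mul_inv_cancel₀ (norm_ne_zero_iff.mpr (ofInt_ne_zero hq)), one_smul]

theorem unit_one : unit 1 = 1 := by
  apply Subtype.ext
  rw [coe_unit one_ne_zero, ofInt_one]
  simp

theorem unit_mul {p q : ℍ[ℤ]} (hp : p ≠ 0) (hq : q ≠ 0) : unit (p * q) = unit p * unit q := by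
  apply Subtype.ext
  rw [coe_unit (quat_mul_ne_zero hp hq), Submonoid.coe_mul, coe_unit hp, coe_unit hq, ofInt_mul,
    norm_mul, smul_mul_smul_comm, mul_inv]

theorem unit_smul {n : ℤ} {q : ℍ[ℤ]} (hn : 0 < n) (hq : q ≠ 0) : unit (n • q) = unit q := by
  apply Subtype.ext
  rw [coe_unit (quat_smul_ne_zero hn.ne' hq), coe_unit hq, ofInt_zsmul, norm_smul, smul_smul,
    mul_inv, mul_right_comm]
  have h : ‖(n : ℝ)‖ = n := by simp [hn.le]
  have h2 : (n : ℝ) ≠ 0 := by exact_mod_cast hn.ne'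
  rw [h, inv_mul_cancel₀ h2, one_mul]

theorem unit_star {q : ℍ[ℤ]} (hq : q ≠ 0) : unit (star q) = (unit q)⁻¹ := by
  apply Subtype.ext
  rw [← Unitary.star_eq_inv, Unitary.coe_star, coe_unit hq, coe_unit (star_quat_ne_zero hq),
    ofInt_star, norm_star, Quaternion.star_smul]

theorem unit_neg {q : ℍ[ℤ]} (hq : q ≠ 0) : unit (-q) = -unit q := by
  apply Subtype.ext
  rw [coe_unit (neg_ne_zero.mpr hq), Unitary.coe_neg, coe_unit hq, ofInt_neg, norm_neg, smul_neg]

theorem unit_eq_of_smul {p q : ℍ[ℤ]} (hp : p ≠ 0) {m n : ℤ} (hm : 0 < m) (hn : 0 < n)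
    (h : m • p = n • q) : unit p = unit q := by
  have hq : q ≠ 0 := by
    rintro rfl
    exact quat_smul_ne_zero hm.ne' hp (by simpa using h)
  rw [← unit_smul hm hp, h, unit_smul hn hq]

/-- A nonzero coordinate f of p eliminates the irrational norms: f(q)·p = f(p)·q. Both factors have
the same sign, so they can be made positive. -/
theorem exists_smul_of_unit_eq {p q : ℍ[ℤ]} (hp : p ≠ 0) (hq : q ≠ 0) (h : unit p = unit q) :
    ∃ m n : ℤ, 0 < m ∧ 0 < n ∧ m • p = n • q := by
  have hP : 0 < ‖ofInt p‖ := norm_pos_iff.mpr (ofInt_ne_zero hp)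
  have hQ : 0 < ‖ofInt q‖ := norm_pos_iff.mpr (ofInt_ne_zero hq)
  have key : ‖ofInt q‖ • ofInt p = ‖ofInt p‖ • ofInt q := by
    conv_lhs => rw [← norm_smul_unit hp, h]
    conv_rhs => rw [← norm_smul_unit hq]
    rw [smul_comm]
  -- cross multiplication with the real numbers replaced by coordinates
  have aux : ∀ f : ℍ[ℤ] → ℤ, ∀ g : ℍ[ℝ] →ₗ[ℝ] ℝ, (∀ x, g (ofInt x) = f x) → f p ≠ 0 →
      ∃ m n : ℤ, 0 < m ∧ 0 < n ∧ m • p = n • q := by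
    intro f g hg hf
    have h1 : ‖ofInt q‖ * (f p : ℝ) = ‖ofInt p‖ * (f q : ℝ) := by
      have := congrArg g key
      simpa [hg] using this
    have hfp : (f p : ℝ) ≠ 0 := by exact_mod_cast hf
    have hsm : (f q : ℝ) • ofInt p = (f p : ℝ) • ofInt q := by
      have : (‖ofInt p‖ * (f q : ℝ)) • ofInt p = (f p * ‖ofInt p‖ : ℝ) • ofInt q := by
        rw [← h1, mul_comm, mul_smul, key, smul_smul]
      rw [mul_smul, mul_comm, mul_smul] at this
      exact smul_right_injective _ hP.ne' this
    have hz : f q • p = f p • q := by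
      apply ofInt_injective
      rw [ofInt_zsmul, ofInt_zsmul, hsm]
    rcases lt_or_gt_of_ne hf with h0 | h0
    · refine ⟨-f q, -f p, ?_, by omega, by rw [neg_smul, neg_smul, hz]⟩
      have h2 : (f p : ℝ) < 0 := by exact_mod_cast h0
      have h3 : (f q : ℝ) < 0 := by
        by_contra hc
        push Not at hc
        have := mul_nonneg hP.le hc
        have := mul_neg_of_pos_of_neg hQ h2
        linarith
      have : f q < 0 := by exact_mod_cast h3
      omega
    · refine ⟨f q, f p, ?_, h0, hz⟩
      have h2 : 0 < (f p : ℝ) := by exact_mod_cast h0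
      have h3 : 0 < (f q : ℝ) := by
        have := mul_pos hQ h2
        rw [h1] at this
        exact (mul_pos_iff_of_pos_left hP).mp this
      exact_mod_cast h3
  by_cases h1 : p.re = 0
  · by_cases h2 : p.imI = 0
    · by_cases h3 : p.imJ = 0
      · by_cases h4 : p.imK = 0
        · exact absurd (QuaternionAlgebra.ext h1 h2 h3 h4) hp
        · exact aux (·.imK) ⟨⟨fun x => x.imK, fun _ _ => rfl⟩, fun _ _ => by simp⟩
            (fun _ => rfl) h4
      · exact aux (·.imJ) ⟨⟨fun x => x.imJ, fun _ _ => rfl⟩, fun _ _ => by simp⟩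
          (fun _ => rfl) h3
    · exact aux (·.imI) ⟨⟨fun x => x.imI, fun _ _ => rfl⟩, fun _ _ => by simp⟩
        (fun _ => rfl) h2
  · exact aux (·.re) ⟨⟨fun x => x.re, fun _ _ => rfl⟩, fun _ _ => by simp⟩ (fun _ => rfl) h1

theorem unit_ext {u v : unitary ℍ[ℝ]} (h : (u : ℍ[ℝ]) = v) : u = v := Subtype.ext h

/-! ### The finite group `octa` and its quotient by the quaternion group -/

/-- Removal of a common factor `2`. -/
def half (q : ℍ[ℤ]) : ℍ[ℤ] :=
  if q.re % 2 = 0 ∧ q.imI % 2 = 0 ∧ q.imJ % 2 = 0 ∧ q.imK % 2 = 0 then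
    ⟨q.re / 2, q.imI / 2, q.imJ / 2, q.imK / 2⟩ else q

theorem exists_smul_half (q : ℍ[ℤ]) : ∃ n : ℤ, 0 < n ∧ q = n • half q := by
  by_cases h : q.re % 2 = 0 ∧ q.imI % 2 = 0 ∧ q.imJ % 2 = 0 ∧ q.imK % 2 = 0
  · refine ⟨2, by norm_num, ?_⟩
    obtain ⟨h1, h2, h3, h4⟩ := h
    have e : half q = ⟨q.re / 2, q.imI / 2, q.imJ / 2, q.imK / 2⟩ := if_pos ⟨h1, h2, h3, h4⟩
    rw [e]
    refine Eq.trans ?_ (zsmul_eq_mk 2 _).symm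
    apply QuaternionAlgebra.ext <;> dsimp only <;> omega
  · exact ⟨1, by norm_num, by rw [one_smul]; exact (if_neg h).symm⟩

theorem unit_half {q : ℍ[ℤ]} (hq : q ≠ 0) : half q ≠ 0 ∧ unit (half q) = unit q := by
  obtain ⟨n, hn, h⟩ := exists_smul_half q
  have h0 : half q ≠ 0 := by
    intro h1
    rw [h1, smul_zero] at h
    exact hq h
  exact ⟨h0, by conv_rhs => rw [h, unit_smul hn h0]⟩

/-- Decidable form of the squared norm. -/
def nrm (q : ℍ[ℤ]) : ℤ := q.re * q.re + q.imI * q.imI + q.imJ * q.imJ + q.imK * q.imK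

theorem normSq_eq_nrm (q : ℍ[ℤ]) : Quaternion.normSq q = nrm q := by
  rw [Quaternion.normSq_def', nrm]
  ring

instance : DecidableEq ℍ[ℤ] := fun x y =>
  decidable_of_iff (x.re = y.re ∧ x.imI = y.imI ∧ x.imJ = y.imJ ∧ x.imK = y.imK)
    QuaternionAlgebra.ext_iff.symm

/-- Integral representatives of the elements of `octa`. -/
def octaList : List ℍ[ℤ] :=
  [1, -1, 0].flatMap fun a => [1, -1, 0].flatMap fun b => [1, -1, 0].flatMap fun c =>
    [1, -1, 0].filterMap fun d =>
      if a * a + b * b + c * c + d * d = 1 ∨ a * a + b * b + c * c + d * d = 2 ∨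
        a * a + b * b + c * c + d * d = 4 then some ⟨a, b, c, d⟩ else none

/-- Membership in `octaList` in terms of coordinates. -/
def InOctaList (q : ℍ[ℤ]) : Prop :=
  |q.re| ≤ 1 ∧ |q.imI| ≤ 1 ∧ |q.imJ| ≤ 1 ∧ |q.imK| ≤ 1 ∧ (nrm q = 1 ∨ nrm q = 2 ∨ nrm q = 4)

instance (q : ℍ[ℤ]) : Decidable (InOctaList q) := by
  unfold InOctaList; infer_instance

theorem mem_octaList_iff {q : ℍ[ℤ]} : q ∈ octaList ↔ InOctaList q := by
  have h1 : ∀ a : ℤ, |a| ≤ 1 ↔ a ∈ ([1, -1, 0] : List ℤ) := by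
    intro a
    rw [abs_le]
    simp only [List.mem_cons, List.not_mem_nil, or_false]
    omega
  constructor
  · intro h
    simp only [octaList, List.mem_flatMap, List.mem_filterMap] at h
    obtain ⟨a, ha, b, hb, c, hc, d, hd, hq⟩ := h
    split_ifs at hq with hn
    obtain rfl := Option.some.inj hq
    exact ⟨(h1 a).2 ha, (h1 b).2 hb, (h1 c).2 hc, (h1 d).2 hd, hn⟩
  · rintro ⟨ha, hb, hc, hd, hn⟩
    simp only [octaList, List.mem_flatMap, List.mem_filterMap]
    refine ⟨q.re, (h1 _).1 ha, q.imI, (h1 _).1 hb, q.imJ, (h1 _).1 hc, q.imK, (h1 _).1 hd, ?_⟩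
    exact if_pos hn

theorem octaList_nodup : octaList.Nodup := by decide +kernel

theorem ne_zero_of_mem_octaList {q : ℍ[ℤ]} (h : q ∈ octaList) : q ≠ 0 := by
  rintro rfl
  rw [mem_octaList_iff] at h
  obtain ⟨-, -, -, -, h⟩ := h
  simp [nrm] at h

/-- The class of an element of `octaList` modulo the quaternion group, as an element of `S₃`. -/
def octaClass (q : ℍ[ℤ]) : DihedralGroup 3 :=
  if nrm q = 1 then .r 0
  else if nrm q = 4 then (if q.re * q.imI * q.imJ * q.imK = 1 then .r 1 else .r 2)
  else if q.re * q.re = q.imI * q.imI then .sr 0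
  else if q.re * q.re = q.imJ * q.imJ then .sr 1
  else .sr 2

/-- `octaClass` is a homomorphism onto S₃. A product of two representatives has norm at most 16, and
two halvings bring it back to a representative. -/
theorem half_half_mul_mem : ∀ x ∈ octaList, ∀ y ∈ octaList, InOctaList (half (half (x * y))) ∧
    octaClass (half (half (x * y))) = octaClass x * octaClass y := by
  decide +kernel

theorem star_mem_octaList : ∀ x ∈ octaList, InOctaList (star x) ∧
    octaClass (star x) = (octaClass x)⁻¹ := by
  decide +kernel

/-- All coordinates lie in {-1, 0, 1}, so a positive proportionality between two such nonzero
vectors has ratio 1. -/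
theorem unit_injOn_octaList {p q : ℍ[ℤ]} (hp : p ∈ octaList) (hq : q ∈ octaList)
    (h : unit p = unit q) : p = q := by
  have hp0 := ne_zero_of_mem_octaList hp
  have hq0 := ne_zero_of_mem_octaList hq
  obtain ⟨m, n, hm, hn, hmn⟩ := exists_smul_of_unit_eq hp0 hq0 h
  rw [mem_octaList_iff] at hp hq
  have aux : ∀ a b : ℤ, |a| ≤ 1 → |b| ≤ 1 → m * a = n * b → m = n ∨ a = 0 := by
    intro a b ha hb hab
    rw [abs_le] at ha hb
    have ha' : a = -1 ∨ a = 0 ∨ a = 1 := by omega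
    have hb' : b = -1 ∨ b = 0 ∨ b = 1 := by omega
    rcases ha' with rfl | rfl | rfl <;> rcases hb' with rfl | rfl | rfl <;> simp at hab ⊢ <;> omega
  have key : m = n := by
    by_contra hne
    apply hp0
    obtain ⟨a1, a2, a3, a4, -⟩ := hp
    obtain ⟨b1, b2, b3, b4, -⟩ := hq
    have e1 := congrArg QuaternionAlgebra.re hmn
    have e2 := congrArg QuaternionAlgebra.imI hmn
    have e3 := congrArg QuaternionAlgebra.imJ hmn
    have e4 := congrArg QuaternionAlgebra.imK hmn
    simp at e1 e2 e3 e4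
    exact QuaternionAlgebra.ext ((aux _ _ a1 b1 e1).resolve_left hne)
      ((aux _ _ a2 b2 e2).resolve_left hne) ((aux _ _ a3 b3 e3).resolve_left hne)
      ((aux _ _ a4 b4 e4).resolve_left hne)
  subst key
  have := congrArg ofInt hmn
  rw [ofInt_zsmul, ofInt_zsmul] at this
  exact ofInt_injective (smul_right_injective _ (by exact_mod_cast hm.ne') this)

/-- `u` is an element of `octa` of class `d`. -/
def Oct (u : unitary ℍ[ℝ]) (d : DihedralGroup 3) : Prop :=
  ∃ q ∈ octaList, u = unit q ∧ octaClass q = d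

theorem oct_unit {q : ℍ[ℤ]} (hq : q ∈ octaList) : Oct (unit q) (octaClass q) := ⟨q, hq, rfl, rfl⟩

theorem Oct.mul {u v : unitary ℍ[ℝ]} {d e : DihedralGroup 3} (hu : Oct u d) (hv : Oct v e) :
    Oct (u * v) (d * e) := by
  obtain ⟨p, hp, rfl, rfl⟩ := hu
  obtain ⟨q, hq, rfl, rfl⟩ := hv
  obtain ⟨h1, h2⟩ := half_half_mul_mem p hp q hq
  have hp0 := ne_zero_of_mem_octaList hp
  have hq0 := ne_zero_of_mem_octaList hq
  refine ⟨_, mem_octaList_iff.2 h1, ?_, h2⟩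
  have h3 := unit_half (quat_mul_ne_zero hp0 hq0)
  rw [(unit_half h3.1).2, h3.2, unit_mul hp0 hq0]

theorem Oct.inv {u : unitary ℍ[ℝ]} {d : DihedralGroup 3} (hu : Oct u d) : Oct u⁻¹ d⁻¹ := by
  obtain ⟨p, hp, rfl, rfl⟩ := hu
  obtain ⟨h1, h2⟩ := star_mem_octaList p hp
  exact ⟨_, mem_octaList_iff.2 h1, (unit_star (ne_zero_of_mem_octaList hp)).symm, h2⟩

theorem oct_one : Oct 1 1 := ⟨1, by decide +kernel, unit_one.symm, by decide +kernel⟩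

theorem unit_neg_one : unit (-1) = -1 := by rw [unit_neg one_ne_zero, unit_one]

theorem oct_neg_one : Oct (-1) 1 :=
  ⟨-1, by decide +kernel, unit_neg_one.symm, by decide +kernel⟩

theorem Oct.neg {u : unitary ℍ[ℝ]} {d : DihedralGroup 3} (h : Oct u d) : Oct (-u) d := by
  have := oct_neg_one.mul h
  rwa [one_mul, neg_one_mul] at this

theorem mem_octa_iff {u : unitary ℍ[ℝ]} : u ∈ octa ↔ ∃ d, Oct u d := by
  constructor
  · intro h
    induction h using Subgroup.closure_induction with
    | mem x hx =>
      obtain ⟨q, h1, h2, h3, h4, h5, rfl⟩ := hx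
      refine ⟨_, oct_unit (mem_octaList_iff.2 ⟨h1, h2, h3, h4, ?_⟩)⟩
      rwa [normSq_eq_nrm] at h5
    | one => exact ⟨1, oct_one⟩
    | mul x y _ _ hx hy =>
      obtain ⟨d, hd⟩ := hx
      obtain ⟨e, he⟩ := hy
      exact ⟨_, hd.mul he⟩
    | inv x _ hx =>
      obtain ⟨d, hd⟩ := hx
      exact ⟨_, hd.inv⟩
  · rintro ⟨_, q, hq, rfl, -⟩
    obtain ⟨h1, h2, h3, h4, h5⟩ := mem_octaList_iff.1 hq
    rw [← normSq_eq_nrm] at h5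
    exact Subgroup.subset_closure ⟨q, h1, h2, h3, h4, h5, rfl⟩

theorem Oct.mem {u : unitary ℍ[ℝ]} {d : DihedralGroup 3} (h : Oct u d) : u ∈ octa :=
  mem_octa_iff.2 ⟨d, h⟩

/-- The quaternion with the given coordinates. -/
def quat {A : Type*} [CommRing A] (a b c d : A) : ℍ[A] := ⟨a, b, c, d⟩

section
variable {A : Type*} [CommRing A] (a b c d : A)
@[simp] theorem quat_re : (quat a b c d).re = a := rfl
@[simp] theorem quat_imI : (quat a b c d).imI = b := rfl
@[simp] theorem quat_imJ : (quat a b c d).imJ = c := rfl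
@[simp] theorem quat_imK : (quat a b c d).imK = d := rfl
end

theorem ofInt_eq_sum (q : ℍ[ℤ]) : ofInt q = (q.re : ℝ) • ofInt (quat 1 0 0 0) +
    (q.imI : ℝ) • ofInt (quat 0 1 0 0) + (q.imJ : ℝ) • ofInt (quat 0 0 1 0) +
    (q.imK : ℝ) • ofInt (quat 0 0 0 1) := by
  ext <;> simp [ofInt_re, ofInt_imI, ofInt_imJ, ofInt_imK]
/-! ### Determinant and kernel of `rot` -/

theorem normSq_unitary (u : unitary ℍ[ℝ]) : Quaternion.normSq (u : ℍ[ℝ]) = 1 := by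
  have h := Unitary.coe_mul_star_self u
  rw [Unitary.coe_star, Quaternion.self_mul_star] at h
  exact Quaternion.coe_injective (by rw [h]; rfl)

theorem det_quaternion_mulLeft (a : ℍ[ℝ]) :
    LinearMap.det (LinearMap.mulLeft ℝ a) = Quaternion.normSq a ^ 2 := by
  -- The coefficients are spelled out so that the basis 1, i, j, k of a general quaternion algebra
  -- applies.
  have key : ∀ a : ℍ[ℝ,-1,0,-1], LinearMap.det (LinearMap.mulLeft ℝ a) =
      (a.re ^ 2 + a.imI ^ 2 + a.imJ ^ 2 + a.imK ^ 2) ^ 2 := by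
    intro a
    rw [← LinearMap.det_toMatrix (QuaternionAlgebra.basisOneIJK (-1 : ℝ) 0 (-1))]
    have : LinearMap.toMatrix (QuaternionAlgebra.basisOneIJK (-1 : ℝ) 0 (-1))
        (QuaternionAlgebra.basisOneIJK (-1 : ℝ) 0 (-1)) (LinearMap.mulLeft ℝ a) =
        !![a.re, -a.imI, -a.imJ, -a.imK; a.imI, a.re, -a.imK, a.imJ;
           a.imJ, a.imK, a.re, -a.imI; a.imK, -a.imJ, a.imI, a.re] := by
      ext i j
      rw [LinearMap.toMatrix_apply]
      fin_cases i <;> fin_cases j <;>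
        simp [QuaternionAlgebra.basisOneIJK]
    rw [this]
    simp [Matrix.det_succ_row_zero, Fin.sum_univ_succ, Fin.succAbove]
    ring
  rw [Quaternion.normSq_def']
  exact key a

theorem det_quaternion_mulRight (a : ℍ[ℝ]) :
    LinearMap.det (LinearMap.mulRight ℝ a) = Quaternion.normSq a ^ 2 := by
  have key : ∀ a : ℍ[ℝ,-1,0,-1], LinearMap.det (LinearMap.mulRight ℝ a) =
      (a.re ^ 2 + a.imI ^ 2 + a.imJ ^ 2 + a.imK ^ 2) ^ 2 := by
    intro a
    rw [← LinearMap.det_toMatrix (QuaternionAlgebra.basisOneIJK (-1 : ℝ) 0 (-1))]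
    have : LinearMap.toMatrix (QuaternionAlgebra.basisOneIJK (-1 : ℝ) 0 (-1))
        (QuaternionAlgebra.basisOneIJK (-1 : ℝ) 0 (-1)) (LinearMap.mulRight ℝ a) =
        !![a.re, -a.imI, -a.imJ, -a.imK; a.imI, a.re, a.imK, -a.imJ;
           a.imJ, -a.imK, a.re, a.imI; a.imK, a.imJ, -a.imI, a.re] := by
      ext i j
      rw [LinearMap.toMatrix_apply]
      fin_cases i <;> fin_cases j <;>
        simp [QuaternionAlgebra.basisOneIJK]
    rw [this]
    simp [Matrix.det_succ_row_zero, Fin.sum_univ_succ, Fin.succAbove]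
    ring
  rw [Quaternion.normSq_def']
  exact key a

theorem det_rot (g : Spin) : LinearMap.det (rot g).toLinearEquiv.toLinearMap = 1 := by
  have h : (rot g).toLinearEquiv.toLinearMap =
      LinearMap.mulLeft ℝ (g.1 : ℍ[ℝ]) * LinearMap.mulRight ℝ (star (g.2 : ℍ[ℝ])) := by
    ext1 x
    simp [rot_apply, mul_assoc]
  rw [h, map_mul, det_quaternion_mulLeft, det_quaternion_mulRight, Quaternion.normSq_star,
    normSq_unitary, normSq_unitary]
  norm_num

/-- Commuting with i and j kills the imaginary part; a real quaternion of norm one is ±1. -/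
theorem eq_one_or_neg_one_of_commute (u : unitary ℍ[ℝ])
    (hi : (u : ℍ[ℝ]) * quat 0 1 0 0 = quat 0 1 0 0 * (u : ℍ[ℝ]))
    (hj : (u : ℍ[ℝ]) * quat 0 0 1 0 = quat 0 0 1 0 * (u : ℍ[ℝ])) : u = 1 ∨ u = -1 := by
  have hn := normSq_unitary u
  rw [Quaternion.normSq_def'] at hn
  have h1 := congrArg QuaternionAlgebra.imK hi
  have h2 := congrArg QuaternionAlgebra.imJ hi
  have h3 := congrArg QuaternionAlgebra.imK hj
  simp at h1 h2 h3
  have e2 : (u : ℍ[ℝ]).imJ = 0 := by linarith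
  have e3 : (u : ℍ[ℝ]).imK = 0 := by linarith
  have e1 : (u : ℍ[ℝ]).imI = 0 := by linarith
  rw [e1, e2, e3] at hn
  have : ((u : ℍ[ℝ]).re - 1) * ((u : ℍ[ℝ]).re + 1) = 0 := by linarith
  rcases mul_eq_zero.mp this with h | h
  · left
    apply unit_ext
    ext <;> simp [e1, e2, e3]
    linarith
  · right
    apply unit_ext
    ext <;> simp [Unitary.coe_neg, e1, e2, e3]
    linarith
theorem rot_eq_one_iff {g : Spin} : rot g = 1 ↔ g = 1 ∨ g = (-1, -1) := by
  constructor
  · intro h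
    have hx : ∀ x : ℍ[ℝ], (g.1 : ℍ[ℝ]) * x * star (g.2 : ℍ[ℝ]) = x := by
      intro x
      rw [← rot_apply, h]
      rfl
    -- The image of 1 identifies the two components; a pair (u, u) acting trivially then makes u
    -- central.
    have h12 : g.1 = g.2 := by
      have := hx 1
      rw [mul_one, ← Unitary.coe_star, ← Submonoid.coe_mul] at this
      have h2 : g.1 * star g.2 = 1 := unit_ext this
      rw [Unitary.star_eq_inv] at h2
      exact mul_inv_eq_one.mp h2
    have hc : ∀ x : ℍ[ℝ], (g.1 : ℍ[ℝ]) * x = x * (g.1 : ℍ[ℝ]) := by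
      intro x
      have := congrArg (· * (g.2 : ℍ[ℝ])) (hx x)
      simp only [mul_assoc, Unitary.coe_star_mul_self, mul_one] at this
      rw [this, h12]
    rcases eq_one_or_neg_one_of_commute g.1 (hc _) (hc _) with h1 | h1
    · left
      exact Prod.ext h1 (h12 ▸ h1)
    · right
      exact Prod.ext h1 (h12 ▸ h1)
  · rintro (rfl | rfl)
    · exact map_one rot
    · ext1 x
      simp [rot_apply, Unitary.coe_neg]

theorem rot_eq_iff {g h : Spin} : rot g = rot h ↔ g = h ∨ g = (-1, -1) * h := by
  have : rot g = rot h ↔ rot (g * h⁻¹) = 1 := by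
    rw [map_mul, map_inv, mul_inv_eq_one]
  rw [this, rot_eq_one_iff, mul_inv_eq_one, mul_inv_eq_iff_eq_mul]

/-! ### The symmetry groups of the two lattices -/

theorem mem_symGroup_rot {L : AddSubgroup ℍ[ℝ]} {g : Spin} :
    rot g ∈ symGroup L ↔ image (rot g) L = L :=
  ⟨fun h => h.2, fun h => ⟨det_rot g, h⟩⟩

theorem mem_symGroup_of_le {L : AddSubgroup ℍ[ℝ]} {g : Spin}
    (h1 : ∀ x ∈ L, rot g x ∈ L) (h2 : ∀ x ∈ L, rot g⁻¹ x ∈ L) : rot g ∈ symGroup L := by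
  rw [mem_symGroup_rot]
  apply le_antisymm
  · rintro _ ⟨x, hx, rfl⟩
    exact h1 x hx
  · intro x hx
    refine ⟨_, h2 x hx, ?_⟩
    change (rot g * rot g⁻¹) x = x
    rw [← map_mul, mul_inv_cancel, map_one]
    rfl

theorem mem_of_mem_symGroup {L : AddSubgroup ℍ[ℝ]} {A : Iso4} (h : A ∈ symGroup L) {x : ℍ[ℝ]}
    (hx : x ∈ L) : A x ∈ L := by
  have : A x ∈ image A L := ⟨x, hx, rfl⟩
  rwa [h.2] at this

theorem ofInt_mem_latP (q : ℍ[ℤ]) : ofInt q ∈ latP := ⟨q, rfl⟩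

theorem mem_latF_iff {x : ℍ[ℝ]} : x ∈ latF ↔ ∃ q : ℍ[ℤ], Even (nrm q) ∧ x = ofInt q := by
  constructor
  · rintro ⟨q, h, rfl⟩
    exact ⟨q, by rwa [← normSq_eq_nrm], rfl⟩
  · rintro ⟨q, h, rfl⟩
    exact ⟨q, by rwa [normSq_eq_nrm], rfl⟩

theorem nrm_eq_of_isometry {A : Iso4} {p q : ℍ[ℤ]} (h : A (ofInt p) = ofInt q) :
    nrm p = nrm q := by
  have h1 : ‖ofInt p‖ = ‖ofInt q‖ := by rw [← h, A.norm_map]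
  have h2 : ((Quaternion.normSq p : ℤ) : ℝ) = (Quaternion.normSq q : ℤ) := by
    rw [← norm_ofInt_sq, ← norm_ofInt_sq, h1]
  rw [← normSq_eq_nrm, ← normSq_eq_nrm]
  exact_mod_cast h2

/-- D₄ is cut out of ℤ⁴ by the parity of the norm, which isometries preserve. -/
theorem symGroup_latP_le_latF : rotP ≤ rotF := by
  intro A hA
  have key : ∀ B : Iso4, B ∈ rotP → ∀ x ∈ latF, B x ∈ latF := by
    intro B hB x hx
    obtain ⟨q, hq, rfl⟩ := mem_latF_iff.1 hx
    obtain ⟨q', hq'⟩ := mem_of_mem_symGroup hB (ofInt_mem_latP q)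
    rw [mem_latF_iff]
    exact ⟨q', by rwa [← nrm_eq_of_isometry hq'], hq'⟩
  refine ⟨hA.1, le_antisymm ?_ ?_⟩
  · rintro _ ⟨x, hx, rfl⟩
    exact key A hA x hx
  · intro x hx
    refine ⟨A⁻¹ x, key _ (inv_mem hA) x hx, ?_⟩
    exact A.apply_symm_apply x

/-- Transfers an integral identity p x q̄ = n y with n = |pq| to the normalised rotation, so that
finite checks can be run over integers. -/
theorem rot_unit_apply {p q x y : ℍ[ℤ]} (hp : p ≠ 0) (hq : q ≠ 0) {n : ℤ} (hn : 0 < n)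
    (hpq : Quaternion.normSq p * Quaternion.normSq q = n ^ 2) (h : p * x * star q = n • y) :
    rot (unit p, unit q) (ofInt x) = ofInt y := by
  have hP : 0 < ‖ofInt p‖ := norm_pos_iff.mpr (ofInt_ne_zero hp)
  have hQ : 0 < ‖ofInt q‖ := norm_pos_iff.mpr (ofInt_ne_zero hq)
  have hn' : (0 : ℝ) < n := by exact_mod_cast hn
  have h1 : ‖ofInt p‖ * ‖ofInt q‖ = n := by
    have : (‖ofInt p‖ * ‖ofInt q‖) ^ 2 = (n : ℝ) ^ 2 := by
      rw [mul_pow, norm_ofInt_sq, norm_ofInt_sq]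
      exact_mod_cast hpq
    exact (pow_left_inj₀ (by positivity) hn'.le two_ne_zero).mp this
  have h2 := congrArg ofInt h
  rw [ofInt_mul, ofInt_mul, ofInt_star, ofInt_zsmul] at h2
  rw [rot_apply, coe_unit hp, coe_unit hq, Quaternion.star_smul, smul_mul_assoc, smul_mul_smul_comm,
    h2, ← mul_inv, h1, smul_smul, inv_mul_cancel₀ hn'.ne', one_smul]

/-- The four standard units. -/
def stdUnits : List ℍ[ℤ] := [quat 1 0 0 0, quat 0 1 0 0, quat 0 0 1 0, quat 0 0 0 1]

theorem octa_pair_integral : ∀ s ∈ octaList, ∀ t ∈ octaList, octaClass s = octaClass t →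
    nrm s = nrm t ∧ ∀ e ∈ stdUnits, (s * e * star t).re % nrm s = 0 ∧
      (s * e * star t).imI % nrm s = 0 ∧ (s * e * star t).imJ % nrm s = 0 ∧
      (s * e * star t).imK % nrm s = 0 := by
  decide +kernel

theorem rot_mem_latP_of_std {g : Spin} (h : ∀ e ∈ stdUnits, rot g (ofInt e) ∈ latP) :
    ∀ x ∈ latP, rot g x ∈ latP := by
  rintro _ ⟨q, rfl⟩
  rw [ofInt_eq_sum q]
  simp only [map_add, LinearIsometryEquiv.map_smul]
  simp only [Int.cast_smul_eq_zsmul]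
  have h1 := h (quat 1 0 0 0) (by simp [stdUnits])
  have h2 := h (quat 0 1 0 0) (by simp [stdUnits])
  have h3 := h (quat 0 0 1 0) (by simp [stdUnits])
  have h4 := h (quat 0 0 0 1) (by simp [stdUnits])
  exact add_mem (add_mem (add_mem (zsmul_mem h1 _) (zsmul_mem h2 _)) (zsmul_mem h3 _))
    (zsmul_mem h4 _)

theorem rot_mem_rotP_of_oct {g : Spin} {d : DihedralGroup 3} (h1 : Oct g.1 d) (h2 : Oct g.2 d) :
    rot g ∈ rotP := by
  have key : ∀ (g : Spin) (d : DihedralGroup 3), Oct g.1 d → Oct g.2 d →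
      ∀ x ∈ latP, rot g x ∈ latP := by
    rintro ⟨_, _⟩ _ ⟨s, hs, rfl, rfl⟩ ⟨t, ht, rfl, hst⟩
    obtain ⟨hn, hdiv⟩ := octa_pair_integral s hs t ht hst.symm
    apply rot_mem_latP_of_std
    intro e he
    obtain ⟨h1, h2, h3, h4⟩ := hdiv e he
    have hpos : 0 < nrm s := by
      rw [← normSq_eq_nrm]
      exact normSq_pos (ne_zero_of_mem_octaList hs)
    refine ⟨⟨(s * e * star t).re / nrm s, (s * e * star t).imI / nrm s,
      (s * e * star t).imJ / nrm s, (s * e * star t).imK / nrm s⟩, ?_⟩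
    apply rot_unit_apply (ne_zero_of_mem_octaList hs) (ne_zero_of_mem_octaList ht) hpos
    · rw [normSq_eq_nrm, normSq_eq_nrm, ← hn, sq]
    · refine Eq.trans ?_ (zsmul_eq_mk _ _).symm
      apply QuaternionAlgebra.ext <;> dsimp only
      · exact (Int.mul_ediv_cancel' (Int.dvd_of_emod_eq_zero h1)).symm
      · exact (Int.mul_ediv_cancel' (Int.dvd_of_emod_eq_zero h2)).symm
      · exact (Int.mul_ediv_cancel' (Int.dvd_of_emod_eq_zero h3)).symm
      · exact (Int.mul_ediv_cancel' (Int.dvd_of_emod_eq_zero h4)).symm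
  exact mem_symGroup_of_le (key g d h1 h2) (key g⁻¹ d⁻¹ h1.inv h2.inv)

theorem norm_ofInt_eq_one {q : ℍ[ℤ]} (h : nrm q = 1) : ‖ofInt q‖ = 1 := by
  have := norm_ofInt_sq q
  rw [normSq_eq_nrm, h] at this
  have h2 := norm_nonneg (ofInt q)
  norm_num at this
  rcases this with h3 | h3
  · exact h3
  · linarith

/-- The six imaginary units. -/
def imUnits : List ℍ[ℤ] :=
  [quat 0 1 0 0, quat 0 0 1 0, quat 0 0 0 1, quat 0 (-1) 0 0, quat 0 0 (-1) 0, quat 0 0 0 (-1)]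

theorem mem_imUnits {q : ℍ[ℤ]} (hn : nrm q = 1) (hr : q.re = 0) : q ∈ imUnits := by
  obtain ⟨a, b, c, d⟩ := q
  simp only [nrm] at hn hr
  subst hr
  have hb : -1 ≤ b ∧ b ≤ 1 := by constructor <;> nlinarith
  have hc : -1 ≤ c ∧ c ≤ 1 := by constructor <;> nlinarith
  have hd : -1 ≤ d ∧ d ≤ 1 := by constructor <;> nlinarith
  have key : ∀ b ∈ ([-1, 0, 1] : List ℤ), ∀ c ∈ ([-1, 0, 1] : List ℤ),
      ∀ d ∈ ([-1, 0, 1] : List ℤ), 0 * 0 + b * b + c * c + d * d = 1 →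
      (quat 0 b c d) ∈ imUnits := by decide +kernel
  have hm : ∀ x : ℤ, -1 ≤ x ∧ x ≤ 1 → x ∈ ([-1, 0, 1] : List ℤ) := by
    intro x hx
    simp only [List.mem_cons, List.not_mem_nil, or_false]
    omega
  exact key b (hm b hb) c (hm c hc) d (hm d hd) hn

/-- Conjugation by `octa` is the rotation group of the cube, which is transitive on ordered pairs of
orthogonal axis directions. -/
theorem exists_octa_of_imUnits : ∀ x ∈ imUnits, ∀ y ∈ imUnits, (x * star y).re = 0 →
    ∃ o ∈ octaList, o * quat 0 1 0 0 * star o = nrm o • x ∧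
      o * quat 0 0 1 0 * star o = nrm o • y := by
  decide +kernel

theorem inner_ofInt (p q : ℍ[ℤ]) : inner ℝ (ofInt p) (ofInt q) = ((p * star q).re : ℤ) := by
  rw [Quaternion.inner_def, ← ofInt_star, ← ofInt_mul, ofInt_re]

theorem isometry_ext {A B : Iso4} (h : ∀ e ∈ stdUnits, A (ofInt e) = B (ofInt e)) : A = B := by
  ext1 x
  have hx : x = x.re • ofInt (quat 1 0 0 0) + x.imI • ofInt (quat 0 1 0 0) +
      x.imJ • ofInt (quat 0 0 1 0) + x.imK • ofInt (quat 0 0 0 1) := by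
    ext <;> simp [ofInt_re, ofInt_imI, ofInt_imJ, ofInt_imK]
  rw [hx]
  simp only [map_add, LinearIsometryEquiv.map_smul]
  rw [h _ (by simp [stdUnits]), h _ (by simp [stdUnits]), h _ (by simp [stdUnits]),
    h _ (by simp [stdUnits])]

theorem ofInt_mem_imUnits_of_isometry {B : Iso4} (h1 : B 1 = 1) {e q : ℍ[ℤ]}
    (he : nrm e = 1) (hr : e.re = 0) (hq : B (ofInt e) = ofInt q) : q ∈ imUnits := by
  apply mem_imUnits
  · rw [← nrm_eq_of_isometry hq, he]
  · have h2 : inner ℝ (B (ofInt e)) (B (ofInt 1)) = inner ℝ (ofInt e) (ofInt 1) :=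
      B.inner_map_map _ _
    rw [ofInt_one, h1, ← ofInt_one, hq, inner_ofInt, inner_ofInt] at h2
    simpa [hr] using h2

theorem orthogonal_of_isometry {B : Iso4} {e e' q q' : ℍ[ℤ]} (hq : B (ofInt e) = ofInt q)
    (hq' : B (ofInt e') = ofInt q') : (q * star q').re = (e * star e').re := by
  have h2 := B.inner_map_map (ofInt e) (ofInt e')
  rw [hq, hq', inner_ofInt, inner_ofInt] at h2
  exact_mod_cast h2

theorem det_reflection_imK {B : Iso4} (h : ∀ e ∈ stdUnits, e.imK = 0 → B (ofInt e) = ofInt e)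
    (hk : B (ofInt (quat 0 0 0 1)) = ofInt (quat 0 0 0 (-1))) :
    LinearMap.det B.toLinearEquiv.toLinearMap = -1 := by
  have hB : ∀ x : ℍ[ℝ], B x = quat x.re x.imI x.imJ (-x.imK) := by
    intro x
    have hx : x = x.re • ofInt (quat 1 0 0 0) + x.imI • ofInt (quat 0 1 0 0) +
        x.imJ • ofInt (quat 0 0 1 0) + x.imK • ofInt (quat 0 0 0 1) := by
      ext <;> simp [ofInt_re, ofInt_imI, ofInt_imJ, ofInt_imK]
    conv_lhs => rw [hx]
    simp only [map_add, LinearIsometryEquiv.map_smul]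
    rw [h _ (by simp [stdUnits]) rfl, h _ (by simp [stdUnits]) rfl, h _ (by simp [stdUnits]) rfl,
      hk]
    ext <;> simp [ofInt_re, ofInt_imI, ofInt_imJ, ofInt_imK]
  have key : ∀ f : ℍ[ℝ,-1,0,-1] →ₗ[ℝ] ℍ[ℝ,-1,0,-1],
      (∀ x, f x = ⟨x.re, x.imI, x.imJ, -x.imK⟩) → LinearMap.det f = -1 := by
    intro f hf
    rw [← LinearMap.det_toMatrix (QuaternionAlgebra.basisOneIJK (-1 : ℝ) 0 (-1))]
    have : LinearMap.toMatrix (QuaternionAlgebra.basisOneIJK (-1 : ℝ) 0 (-1))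
        (QuaternionAlgebra.basisOneIJK (-1 : ℝ) 0 (-1)) f =
        !![1, 0, 0, 0; 0, 1, 0, 0; 0, 0, 1, 0; 0, 0, 0, -1] := by
      ext i j
      rw [LinearMap.toMatrix_apply, hf]
      fin_cases i <;> fin_cases j <;>
        simp [QuaternionAlgebra.basisOneIJK]
    rw [this]
    simp [Matrix.det_succ_row_zero, Fin.sum_univ_succ, Fin.succAbove]
  exact key _ hB

/-- A rotation fixing 1 and permuting the imaginary units up to sign is determined by the images of
i and j, and some octahedral conjugation has the same images. -/
theorem exists_oct_of_fix_one {B : Iso4} (hdet : LinearMap.det B.toLinearEquiv.toLinearMap = 1)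
    (h1 : B 1 = 1) (hB : ∀ e ∈ stdUnits, e.re = 0 → B (ofInt e) ∈ latP) :
    ∃ o d, Oct o d ∧ B = rot (o, o) := by
  obtain ⟨x, hx⟩ := hB (quat 0 1 0 0) (by simp [stdUnits]) rfl
  obtain ⟨y, hy⟩ := hB (quat 0 0 1 0) (by simp [stdUnits]) rfl
  obtain ⟨z, hz⟩ := hB (quat 0 0 0 1) (by simp [stdUnits]) rfl
  have mx := ofInt_mem_imUnits_of_isometry h1 (by rfl) rfl hx
  have my := ofInt_mem_imUnits_of_isometry h1 (by rfl) rfl hy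
  obtain ⟨o, ho, hox, hoy⟩ := exists_octa_of_imUnits x mx y my
    (by rw [orthogonal_of_isometry hx hy]; rfl)
  have ho0 := ne_zero_of_mem_octaList ho
  have hopos : 0 < nrm o := by
    rw [← normSq_eq_nrm]
    exact normSq_pos ho0
  refine ⟨unit o, _, oct_unit ho, ?_⟩
  have hsq : Quaternion.normSq o * Quaternion.normSq o = nrm o ^ 2 := by
    rw [normSq_eq_nrm, sq]
  have hrx := rot_unit_apply ho0 ho0 hopos hsq hox
  have hry := rot_unit_apply ho0 ho0 hopos hsq hoy
  have hr1 : rot (unit o, unit o) 1 = 1 := by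
    rw [rot_apply, mul_one]
    exact Unitary.coe_mul_star_self _
  set A := rot (unit o, unit o) with hA
  have hAP : A ∈ rotP := rot_mem_rotP_of_oct (oct_unit ho) (oct_unit ho)
  obtain ⟨z', hz'⟩ := mem_of_mem_symGroup (inv_mem hAP) (ofInt_mem_latP z)
  set C : Iso4 := A⁻¹ * B with hC
  have c1 : C 1 = 1 := by
    change A.symm (B 1) = 1
    rw [h1, A.symm_apply_eq, hr1]
  have ci : C (ofInt (quat 0 1 0 0)) = ofInt (quat 0 1 0 0) := by
    change A.symm (B _) = _
    rw [hx, A.symm_apply_eq, hrx]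
  have cj : C (ofInt (quat 0 0 1 0)) = ofInt (quat 0 0 1 0) := by
    change A.symm (B _) = _
    rw [hy, A.symm_apply_eq, hry]
  have ck : C (ofInt (quat 0 0 0 1)) = ofInt z' := by
    change A⁻¹ (B _) = _
    rw [hz, hz']
  have mz := ofInt_mem_imUnits_of_isometry c1 (by rfl) rfl ck
  have o1 := orthogonal_of_isometry ci ck
  have o2 := orthogonal_of_isometry cj ck
  have hz'' : z' = quat 0 0 0 1 ∨ z' = quat 0 0 0 (-1) := by
    have : ∀ z ∈ imUnits, (quat 0 1 0 0 * star z).re = (quat (0 : ℤ) 1 0 0 * star (quat 0 0 0 1)).re →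
        (quat 0 0 1 0 * star z).re = (quat (0 : ℤ) 0 1 0 * star (quat 0 0 0 1)).re →
        z = quat 0 0 0 1 ∨ z = quat 0 0 0 (-1) := by decide +kernel
    exact this z' mz o1 o2
  have c1' : C (ofInt (quat 1 0 0 0)) = ofInt (quat 1 0 0 0) := by
    have : ofInt (quat 1 0 0 0) = 1 := ofInt_one
    rw [this, c1]
  -- C fixes 1, i and j, so only k ↦ ±k remains, and the determinant excludes the reflection.
  have hCone : C = 1 := by
    rcases hz'' with rfl | rfl
    · apply isometry_ext
      intro e he
      simp only [stdUnits, List.mem_cons, List.not_mem_nil, or_false] at he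
      rcases he with rfl | rfl | rfl | rfl
      exacts [c1', ci, cj, ck]
    · exfalso
      have hd : LinearMap.det C.toLinearEquiv.toLinearMap = -1 := by
        apply det_reflection_imK _ ck
        intro e he hk
        simp only [stdUnits, List.mem_cons, List.not_mem_nil, or_false] at he
        rcases he with rfl | rfl | rfl | rfl
        · exact c1'
        · exact ci
        · exact cj
        · simp at hk
      have hd2 : LinearMap.det C.toLinearEquiv.toLinearMap = 1 := by
        have e : C.toLinearEquiv.toLinearMap =
            (A⁻¹).toLinearEquiv.toLinearMap * B.toLinearEquiv.toLinearMap := rfl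
        rw [e, map_mul, hdet, (inv_mem hAP).1, mul_one]
      rw [hd] at hd2
      norm_num at hd2
  exact (inv_mul_eq_one.mp hCone).symm

/-! ### Parity in S₃, powers of ω, and the generators of the two covers -/

/-- Whether an element of `S₃` is even. -/
def isR : DihedralGroup 3 → Bool
  | .r _ => true
  | .sr _ => false

theorem isR_mul : ∀ d e : DihedralGroup 3, isR (d * e) = (isR d == isR e) := by decide

theorem isR_inv : ∀ d : DihedralGroup 3, isR d⁻¹ = isR d := by decide

/-- Integral representatives of the powers of `ω`. -/
def omega : Fin 3 → ℍ[ℤ]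
  | 0 => 1
  | 1 => ⟨1, 1, 1, 1⟩
  | 2 => ⟨-1, 1, 1, 1⟩

theorem omega_mem : ∀ k, omega k ∈ octaList := by decide +kernel

theorem omega_ne_zero (k : Fin 3) : omega k ≠ 0 := ne_zero_of_mem_octaList (omega_mem k)

/-- The even elements of `S₃`. -/
def rho (k : Fin 3) : DihedralGroup 3 := .r k

theorem octaClass_omega : ∀ k, octaClass (omega k) = rho k := by decide +kernel

theorem oct_omega (k : Fin 3) : Oct (unit (omega k)) (rho k) :=
  ⟨_, omega_mem k, rfl, octaClass_omega k⟩

theorem s_eq (k : Fin 3) : s k = (1, unit (omega k)) := by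
  fin_cases k
  · exact Prod.ext rfl unit_one.symm
  · exact Prod.ext unit_one rfl
  · exact Prod.ext unit_one rfl

theorem zsmul_re (n : ℤ) (q : ℍ[ℤ]) : (n • q).re = n * q.re := by simp

theorem mem_octaList_of_nrm_one {q : ℍ[ℤ]} (h : nrm q = 1) : q ∈ octaList ∧ octaClass q = 1 := by
  refine ⟨mem_octaList_iff.2 ?_, if_pos h⟩
  have h' := h
  unfold nrm at h'
  exact ⟨abs_le.2 ⟨by nlinarith, by nlinarith⟩, abs_le.2 ⟨by nlinarith, by nlinarith⟩,
    abs_le.2 ⟨by nlinarith, by nlinarith⟩, abs_le.2 ⟨by nlinarith, by nlinarith⟩, Or.inl h⟩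

/-- The integral vectors of norm 4 are the doubled units and (±1,±1,±1,±1). Both have even class,
and only doubled units can have real part 0. -/
theorem half_of_nrm_four {q : ℍ[ℤ]} (h : nrm q = 4) :
    half q ∈ octaList ∧ isR (octaClass (half q)) = true ∧
      (q.re = 0 → ∃ y : ℍ[ℤ], q = (2 : ℤ) • y) := by
  have key : ∀ a ∈ ([-2, -1, 0, 1, 2] : List ℤ), ∀ b ∈ ([-2, -1, 0, 1, 2] : List ℤ),
      ∀ c ∈ ([-2, -1, 0, 1, 2] : List ℤ), ∀ d ∈ ([-2, -1, 0, 1, 2] : List ℤ),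
      nrm (quat a b c d) = 4 → InOctaList (half (quat a b c d)) ∧
        isR (octaClass (half (quat a b c d))) = true ∧
        (a = 0 → b % 2 = 0 ∧ c % 2 = 0 ∧ d % 2 = 0) := by decide +kernel
  have hm : ∀ x : ℤ, x * x ≤ 4 → x ∈ ([-2, -1, 0, 1, 2] : List ℤ) := by
    intro x hx
    have h1 : x ≤ 2 := by nlinarith
    have h2 : -2 ≤ x := by nlinarith
    simp only [List.mem_cons, List.not_mem_nil, or_false]
    omega
  have h' := h
  unfold nrm at h'
  obtain ⟨k1, k2, k3⟩ := key q.re (hm _ (by nlinarith)) q.imI (hm _ (by nlinarith)) q.imJ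
    (hm _ (by nlinarith)) q.imK (hm _ (by nlinarith)) h
  refine ⟨mem_octaList_iff.2 k1, k2, fun h0 => ?_⟩
  obtain ⟨h2, h3, h4⟩ := k3 h0
  refine ⟨quat 0 (q.imI / 2) (q.imJ / 2) (q.imK / 2), ?_⟩
  refine Eq.trans ?_ (zsmul_eq_mk _ _).symm
  apply QuaternionAlgebra.ext <;> dsimp only [quat] <;> omega

theorem nrm_mul (p q : ℍ[ℤ]) : nrm (p * q) = nrm p * nrm q := by
  rw [← normSq_eq_nrm, ← normSq_eq_nrm, ← normSq_eq_nrm, map_mul]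

theorem nrm_star (p : ℍ[ℤ]) : nrm (star p) = nrm p := by
  rw [← normSq_eq_nrm, ← normSq_eq_nrm, Quaternion.normSq_star]

theorem nrm_zsmul (n : ℤ) (q : ℍ[ℤ]) : nrm (n • q) = n ^ 2 * nrm q := by
  rw [← normSq_eq_nrm, ← normSq_eq_nrm, normSq_zsmul]

theorem nrm_pos {q : ℍ[ℤ]} (h : q ≠ 0) : 0 < nrm q := by
  rw [← normSq_eq_nrm]
  exact normSq_pos h

theorem even_nrm_iff (q : ℍ[ℤ]) : Even (nrm q) ↔ (q.re + q.imI + q.imJ + q.imK) % 2 = 0 := by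
  rw [nrm, Int.even_iff]
  have h : ∀ a : ℤ, (a * a) % 2 = a % 2 := by
    intro a
    rcases Int.emod_two_eq_zero_or_one a with h | h <;> simp [Int.mul_emod, h]
  have h1 := h q.re
  have h2 := h q.imI
  have h3 := h q.imJ
  have h4 := h q.imK
  omega

/-- Modulo 2, t is 1+i+j+k, so each coordinate of q t is congruent to the coordinate sum of q, which
is even. -/
theorem exists_two_smul {t q : ℍ[ℤ]} (h1 : t.re % 2 = 1) (h2 : t.imI % 2 = 1)
    (h3 : t.imJ % 2 = 1) (h4 : t.imK % 2 = 1) (hq : Even (nrm q)) :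
    ∃ y : ℍ[ℤ], q * t = (2 : ℤ) • y := by
  rw [even_nrm_iff] at hq
  obtain ⟨a, ha⟩ : ∃ a, t.re = 2 * a + 1 := ⟨t.re / 2, by omega⟩
  obtain ⟨b, hb⟩ : ∃ a, t.imI = 2 * a + 1 := ⟨t.imI / 2, by omega⟩
  obtain ⟨c, hc⟩ : ∃ a, t.imJ = 2 * a + 1 := ⟨t.imJ / 2, by omega⟩
  obtain ⟨d, hd⟩ : ∃ a, t.imK = 2 * a + 1 := ⟨t.imK / 2, by omega⟩
  obtain ⟨e, he⟩ : ∃ e, q.re = 2 * e - q.imI - q.imJ - q.imK :=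
    ⟨(q.re + q.imI + q.imJ + q.imK) / 2, by omega⟩
  have : ∀ x : ℍ[ℤ], x.re % 2 = 0 → x.imI % 2 = 0 → x.imJ % 2 = 0 → x.imK % 2 = 0 →
      ∃ y : ℍ[ℤ], x = (2 : ℤ) • y := by
    intro x k1 k2 k3 k4
    refine ⟨quat (x.re / 2) (x.imI / 2) (x.imJ / 2) (x.imK / 2), ?_⟩
    refine Eq.trans ?_ (zsmul_eq_mk _ _).symm
    apply QuaternionAlgebra.ext <;> dsimp only [quat] <;> omega
  apply this
  · rw [Quaternion.re_mul, ha, hb, hc, hd, he]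
    ring_nf
    omega
  · rw [Quaternion.imI_mul, ha, hb, hc, hd, he]
    ring_nf
    omega
  · rw [Quaternion.imJ_mul, ha, hb, hc, hd, he]
    ring_nf
    omega
  · rw [Quaternion.imK_mul, ha, hb, hc, hd, he]
    ring_nf
    omega

theorem rot_one_unit_mem_rotF {t : ℍ[ℤ]} (ht : nrm t = 4) (h1 : t.re % 2 = 1)
    (h2 : t.imI % 2 = 1) (h3 : t.imJ % 2 = 1) (h4 : t.imK % 2 = 1) :
    rot (1, unit t) ∈ rotF := by
  have key : ∀ t : ℍ[ℤ], nrm t = 4 → t.re % 2 = 1 → t.imI % 2 = 1 → t.imJ % 2 = 1 →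
      t.imK % 2 = 1 → ∀ x ∈ latF, rot (1, unit t) x ∈ latF := by
    intro t ht h1 h2 h3 h4 x hx
    obtain ⟨q, hq, rfl⟩ := mem_latF_iff.1 hx
    have ht0 : t ≠ 0 := by
      rintro rfl
      simp [nrm] at ht
    obtain ⟨y, hy⟩ := exists_two_smul (t := star t) (q := q) (by simpa using h1)
      (by simp; omega) (by simp; omega) (by simp; omega) hq
    rw [mem_latF_iff]
    refine ⟨y, ?_, ?_⟩
    · have := congrArg nrm hy
      rw [nrm_mul, nrm_star, ht, nrm_zsmul] at this
      have e : nrm y = nrm q := by linarith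
      rwa [e]
    · rw [← unit_one]
      apply rot_unit_apply one_ne_zero ht0 (n := 2) (by norm_num)
      · rw [normSq_eq_nrm t, ht]
        simp
      · rw [one_mul, hy]
  have ht0 : t ≠ 0 := by
    rintro rfl
    simp [nrm] at ht
  apply mem_symGroup_of_le (key t ht h1 h2 h3 h4)
  have e : ((1, unit t) : Spin)⁻¹ = (1, unit (star t)) := by
    rw [unit_star ht0, Prod.inv_mk, inv_one]
  rw [e]
  exact key (star t) (by rw [nrm_star, ht]) (by simpa using h1) (by simp; omega) (by simp; omega)
    (by simp; omega)

/-- The rotations form the subgroup of index two in S₃, so elements of equal parity differ by a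
rotation, that is, by the class of a power of ω. -/
theorem exists_omega_mul : ∀ d e : DihedralGroup 3, isR d = isR e →
    ∃ k : Fin 3, e = rho k * d := by decide

theorem rot_one_omega_mem_rotF (k : Fin 3) : rot (1, unit (omega k)) ∈ rotF := by
  fin_cases k
  · change rot (1, unit 1) ∈ rotF
    rw [unit_one]
    exact (map_one rot).symm ▸ one_mem rotF
  · exact rot_one_unit_mem_rotF (t := omega 1) (by decide +kernel) rfl rfl rfl rfl
  · exact rot_one_unit_mem_rotF (t := omega 2) (by decide +kernel) rfl rfl rfl rfl

theorem rot_mem_rotF_of_oct {g : Spin} {d e : DihedralGroup 3} (h1 : Oct g.1 d) (h2 : Oct g.2 e)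
    (h : isR d = isR e) : rot g ∈ rotF := by
  obtain ⟨k, rfl⟩ := exists_omega_mul d e h
  have h3 : g = (1, unit (omega k)) * (g.1, (unit (omega k))⁻¹ * g.2) := by
    ext1 <;> simp
  rw [h3, map_mul]
  refine mul_mem (rot_one_omega_mem_rotF k) (symGroup_latP_le_latF ?_)
  refine rot_mem_rotP_of_oct (d := d) h1 ?_
  have := (oct_omega k).inv.mul h2
  rwa [inv_mul_cancel_left] at this

theorem coe_unit_of_nrm_one {q : ℍ[ℤ]} (h : nrm q = 1) : (unit q : ℍ[ℝ]) = ofInt q := by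
  have hq : q ≠ 0 := by
    rintro rfl
    simp [nrm] at h
  rw [coe_unit hq, norm_ofInt_eq_one h, inv_one, one_smul]

/-- The image of 1 is one of the eight integral units. Dividing it off on the left leaves a rotation
fixing 1, which is an octahedral conjugation. -/
theorem exists_oct_of_mem_rotP {A : Iso4} (hA : A ∈ rotP) :
    ∃ g d, Oct (Prod.fst g) d ∧ Oct g.2 d ∧ A = rot g := by
  obtain ⟨q, hq⟩ := mem_of_mem_symGroup hA (ofInt_mem_latP 1)
  have hn : nrm q = 1 := by
    rw [← nrm_eq_of_isometry hq]
    rfl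
  obtain ⟨hm, hc⟩ := mem_octaList_of_nrm_one hn
  have hoq : Oct (unit q) 1 := ⟨q, hm, rfl, hc⟩
  set u : Spin := (unit q, 1) with hu
  have huP : rot u ∈ rotP := rot_mem_rotP_of_oct (d := 1) hoq oct_one
  set B : Iso4 := (rot u)⁻¹ * A with hB
  have hBP : B ∈ rotP := mul_mem (inv_mem huP) hA
  have hB1 : B 1 = 1 := by
    change (rot u).symm (A 1) = 1
    rw [(rot u).symm_apply_eq, rot_apply, ← ofInt_one, hq, ofInt_one, mul_one]
    simp [hu, coe_unit_of_nrm_one hn]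
  obtain ⟨o, d, ho, hBo⟩ := exists_oct_of_fix_one hBP.1 hB1
    (fun e _ _ => mem_of_mem_symGroup hBP (ofInt_mem_latP e))
  refine ⟨u * (o, o), d, ?_, ?_, ?_⟩
  · have := hoq.mul ho
    rwa [one_mul] at this
  · change Oct (1 * o) d
    rwa [one_mul]
  · rw [map_mul, ← hBo, hB, mul_inv_cancel_left]

theorem exists_oct_of_mem_rotF {A : Iso4} (hA : A ∈ rotF) :
    ∃ g d e, Oct (Prod.fst g) d ∧ Oct g.2 e ∧ isR d = isR e ∧ A = rot g := by
  -- The vector 1 has odd norm and is not in D₄; its double is.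
  have h2F : ofInt ((2 : ℤ) • 1) ∈ latF :=
    mem_latF_iff.2 ⟨_, by rw [nrm_zsmul]; exact Even.mul_right (by decide) _, rfl⟩
  obtain ⟨q, -, hq⟩ := mem_latF_iff.1 (mem_of_mem_symGroup hA h2F)
  have hn : nrm q = 4 := by
    rw [← nrm_eq_of_isometry hq, nrm_zsmul]
    rfl
  have hq0 : q ≠ 0 := by
    rintro rfl
    simp [nrm] at hn
  obtain ⟨hm, hc, -⟩ := half_of_nrm_four hn
  have hoq : Oct (unit q) (octaClass (half q)) := ⟨_, hm, (unit_half hq0).2.symm, rfl⟩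
  set u : Spin := (unit q, 1) with hu
  have huF : rot u ∈ rotF := rot_mem_rotF_of_oct hoq oct_one (by rw [hc]; rfl)
  have hA1 : A 1 = unit q := by
    have hnq : ‖ofInt q‖ = 2 := by
      have := norm_ofInt_sq q
      rw [normSq_eq_nrm, hn] at this
      have h2 : ‖ofInt q‖ ^ 2 = (2 : ℝ) ^ 2 := by rw [this]; norm_num
      exact (pow_left_inj₀ (norm_nonneg _) (by norm_num) two_ne_zero).mp h2
    rw [ofInt_zsmul, ofInt_one, LinearIsometryEquiv.map_smul] at hq
    rw [coe_unit hq0, hnq, ← hq, smul_smul]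
    norm_num
  set B : Iso4 := (rot u)⁻¹ * A with hB
  have hBF : B ∈ rotF := mul_mem (inv_mem huF) hA
  have hB1 : B 1 = 1 := by
    change (rot u).symm (A 1) = 1
    rw [(rot u).symm_apply_eq, rot_apply, hA1, mul_one]
    simp [hu]
  -- B maps 2e to a vector of norm 4 orthogonal to 1. Its real part vanishes, so it is a doubled
  -- unit and B e is integral.
  obtain ⟨o, d, ho, hBo⟩ := exists_oct_of_fix_one hBF.1 hB1 (by
    intro e he hr
    have h2e : ofInt ((2 : ℤ) • e) ∈ latF :=
      mem_latF_iff.2 ⟨_, by rw [nrm_zsmul]; exact Even.mul_right (by decide) _, rfl⟩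
    obtain ⟨x, -, hx⟩ := mem_latF_iff.1 (mem_of_mem_symGroup hBF h2e)
    have hne : nrm e = 1 := by
      have : ∀ e ∈ stdUnits, nrm e = 1 := by decide +kernel
      exact this e he
    have hxn : nrm x = 4 := by
      rw [← nrm_eq_of_isometry hx, nrm_zsmul, hne]
      rfl
    have hxr : x.re = 0 := by
      have hb1 : B (ofInt 1) = ofInt 1 := by rw [ofInt_one, hB1]
      have := orthogonal_of_isometry hx hb1
      rw [star_one, mul_one, mul_one, zsmul_re, hr] at this
      simpa using this
    obtain ⟨y, rfl⟩ := (half_of_nrm_four hxn).2.2 hxr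
    rw [ofInt_zsmul, ofInt_zsmul, LinearIsometryEquiv.map_smul] at hx
    have := smul_right_injective _ (by norm_num : ((2 : ℤ) : ℝ) ≠ 0) hx
    exact ⟨y, this⟩)
  refine ⟨u * (o, o), octaClass (half q) * d, d, hoq.mul ho, ?_, ?_, ?_⟩
  · change Oct (1 * o) d
    rwa [one_mul]
  · rw [isR_mul, hc]
    cases isR d <;> rfl
  · rw [map_mul, ← hBo, hB, mul_inv_cancel_left]

/-! ### The covers described by classes in S₃, and their orders -/

theorem mem_coverP_iff {g : Spin} : g ∈ coverP ↔ ∃ d, Oct g.1 d ∧ Oct g.2 d := by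
  constructor
  · intro h
    obtain ⟨g', d, h1, h2, h3⟩ := exists_oct_of_mem_rotP (A := rot g) h
    rcases rot_eq_iff.1 h3 with rfl | rfl
    · exact ⟨d, h1, h2⟩
    · refine ⟨d, ?_, ?_⟩
      · change Oct (-1 * g'.1) d
        rw [neg_one_mul]
        exact h1.neg
      · change Oct (-1 * g'.2) d
        rw [neg_one_mul]
        exact h2.neg
  · rintro ⟨d, h1, h2⟩
    exact rot_mem_rotP_of_oct h1 h2

theorem mem_coverF_iff {g : Spin} :
    g ∈ coverF ↔ ∃ d e, Oct g.1 d ∧ Oct g.2 e ∧ isR d = isR e := by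
  constructor
  · intro h
    obtain ⟨g', d, e, h1, h2, h4, h3⟩ := exists_oct_of_mem_rotF (A := rot g) h
    rcases rot_eq_iff.1 h3 with rfl | rfl
    · exact ⟨d, e, h1, h2, h4⟩
    · refine ⟨d, e, ?_, ?_, h4⟩
      · change Oct (-1 * g'.1) d
        rw [neg_one_mul]
        exact h1.neg
      · change Oct (-1 * g'.2) e
        rw [neg_one_mul]
        exact h2.neg
  · rintro ⟨d, e, h1, h2, h⟩
    exact rot_mem_rotF_of_oct h1 h2 h

theorem coverP_le_coverF : coverP ≤ coverF := fun _ h => symGroup_latP_le_latF h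

theorem exists_mem_coverP_of_mem_rotP {A : Iso4} (hA : A ∈ rotP) : ∃ g ∈ coverP, A = rot g := by
  obtain ⟨g, d, h1, h2, rfl⟩ := exists_oct_of_mem_rotP hA
  exact ⟨g, hA, rfl⟩

theorem exists_mem_coverF_of_mem_rotF {A : Iso4} (hA : A ∈ rotF) : ∃ g ∈ coverF, A = rot g := by
  obtain ⟨g, d, e, h1, h2, -, rfl⟩ := exists_oct_of_mem_rotF hA
  exact ⟨g, hA, rfl⟩

/-- Every element of `coverF` is a power of `s 1` times an element of `coverP`, on either side. -/
theorem exists_s_mul {g : Spin} (hg : g ∈ coverF) :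
    ∃ k : Fin 3, ∃ h ∈ coverP, g = s k * h := by
  obtain ⟨d, e, h1, h2, h⟩ := mem_coverF_iff.1 hg
  obtain ⟨k, rfl⟩ := exists_omega_mul d e h
  refine ⟨k, (g.1, (unit (omega k))⁻¹ * g.2), mem_coverP_iff.2 ⟨d, h1, ?_⟩, ?_⟩
  · have := (oct_omega k).inv.mul h2
    rwa [inv_mul_cancel_left] at this
  · rw [s_eq]
    ext1 <;> simp

theorem s_mem_coverF (k : Fin 3) : s k ∈ coverF := by
  rw [s_eq]
  exact rot_one_omega_mem_rotF k

theorem coverF_eq_union : (coverF : Set Spin) = (coverP : Set Spin)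
    ∪ (fun x => pair 1 ⟨1, 1, 1, 1⟩ * x) '' (coverP : Set Spin)
    ∪ (fun x => pair 1 ⟨1, -1, -1, -1⟩ * x) '' (coverP : Set Spin) := by
  have hm : quat 1 (-1) (-1) (-1) ∈ octaList := by decide +kernel
  have h0 := ne_zero_of_mem_octaList hm
  have hc : octaClass (quat 1 (-1) (-1) (-1)) = rho 2 := by decide +kernel
  ext g
  constructor
  · intro hg
    obtain ⟨k, h, hh, rfl⟩ := exists_s_mul hg
    fin_cases k
    · left; left
      change 1 * h ∈ coverP
      rwa [one_mul]
    · left; right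
      exact ⟨h, hh, rfl⟩
    · right
      -- The representative (1,-1,-1,-1) is the negative of `omega 2`; the sign is absorbed by
      -- (1,-1) in `coverP`.
      refine ⟨(1, -1) * h, ?_, ?_⟩
      · exact mul_mem (mem_coverP_iff.2 ⟨1, oct_one, oct_neg_one⟩) hh
      · have e : pair 1 ⟨1, -1, -1, -1⟩ * (1, -1) = s 2 := by
          rw [s_eq]
          refine Prod.ext ?_ ?_
          · change unit 1 * 1 = 1
            rw [unit_one, one_mul]
          · change unit (quat 1 (-1) (-1) (-1)) * -1 = unit (omega 2)
            rw [mul_neg_one, ← unit_neg h0]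
            congr 1
        change pair 1 ⟨1, -1, -1, -1⟩ * ((1, -1) * h) = s 2 * h
        rw [← mul_assoc, e]
  · rintro ((hg | ⟨h, hh, rfl⟩) | ⟨h, hh, rfl⟩)
    · exact coverP_le_coverF hg
    · exact mul_mem (s_mem_coverF 1) (coverP_le_coverF hh)
    · refine mul_mem (mem_coverF_iff.2 ⟨1, rho 2, ?_, ?_, rfl⟩) (coverP_le_coverF hh)
      · change Oct (unit 1) 1
        rw [unit_one]
        exact oct_one
      · exact ⟨_, hm, rfl, hc⟩

/-- The elements of `Spin` given by a list of pairs of quaternions, with the second component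
conjugated by `v`. -/
theorem ncard_unit_pairs (l : List (ℍ[ℤ] × ℍ[ℤ])) (hl : l.Nodup)
    (h : ∀ x ∈ l, x.1 ∈ octaList ∧ x.2 ∈ octaList) (v : unitary ℍ[ℝ]) :
    {g : Spin | ∃ x ∈ l, g = (unit x.1, v * unit x.2 * v⁻¹)}.ncard = l.length := by
  have e : {g : Spin | ∃ x ∈ l, g = (unit x.1, v * unit x.2 * v⁻¹)} =
      (fun x : ℍ[ℤ] × ℍ[ℤ] => ((unit x.1, v * unit x.2 * v⁻¹) : Spin)) '' (l.toFinset : Set _) := by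
    ext g
    simp only [Set.mem_ofPred_eq, Set.mem_image, List.coe_toFinset]
    exact ⟨fun ⟨x, hx, hg⟩ => ⟨x, hx, hg.symm⟩, fun ⟨x, hx, hg⟩ => ⟨x, hx, hg.symm⟩⟩
  rw [e, Set.InjOn.ncard_image, Set.ncard_coe_finset, List.toFinset_card_of_nodup hl]
  intro x hx y hy hxy
  simp only [List.coe_toFinset, Set.mem_ofPred_eq] at hx hy
  obtain ⟨h1, h2⟩ := Prod.mk.inj hxy
  exact Prod.ext (unit_injOn_octaList (h x hx).1 (h y hy).1 h1)
    (unit_injOn_octaList (h x hx).2 (h y hy).2 (by simpa using h2))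

theorem mem_octaList_product {x : ℍ[ℤ] × ℍ[ℤ]} :
    x ∈ octaList ×ˢ octaList ↔ x.1 ∈ octaList ∧ x.2 ∈ octaList := List.pair_mem_product

theorem octaList_product_nodup : (octaList ×ˢ octaList).Nodup :=
  octaList_nodup.product octaList_nodup

/-- Of the 48² pairs one in six lies over the diagonal of S₃ × S₃; for `coverF` it is one in two. -/
theorem card_coverP : Nat.card coverP = 384 := by
  have e : (coverP : Set Spin) = {g : Spin | ∃ x ∈ (octaList ×ˢ octaList).filter
      (fun x => octaClass x.1 = octaClass x.2), g = (unit x.1, 1 * unit x.2 * 1⁻¹)} := by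
    ext g
    simp only [SetLike.mem_coe, mem_coverP_iff, Set.mem_ofPred_eq, List.mem_filter,
      mem_octaList_product, one_mul, inv_one, mul_one, decide_eq_true_eq]
    constructor
    · rintro ⟨d, ⟨p, hp, h1, rfl⟩, ⟨q, hq, h2, h3⟩⟩
      exact ⟨(p, q), ⟨⟨hp, hq⟩, h3.symm⟩, Prod.ext h1 h2⟩
    · rintro ⟨x, ⟨⟨hp, hq⟩, h⟩, rfl⟩
      exact ⟨_, ⟨_, hp, rfl, rfl⟩, ⟨_, hq, rfl, h.symm⟩⟩
  rw [← SetLike.coe_sort_coe, Nat.card_coe_set_eq, e, ncard_unit_pairs]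
  · decide +kernel
  · exact octaList_product_nodup.filter _
  · intro x hx
    exact mem_octaList_product.1 (List.mem_of_mem_filter hx)

theorem card_coverF : Nat.card coverF = 1152 := by
  have e : (coverF : Set Spin) = {g : Spin | ∃ x ∈ (octaList ×ˢ octaList).filter
      (fun x => isR (octaClass x.1) = isR (octaClass x.2)),
        g = (unit x.1, 1 * unit x.2 * 1⁻¹)} := by
    ext g
    simp only [SetLike.mem_coe, mem_coverF_iff, Set.mem_ofPred_eq, List.mem_filter,
      mem_octaList_product, one_mul, inv_one, mul_one, decide_eq_true_eq]
    constructor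
    · rintro ⟨d, e, ⟨p, hp, h1, rfl⟩, ⟨q, hq, h2, rfl⟩, h3⟩
      exact ⟨(p, q), ⟨⟨hp, hq⟩, h3⟩, Prod.ext h1 h2⟩
    · rintro ⟨x, ⟨⟨hp, hq⟩, h⟩, rfl⟩
      exact ⟨_, _, ⟨_, hp, rfl, rfl⟩, ⟨_, hq, rfl, rfl⟩, h⟩
  rw [← SetLike.coe_sort_coe, Nat.card_coe_set_eq, e, ncard_unit_pairs]
  · decide +kernel
  · exact octaList_product_nodup.filter _
  · intro x hx
    exact mem_octaList_product.1 (List.mem_of_mem_filter hx)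

theorem relIndex_coverP : coverP.relIndex coverF = 3 := by
  have h := Subgroup.card_mul_index (coverP.subgroupOf coverF)
  rw [Nat.card_congr (Subgroup.subgroupOfEquivOfLe coverP_le_coverF).toEquiv, card_coverP,
    card_coverF] at h
  change (coverP.subgroupOf coverF).index = 3
  omega

/-! ### Equivalence types -/

theorem Sim.refl (q : ℍ[ℤ]) : Sim q q := ⟨1, one_mem _, 1, one_mem _, by simp⟩

theorem Sim.symm {p q : ℍ[ℤ]} (h : Sim p q) : Sim q p := by
  obtain ⟨x, hx, y, hy, h⟩ := h
  exact ⟨x⁻¹, inv_mem hx, y⁻¹, inv_mem hy, by rw [h]; group⟩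

theorem Sim.trans {p q r : ℍ[ℤ]} (h : Sim p q) (h' : Sim q r) : Sim p r := by
  obtain ⟨x, hx, y, hy, h⟩ := h
  obtain ⟨x', hx', y', hy', h'⟩ := h'
  exact ⟨x' * x, mul_mem hx' hx, y * y', mul_mem hy hy', by rw [h', h]; group⟩

theorem HasType.of_sim {p q : ℍ[ℤ]} {i : Fin 6} (h : HasType p i) (hq : q ≠ 0) (hs : Sim p q) :
    HasType q i := by
  refine ⟨hq, ?_⟩
  have e : {k : Fin 6 | ∃ c ∈ form k, c ≠ 0 ∧ Sim q c} =
      {k : Fin 6 | ∃ c ∈ form k, c ≠ 0 ∧ Sim p c} := by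
    ext k
    exact ⟨fun ⟨c, h1, h2, h3⟩ => ⟨c, h1, h2, hs.trans h3⟩,
      fun ⟨c, h1, h2, h3⟩ => ⟨c, h1, h2, hs.symm.trans h3⟩⟩
  rw [e]
  exact h.2

theorem HasType.le {p c : ℍ[ℤ]} {i j : Fin 6} (h : HasType p i) (hc : c ∈ form j) (h0 : c ≠ 0)
    (hs : Sim p c) : i ≤ j := h.2.2 ⟨c, hc, h0, hs⟩

theorem exists_hasType {p : ℍ[ℤ]} (hp : p ≠ 0) : ∃ i, HasType p i := by
  have hne : {k : Fin 6 | ∃ c ∈ form k, c ≠ 0 ∧ Sim p c}.Nonempty :=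
    ⟨5, p, Set.mem_univ _, hp, Sim.refl p⟩
  obtain ⟨i, hi, hmin⟩ := WellFounded.has_min (wellFounded_lt (α := Fin 6)) _ hne
  exact ⟨i, hp, hi, fun j hj => not_lt.mp (hmin j hj)⟩

theorem HasType.exists_form {p : ℍ[ℤ]} {i : Fin 6} (h : HasType p i) :
    ∃ c ∈ form i, HasType c i ∧ Sim p c := by
  obtain ⟨c, hc, h0, hs⟩ := h.2.1
  exact ⟨c, hc, h.of_sim h0 hs, hs⟩

/-- The factors k and l may be negative because -1 belongs to `octa`. This is how an integral
identity exhibits an equivalence. -/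
theorem sim_of_smul {p c x y : ℍ[ℤ]} (hp : p ≠ 0) (hx : x ∈ octaList) (hy : y ∈ octaList)
    (hc : c ≠ 0) {k l : ℤ} (hk : k ≠ 0) (hl : l ≠ 0) (h : k • p = l • (x * c * y)) : Sim p c := by
  have hx0 := ne_zero_of_mem_octaList hx
  have hy0 := ne_zero_of_mem_octaList hy
  have hz := quat_mul_ne_zero (quat_mul_ne_zero hx0 hc) hy0
  have h1 : (k * k) • p = (k * l) • (x * c * y) := by rw [mul_smul, h, ← mul_smul]
  have hkk : 0 < k * k := mul_self_pos.2 hk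
  have key : unit p = unit (x * c * y) ∨ unit p = -unit (x * c * y) := by
    rcases lt_or_gt_of_ne (mul_ne_zero hk hl) with h2 | h2
    · right
      rw [← unit_neg hz]
      apply unit_eq_of_smul hp hkk (n := -(k * l)) (by omega)
      rw [h1, neg_smul_neg]
    · left
      exact unit_eq_of_smul hp hkk h2 h1
  rw [unit_mul (quat_mul_ne_zero hx0 hc) hy0, unit_mul hx0 hc] at key
  refine Sim.symm ?_
  rcases key with e | e
  · exact ⟨_, (oct_unit hx).mem, _, (oct_unit hy).mem, e⟩
  · refine ⟨_, (oct_unit hx).neg.mem, _, (oct_unit hy).mem, ?_⟩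
    rw [e, neg_mul, neg_mul]

theorem HasType.le_of_smul {p c x y : ℍ[ℤ]} {i j : Fin 6} (h : HasType p i) (hc : c ∈ form j)
    (hx : x ∈ octaList) (hy : y ∈ octaList) (h0 : c ≠ 0) {k l : ℤ} (hk : k ≠ 0) (hl : l ≠ 0)
    (e : k • p = l • (x * c * y)) : i ≤ j :=
  h.le hc h0 (sim_of_smul h.1 hx hy h0 hk hl e)

/-! ### The power of two in the squared norm -/

theorem padicValInt_sq_mul {a n : ℤ} (ha : a ≠ 0) (hn : n ≠ 0) :
    padicValInt 2 (a ^ 2 * n) = 2 * padicValInt 2 a + padicValInt 2 n := by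
  rw [padicValInt.mul (pow_ne_zero 2 ha) hn, sq, padicValInt.mul ha ha]
  ring

theorem even_val_iff_of_sq {a b m n : ℤ} (ha : a ≠ 0) (hb : b ≠ 0) (hm : m ≠ 0) (hn : n ≠ 0)
    (h : a ^ 2 * m = b ^ 2 * n) : Even (padicValInt 2 m) ↔ Even (padicValInt 2 n) := by
  have h1 := congrArg (padicValInt 2) h
  rw [padicValInt_sq_mul ha hm, padicValInt_sq_mul hb hn] at h1
  rw [Nat.even_iff, Nat.even_iff]
  omega

theorem padicValInt_two_two : padicValInt 2 2 = 1 := by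
  simp [padicValInt]

theorem sq_ne_two_mul_sq {a b : ℤ} (ha : a ≠ 0) (hb : b ≠ 0) : a ^ 2 ≠ 2 * b ^ 2 := by
  intro h
  have := (even_val_iff_of_sq ha hb one_ne_zero two_ne_zero (by linarith)).1 (by simp)
  rw [padicValInt_two_two] at this
  exact absurd this (by decide)

/-! ### Stabilisers of canonical quaternions -/

/-- The condition that defines `stabList`. -/
def stabPred : Fin 6 → ℍ[ℤ] → Bool
  | 0 => fun _ => true
  | 1 => fun q => (q.imI = q.imJ ∧ q.imJ = q.imK) ∨
      (nrm q = 2 ∧ q.re = 0 ∧ q.imI + q.imJ + q.imK = 0)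
  | 2 => fun q => q.imI = q.imJ ∧ q.imJ = q.imK
  | 3 => fun q => q.imJ = 0 ∧ q.imK = 0
  | 4 => fun q => q.imI = q.imJ ∧ q.imK = 0
  | 5 => fun q => q.imI = 0 ∧ q.imJ = 0 ∧ q.imK = 0

/-- For a canonical quaternion `c` of type `i`, the elements `s` of `octa` for which `c⁻¹ s c` is in
`octa` as well. -/
def stabList (i : Fin 6) : List ℍ[ℤ] := octaList.filter (stabPred i)

theorem mem_octaList_of_mem_stabList (i : Fin 6) : ∀ s ∈ stabList i, s ∈ octaList :=
  fun _ hs => List.mem_of_mem_filter hs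

theorem stabList_nodup (i : Fin 6) : (stabList i).Nodup := octaList_nodup.filter _

/-- Conjugation by i+j+k is the half-turn about a diagonal of the cube. It is not a cube symmetry,
but it fixes the rotations about that diagonal and inverts the half-turns about perpendicular edge
axes. -/
theorem stabList_one_spec : ∀ s ∈ stabList 1, ∃ t ∈ octaList, octaClass t = octaClass s ∧
    s * quat 0 1 1 1 = quat 0 1 1 1 * t := by
  decide +kernel

/-- For types 0 and 2 to 5 one takes t = s, since s commutes with c; only type 1 needs a separate
check. -/
theorem exists_of_mem_stabList {i : Fin 6} {c s : ℍ[ℤ]} (hc : c ∈ form i) (hs : s ∈ stabList i) :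
    ∃ t ∈ octaList, octaClass t = octaClass s ∧ s * c = c * t := by
  have hso := mem_octaList_of_mem_stabList i s hs
  fin_cases i
  · obtain rfl : c = 1 := hc
    exact ⟨s, hso, rfl, by rw [mul_one, one_mul]⟩
  · obtain rfl : c = quat 0 1 1 1 := hc
    exact stabList_one_spec s hs
  · obtain ⟨m, n, rfl⟩ := hc
    have h := of_decide_eq_true (List.mem_filter.1 hs).2
    refine ⟨s, hso, rfl, ?_⟩
    change s * quat m n n n = quat m n n n * s
    ext <;> simp [h.1, h.2] <;> ring
  · obtain ⟨m, n, rfl⟩ := hc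
    have h := of_decide_eq_true (List.mem_filter.1 hs).2
    refine ⟨s, hso, rfl, ?_⟩
    change s * quat m n 0 0 = quat m n 0 0 * s
    ext <;> simp [h.1, h.2] <;> ring
  · obtain ⟨m, n, rfl⟩ := hc
    have h := of_decide_eq_true (List.mem_filter.1 hs).2
    refine ⟨s, hso, rfl, ?_⟩
    change s * quat m n n 0 = quat m n n 0 * s
    ext <;> simp [h.1, h.2] <;> ring
  · have h := of_decide_eq_true (List.mem_filter.1 hs).2
    refine ⟨s, hso, rfl, ?_⟩
    ext <;> simp [h.1, h.2.1, h.2.2] <;> ring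

theorem abs_one_cases {a : ℤ} (h : |a| ≤ 1) : a = -1 ∨ a = 0 ∨ a = 1 := by
  rw [abs_le] at h
  omega

/-- If `s p` and `p t` have the same direction for `s, t` in `octa`, they are equal. -/
theorem mul_eq_mul_of_unit {s t p : ℍ[ℤ]} (hs : s ∈ octaList) (ht : t ∈ octaList) (hp : p ≠ 0)
    (h : unit s * unit p = unit p * unit t) : s * p = p * t ∧ nrm s = nrm t ∧ s.re = t.re := by
  have hs0 := ne_zero_of_mem_octaList hs
  have ht0 := ne_zero_of_mem_octaList ht
  rw [← unit_mul hs0 hp, ← unit_mul hp ht0] at h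
  obtain ⟨m, n, hm, hn, hmn⟩ :=
    exists_smul_of_unit_eq (quat_mul_ne_zero hs0 hp) (quat_mul_ne_zero hp ht0) h
  have h1 := congrArg nrm hmn
  rw [nrm_zsmul, nrm_zsmul, nrm_mul, nrm_mul] at h1
  have hpp := nrm_pos hp
  have h2 : m ^ 2 * nrm s = n ^ 2 * nrm t :=
    mul_right_cancel₀ hpp.ne' (by linear_combination h1)
  -- Multiplying by p̄ on the right isolates the traces: the real parts of s p p̄ and p t p̄ are
  -- |p|² times those of s and t.
  have h3 : m * s.re = n * t.re := by
    have := congrArg (fun x => (x * star p).re) hmn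
    have e1 : ((m • (s * p)) * star p).re = nrm p * (m * s.re) := by
      simp [nrm]
      ring
    have e2 : ((n • (p * t)) * star p).re = nrm p * (n * t.re) := by
      simp [nrm]
      ring
    simp only [e1, e2] at this
    exact mul_left_cancel₀ hpp.ne' this
  obtain ⟨as, -, -, -, ns⟩ := mem_octaList_iff.1 hs
  obtain ⟨at', bt, ct, dt, nt⟩ := mem_octaList_iff.1 ht
  have hfour : ∀ x ∈ octaList, nrm x = 4 → x.re = 1 ∨ x.re = -1 := by decide +kernel
  have hre : ∀ a b : ℤ, (a = -1 ∨ a = 0 ∨ a = 1) → (b = 1 ∨ b = -1) → 2 * a ≠ b := by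
    intro a b ha hb
    omega
  -- Norms are 1, 2 or 4. A ratio 2 would make √2 rational. A ratio 4 would make the real part ±1 of
  -- an element of norm 4 twice an integer.
  have key : nrm s = nrm t := by
    have pos2 : ∀ {a b : ℤ}, 0 < a → 0 < b → a ^ 2 = b ^ 2 * 4 → a = 2 * b := by
      intro a b ha hb hab
      nlinarith
    rcases ns with e | e | e <;> rcases nt with e' | e' | e' <;> rw [e, e'] at h2 ⊢ <;>
      try rfl
    · exact absurd (by linarith) (sq_ne_two_mul_sq hm.ne' hn.ne')
    · have hmn2 := pos2 hm hn (by linarith)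
      subst hmn2
      have : 2 * s.re = t.re := mul_left_cancel₀ hn.ne' (by linear_combination h3)
      exact absurd this (hre _ _ (abs_one_cases as) (hfour t ht e'))
    · exact absurd (by linarith) (sq_ne_two_mul_sq hn.ne' hm.ne')
    · exact absurd (by linarith) (sq_ne_two_mul_sq hm.ne' hn.ne')
    · have hmn2 := pos2 hn hm (by linarith)
      subst hmn2
      have : 2 * t.re = s.re := mul_left_cancel₀ hm.ne' (by linear_combination -h3)
      exact absurd this (hre _ _ (abs_one_cases at') (hfour s hs e))
    · exact absurd (by linarith) (sq_ne_two_mul_sq hn.ne' hm.ne')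
  rw [key] at h2
  have h4 : m ^ 2 = n ^ 2 := mul_right_cancel₀ (nrm_pos ht0).ne' h2
  have h5 : m = n := by nlinarith
  subst h5
  refine ⟨?_, key, mul_left_cancel₀ hm.ne' h3⟩
  have := congrArg ofInt hmn
  rw [ofInt_zsmul, ofInt_zsmul] at this
  exact ofInt_injective (smul_right_injective _ (by exact_mod_cast hm.ne') this)

/-- `(a, b)` is proportional to one of the pairs `(k, l)` with `(k², l²)` in a given list. -/
def RatioIn (l : List (ℤ × ℤ)) (a b : ℤ) : Prop :=
  (a ≠ 0 ∨ b ≠ 0) ∧ ∃ x ∈ l, a * a * x.1 = b * b * x.2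

instance (l : List (ℤ × ℤ)) (a b : ℤ) : Decidable (RatioIn l a b) := by
  unfold RatioIn; infer_instance

/-- One of the coordinates of `P`, `Q` has its ratio in the given list. -/
def QuatRatioIn (l : List (ℤ × ℤ)) (P Q : ℍ[ℤ]) : Prop :=
  RatioIn l P.re Q.re ∨ RatioIn l P.imI Q.imI ∨ RatioIn l P.imJ Q.imJ ∨ RatioIn l P.imK Q.imK

instance (l : List (ℤ × ℤ)) (P Q : ℍ[ℤ]) : Decidable (QuatRatioIn l P Q) := by
  unfold QuatRatioIn; infer_instance

theorem exists_of_ratioIn {l : List (ℤ × ℤ)} {a b m n : ℤ} (h : RatioIn l a b)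
    (hl : ∀ x ∈ l, 0 ≤ x.1 ∧ 0 ≤ x.2 ∧ (x.1 ≠ 0 ∨ x.2 ≠ 0)) (e : m * a + n * b = 0) :
    ∃ x ∈ l, n * n * x.1 = m * m * x.2 := by
  obtain ⟨h0, x, hx, hab⟩ := h
  refine ⟨x, hx, ?_⟩
  obtain ⟨h1, h2, h3⟩ := hl x hx
  have key : ∀ a b m n u v : ℤ, a ≠ 0 → m * a + n * b = 0 → a * a * u = b * b * v →
      n * n * u = m * m * v := by
    intro a b m n u v ha e hab
    have hm : m * a = -(n * b) := by linarith
    apply mul_left_cancel₀ (mul_ne_zero ha ha)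
    calc a * a * (n * n * u) = n * n * (a * a * u) := by ring
      _ = (n * b) * (n * b) * v := by rw [hab]; ring
      _ = (m * a) * (m * a) * v := by rw [hm]; ring
      _ = a * a * (m * m * v) := by ring
  rcases h0 with h0 | h0
  · exact key a b m n _ _ h0 e hab
  · exact (key b a n m _ _ h0 (by linarith) hab.symm).symm

theorem exists_of_quatRatioIn {l : List (ℤ × ℤ)} {P Q : ℍ[ℤ]} {m n : ℤ} (h : QuatRatioIn l P Q)
    (hl : ∀ x ∈ l, 0 ≤ x.1 ∧ 0 ≤ x.2 ∧ (x.1 ≠ 0 ∨ x.2 ≠ 0)) (e : m • P + n • Q = 0) :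
    ∃ x ∈ l, n * n * x.1 = m * m * x.2 := by
  have e1 := congrArg QuaternionAlgebra.re e
  have e2 := congrArg QuaternionAlgebra.imI e
  have e3 := congrArg QuaternionAlgebra.imJ e
  have e4 := congrArg QuaternionAlgebra.imK e
  simp at e1 e2 e3 e4
  rcases h with h | h | h | h
  · exact exists_of_ratioIn h hl e1
  · exact exists_of_ratioIn h hl e2
  · exact exists_of_ratioIn h hl e3
  · exact exists_of_ratioIn h hl e4

/-- With c = m·1 + n·(0,1,1,1) the condition s c = c t is linear in m and n. Outside the generic
stabiliser some coordinate of it is nontrivial and fixes m : n up to sign; the list collects the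
ratios that occur. The next two lemmas do this for (m,n,0,0) and (m,n,n,0). -/
theorem ratio_form_two : ∀ s ∈ octaList, ∀ t ∈ octaList, s ∈ stabList 2 ∨
    nrm s ≠ nrm t ∨ s.re ≠ t.re ∨
    QuatRatioIn [(0, 1), (1, 0), (1, 1), (9, 1)] (s * quat 1 0 0 0 - quat 1 0 0 0 * t)
      (s * quat 0 1 1 1 - quat 0 1 1 1 * t) := by
  decide +kernel

theorem ratio_form_three : ∀ s ∈ octaList, ∀ t ∈ octaList, s ∈ stabList 3 ∨
    nrm s ≠ nrm t ∨ s.re ≠ t.re ∨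
    QuatRatioIn [(0, 1), (1, 0), (1, 1)] (s * quat 1 0 0 0 - quat 1 0 0 0 * t)
      (s * quat 0 1 0 0 - quat 0 1 0 0 * t) := by
  decide +kernel

theorem ratio_form_four : ∀ s ∈ octaList, ∀ t ∈ octaList, s ∈ stabList 4 ∨
    nrm s ≠ nrm t ∨ s.re ≠ t.re ∨
    QuatRatioIn [(0, 1), (1, 0), (1, 1), (4, 1)] (s * quat 1 0 0 0 - quat 1 0 0 0 * t)
      (s * quat 0 1 1 0 - quat 0 1 1 0 * t) := by
  decide +kernel

theorem quat_ne_zero {a b c d : ℤ} (h : quat a b c d ≠ quat 0 0 0 0) : quat a b c d ≠ 0 := by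
  intro h0
  apply h
  rw [h0]
  rfl

theorem one_mem_octaList : (1 : ℍ[ℤ]) ∈ octaList := by decide +kernel

theorem mem_stabList_one : ∀ s ∈ octaList, ∀ t ∈ octaList,
    s * quat 0 1 1 1 = quat 0 1 1 1 * t → s ∈ stabList 1 := by
  decide +kernel

theorem eq_or_eq_neg_of_mul_self {m n : ℤ} (h : n * n = m * m) : m = n ∨ m = -n := by
  rw [← sq, ← sq] at h
  exact (sq_eq_sq_iff_eq_or_eq_neg.1 h.symm)

/-- Degenerate members of the family `(m, n, n, n)`. -/
theorem form_two_degenerate {m n : ℤ} (h : HasType (quat m n n n) 2) {x : ℤ × ℤ}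
    (hx : x ∈ [((0 : ℤ), (1 : ℤ)), (1, 0), (1, 1), (9, 1)])
    (e : n * n * x.1 = m * m * x.2) : False := by
  have h0 := h.1
  simp only [List.mem_cons, List.not_mem_nil, or_false] at hx
  have one : (1 : ℍ[ℤ]) ∈ form 0 := rfl
  have thr : quat 0 1 1 1 ∈ form 1 := rfl
  have thr0 : quat (0 : ℤ) 1 1 1 ≠ 0 := quat_ne_zero (by decide)
  have w1 : quat 1 1 1 1 ∈ octaList := by decide +kernel
  have w2 : quat (-1) 1 1 1 ∈ octaList := by decide +kernel
  have w3 : quat 1 (-1) (-1) (-1) ∈ octaList := by decide +kernel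
  -- The four ratios are m = 0, n = 0, m = ±n and m = ±3n. They give the directions (0,1,1,1), 1, an
  -- element of `octa`, and (0,1,1,1) times an element of `octa`.
  rcases hx with rfl | rfl | rfl | rfl
  · have hm : m = 0 := by simpa using e.symm
    subst hm
    have hn : n ≠ 0 := by rintro rfl; exact h0 rfl
    refine absurd (h.le_of_smul thr one_mem_octaList one_mem_octaList thr0 one_ne_zero hn ?_)
      (by decide)
    ext <;> simp
  · have hn : n = 0 := by simpa using e
    subst hn
    have hm : m ≠ 0 := by rintro rfl; exact h0 rfl
    refine absurd (h.le_of_smul one one_mem_octaList one_mem_octaList one_ne_zero one_ne_zero hm ?_)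
      (by decide)
    ext <;> simp
  · rw [mul_one, mul_one] at e
    rcases eq_or_eq_neg_of_mul_self e with rfl | rfl
    · have hm : m ≠ 0 := by rintro rfl; exact h0 rfl
      refine absurd (h.le_of_smul one w1 one_mem_octaList one_ne_zero one_ne_zero hm ?_)
        (by decide)
      ext <;> simp
    · have hn : n ≠ 0 := by rintro rfl; exact h0 rfl
      refine absurd (h.le_of_smul one w2 one_mem_octaList one_ne_zero one_ne_zero hn ?_)
        (by decide)
      ext <;> simp
  · rcases eq_or_eq_neg_of_mul_self (m := m) (n := 3 * n) (by linarith) with rfl | rfl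
    · have hn : n ≠ 0 := by rintro rfl; exact h0 rfl
      refine absurd (h.le_of_smul thr one_mem_octaList w3 thr0 one_ne_zero hn ?_)
        (by decide)
      ext <;> simp
      ring
    · have hn : n ≠ 0 := by rintro rfl; exact h0 rfl
      refine absurd (h.le_of_smul thr one_mem_octaList w1 thr0 one_ne_zero hn ?_)
        (by decide)
      ext <;> simp
      ring

/-- Degenerate members of the family `(m, n, 0, 0)`. -/
theorem form_three_degenerate {m n : ℤ} (h : HasType (quat m n 0 0) 3) {x : ℤ × ℤ}
    (hx : x ∈ [((0 : ℤ), (1 : ℤ)), (1, 0), (1, 1)])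
    (e : n * n * x.1 = m * m * x.2) : False := by
  have h0 := h.1
  simp only [List.mem_cons, List.not_mem_nil, or_false] at hx
  have one : (1 : ℍ[ℤ]) ∈ form 0 := rfl
  have w1 : quat 0 1 0 0 ∈ octaList := by decide +kernel
  have w2 : quat 1 1 0 0 ∈ octaList := by decide +kernel
  have w3 : quat (-1) 1 0 0 ∈ octaList := by decide +kernel
  -- In each case, m = 0, n = 0 or m = ±n, the quaternion points along an element of `octa`.
  rcases hx with rfl | rfl | rfl
  · have hm : m = 0 := by simpa using e.symm
    subst hm
    have hn : n ≠ 0 := by rintro rfl; exact h0 rfl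
    refine absurd (h.le_of_smul one w1 one_mem_octaList one_ne_zero one_ne_zero hn ?_)
      (by decide)
    ext <;> simp
  · have hn : n = 0 := by simpa using e
    subst hn
    have hm : m ≠ 0 := by rintro rfl; exact h0 rfl
    refine absurd (h.le_of_smul one one_mem_octaList one_mem_octaList one_ne_zero one_ne_zero hm ?_)
      (by decide)
    ext <;> simp
  · rw [mul_one, mul_one] at e
    rcases eq_or_eq_neg_of_mul_self e with rfl | rfl
    · have hm : m ≠ 0 := by rintro rfl; exact h0 rfl
      refine absurd (h.le_of_smul one w2 one_mem_octaList one_ne_zero one_ne_zero hm ?_)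
        (by decide)
      ext <;> simp
    · have hn : n ≠ 0 := by rintro rfl; exact h0 rfl
      refine absurd (h.le_of_smul one w3 one_mem_octaList one_ne_zero one_ne_zero hn ?_)
        (by decide)
      ext <;> simp

/-- Degenerate members of the family `(m, n, n, 0)`. -/
theorem form_four_degenerate {m n : ℤ} (h : HasType (quat m n n 0) 4) {x : ℤ × ℤ}
    (hx : x ∈ [((0 : ℤ), (1 : ℤ)), (1, 0), (1, 1), (4, 1)])
    (e : n * n * x.1 = m * m * x.2) : False := by
  have h0 := h.1
  simp only [List.mem_cons, List.not_mem_nil, or_false] at hx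
  have one : (1 : ℍ[ℤ]) ∈ form 0 := rfl
  have thr : quat 0 1 1 1 ∈ form 1 := rfl
  have thr0 : quat (0 : ℤ) 1 1 1 ≠ 0 := quat_ne_zero (by decide)
  have ij : quat 0 1 1 0 ∈ octaList := by decide +kernel
  have i1 : quat 0 1 0 0 ∈ octaList := by decide +kernel
  have j1 : quat 0 0 1 0 ∈ octaList := by decide +kernel
  have k1 : quat 1 0 0 1 ∈ octaList := by decide +kernel
  have k2 : quat 1 0 0 (-1) ∈ octaList := by decide +kernel
  -- For m = 0 or n = 0 the direction lies in `octa`; for m = ±n and m = ±2n the quaternion is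
  -- equivalent to (0,1,1,1).
  rcases hx with rfl | rfl | rfl | rfl
  · have hm : m = 0 := by simpa using e.symm
    subst hm
    have hn : n ≠ 0 := by rintro rfl; exact h0 rfl
    refine absurd (h.le_of_smul one ij one_mem_octaList one_ne_zero one_ne_zero hn ?_)
      (by decide)
    ext <;> simp
  · have hn : n = 0 := by simpa using e
    subst hn
    have hm : m ≠ 0 := by rintro rfl; exact h0 rfl
    refine absurd (h.le_of_smul one one_mem_octaList one_mem_octaList one_ne_zero one_ne_zero hm ?_)
      (by decide)
    ext <;> simp
  · rw [mul_one, mul_one] at e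
    rcases eq_or_eq_neg_of_mul_self e with rfl | rfl
    · have hm : m ≠ 0 := by rintro rfl; exact h0 rfl
      refine absurd (h.le_of_smul thr j1 i1 thr0 one_ne_zero
        (neg_ne_zero.2 hm) ?_) (by decide)
      ext <;> simp
    · have hn : n ≠ 0 := by rintro rfl; exact h0 rfl
      refine absurd (h.le_of_smul thr i1 j1 thr0 one_ne_zero
        (neg_ne_zero.2 hn) ?_) (by decide)
      ext <;> simp
  · rcases eq_or_eq_neg_of_mul_self (m := m) (n := 2 * n) (by linarith) with rfl | rfl
    · have hn : n ≠ 0 := by rintro rfl; exact h0 rfl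
      refine absurd (h.le_of_smul thr k1 j1 thr0 one_ne_zero (neg_ne_zero.2 hn) ?_)
        (by decide)
      ext <;> simp
      ring
    · have hn : n ≠ 0 := by rintro rfl; exact h0 rfl
      refine absurd (h.le_of_smul thr k2 i1 thr0 one_ne_zero hn ?_)
        (by decide)
      ext <;> simp
      ring

/-- A representative of the conjugacy class in `octa`. -/
def octaStd (s : ℍ[ℤ]) : ℍ[ℤ] :=
  if nrm s = 1 then quat 0 1 0 0 else if nrm s = 4 then quat s.re 1 1 1
  else if s.re = 0 then quat 0 1 1 0 else quat s.re 1 0 0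

/-- Apart from ±1, a conjugacy class of `octa` is determined by the norm and real part of its
integral representatives. -/
theorem exists_conj_octaStd : ∀ s ∈ octaList, s ∈ stabList 5 ∨
    ∃ x ∈ octaList, x * s * star x = nrm x • octaStd s := by
  decide +kernel

theorem star_mem {x : ℍ[ℤ]} (h : x ∈ octaList) : star x ∈ octaList :=
  mem_octaList_iff.2 (star_mem_octaList x h).1

theorem mem_stabList_five_neg : ∀ s ∈ octaList, ∀ t ∈ octaList, t ∈ stabList 5 →
    nrm s = nrm t → s.re = t.re → s ∈ stabList 5 := by
  decide +kernel

/-- The centralisers of i, i+j+k and i+j are the planes (m,n,0,0), (m,n,n,n) and (m,n,n,0). -/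
theorem form_of_commute_octaStd {c s : ℍ[ℤ]} (h : octaStd s * c = c * octaStd s) :
    ∃ j : Fin 6, j < 5 ∧ c ∈ form j := by
  have h1 := congrArg QuaternionAlgebra.imI h
  have h2 := congrArg QuaternionAlgebra.imJ h
  have h3 := congrArg QuaternionAlgebra.imK h
  unfold octaStd at h1 h2 h3
  split_ifs at h1 h2 h3
  · simp at h1 h2 h3
    exact ⟨3, by decide, c.re, c.imI, QuaternionAlgebra.ext rfl rfl (by dsimp only; omega) (by dsimp only; omega)⟩
  · simp at h1 h2 h3
    refine ⟨2, by decide, c.re, c.imI, QuaternionAlgebra.ext rfl rfl ?_ ?_⟩ <;> dsimp only <;>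
      linarith
  · simp at h1 h2 h3
    refine ⟨4, by decide, c.re, c.imI, QuaternionAlgebra.ext rfl rfl ?_ ?_⟩ <;> dsimp only <;>
      linarith
  · simp at h1 h2 h3
    refine ⟨3, by decide, c.re, c.imI, QuaternionAlgebra.ext rfl rfl ?_ ?_⟩ <;> dsimp only <;>
      linarith

/-- If x conjugates s to d and y conjugates t to d, then s c = c t turns into x c ȳ commuting with
d. -/
theorem mul_eq_of_conj {s t c x y d : ℍ[ℤ]} (h : s * c = c * t) (hx : x ≠ 0) (hy : y ≠ 0)
    (h1 : x * s * star x = nrm x • d) (h2 : y * t * star y = nrm y • d) :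
    d * (x * c * star y) = x * c * star y * d := by
  have cx : star x * x = Quaternion.coe (nrm x) := by
    rw [Quaternion.star_mul_self, normSq_eq_nrm]
  have cy : star y * y = Quaternion.coe (nrm y) := by
    rw [Quaternion.star_mul_self, normSq_eq_nrm]
  have e1 : nrm x • (d * (x * c * star y)) = nrm x • (x * s * c * star y) := by
    calc nrm x • (d * (x * c * star y)) = (nrm x • d) * (x * c * star y) := by
          rw [smul_mul_assoc]
      _ = x * s * (star x * x) * c * star y := by rw [← h1]; noncomm_ring
      _ = nrm x • (x * s * c * star y) := by
          rw [cx]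
          ext <;> simp <;> ring
  have e2 : nrm y • (x * c * star y * d) = nrm y • (x * c * t * star y) := by
    calc nrm y • (x * c * star y * d) = (x * c * star y) * (nrm y • d) := by
          rw [mul_smul_comm]
      _ = x * c * (star y * y) * t * star y := by rw [← h2]; noncomm_ring
      _ = nrm y • (x * c * t * star y) := by
          rw [cy]
          ext <;> simp <;> ring
  have cancel : ∀ (n : ℤ) (a b : ℍ[ℤ]), n ≠ 0 → n • a = n • b → a = b := by
    intro n a b hn hab
    have := congrArg ofInt hab
    rw [ofInt_zsmul, ofInt_zsmul] at this
    exact ofInt_injective (smul_right_injective _ (by exact_mod_cast hn) this)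
  rw [cancel _ _ _ (nrm_pos hx).ne' e1, cancel _ _ _ (nrm_pos hy).ne' e2]
  rw [mul_assoc x s c, h]
  noncomm_ring

/-- For types 2 to 4 an extra s would force a degenerate parameter ratio. For type 5, s and t are
conjugate to the same standard element, so c would be equivalent to a quaternion commuting with it,
which has a form of smaller type. -/
theorem mem_stabList_of_unit {i : Fin 6} {c s t : ℍ[ℤ]} (hc : c ∈ form i) (h : HasType c i)
    (hs : s ∈ octaList) (ht : t ∈ octaList) (e : unit s * unit c = unit c * unit t) :
    s ∈ stabList i := by
  obtain ⟨e1, e2, e3⟩ := mul_eq_mul_of_unit hs ht h.1 e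
  have expand : ∀ (m n : ℤ) (u v : ℍ[ℤ]), s * (m • u + n • v) = (m • u + n • v) * t →
      m • (s * u - u * t) + n • (s * v - v * t) = 0 := by
    intro m n u v huv
    have : s * (m • u + n • v) - (m • u + n • v) * t = 0 := sub_eq_zero.2 huv
    rw [← this, mul_add, add_mul, mul_smul_comm, mul_smul_comm, smul_mul_assoc, smul_mul_assoc,
      smul_sub, smul_sub]
    abel
  fin_cases i
  · exact List.mem_filter.2 ⟨hs, rfl⟩
  · obtain rfl : c = quat 0 1 1 1 := hc
    exact mem_stabList_one s hs t ht e1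
  · obtain ⟨m, n, rfl⟩ := hc
    rcases ratio_form_two s hs t ht with hm | hm | hm | hm
    · exact hm
    · exact absurd e2 hm
    · exact absurd e3 hm
    · have hd : quat m n n n = m • quat 1 0 0 0 + n • quat 0 1 1 1 := by
        ext <;> simp
      obtain ⟨x, hx, hx2⟩ := exists_of_quatRatioIn hm (by decide)
        (expand m n _ _ (by rw [← hd]; exact e1))
      exact (form_two_degenerate h hx hx2).elim
  · obtain ⟨m, n, rfl⟩ := hc
    rcases ratio_form_three s hs t ht with hm | hm | hm | hm
    · exact hm
    · exact absurd e2 hm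
    · exact absurd e3 hm
    · have hd : quat m n 0 0 = m • quat 1 0 0 0 + n • quat 0 1 0 0 := by
        ext <;> simp
      obtain ⟨x, hx, hx2⟩ := exists_of_quatRatioIn hm (by decide)
        (expand m n _ _ (by rw [← hd]; exact e1))
      exact (form_three_degenerate h hx hx2).elim
  · obtain ⟨m, n, rfl⟩ := hc
    rcases ratio_form_four s hs t ht with hm | hm | hm | hm
    · exact hm
    · exact absurd e2 hm
    · exact absurd e3 hm
    · have hd : quat m n n 0 = m • quat 1 0 0 0 + n • quat 0 1 1 0 := by
        ext <;> simp
      obtain ⟨x, hx, hx2⟩ := exists_of_quatRatioIn hm (by decide)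
        (expand m n _ _ (by rw [← hd]; exact e1))
      exact (form_four_degenerate h hx hx2).elim
  · rcases exists_conj_octaStd s hs with h1 | ⟨x, hx, h1⟩
    · exact h1
    rcases exists_conj_octaStd t ht with h2 | ⟨y, hy, h2⟩
    · exact mem_stabList_five_neg s hs t ht h2 e2 e3
    exfalso
    have hstd : octaStd t = octaStd s := by
      unfold octaStd
      rw [e2, e3]
    rw [hstd] at h2
    have hx0 := ne_zero_of_mem_octaList hx
    have hy0 := ne_zero_of_mem_octaList hy
    have hcom := mul_eq_of_conj e1 hx0 hy0 h1 h2
    obtain ⟨j, hj, hform⟩ := form_of_commute_octaStd hcom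
    have hz := quat_mul_ne_zero (quat_mul_ne_zero hx0 h.1) (star_quat_ne_zero hy0)
    have hsim : Sim c (x * c * star y) :=
      ⟨_, (oct_unit hx).mem, _, (oct_unit (star_mem hy)).mem, by
        rw [unit_mul (quat_mul_ne_zero hx0 h.1) (star_quat_ne_zero hy0), unit_mul hx0 h.1]⟩
    exact absurd (h.le hform hz hsim) (not_le.2 hj)

/-! ### The image of the stabiliser in `S₃` -/

/-- The classes of the elements of `stabList i`. -/
def stabClass : Fin 6 → List (DihedralGroup 3)
  | 0 => [.r 0, .r 1, .r 2, .sr 0, .sr 1, .sr 2]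
  | 1 => [.r 0, .r 1, .r 2, .sr 0, .sr 1, .sr 2]
  | 2 => [.r 0, .r 1, .r 2]
  | 3 => [.r 0, .sr 0]
  | 4 => [.r 0, .sr 2]
  | 5 => [.r 0]

theorem mem_stabClass {i : Fin 6} {d : DihedralGroup 3} :
    d ∈ stabClass i ↔ ∃ s ∈ stabList i, octaClass s = d := by
  have : ∀ i, ∀ d, d ∈ stabClass i ↔ ∃ s ∈ stabList i, octaClass s = d := by decide +kernel
  exact this i d

theorem stabClass_of_unit {i : Fin 6} {c : ℍ[ℤ]} (hc : c ∈ form i) (h : HasType c i)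
    {u v : unitary ℍ[ℝ]} {d e : DihedralGroup 3} (hu : Oct u d) (hv : Oct v e)
    (huv : u * unit c = unit c * v) : d = e ∧ d ∈ stabClass i := by
  obtain ⟨s, hs, rfl, rfl⟩ := hu
  obtain ⟨t, ht, rfl, rfl⟩ := hv
  have hm := mem_stabList_of_unit hc h hs ht huv
  refine ⟨?_, mem_stabClass.2 ⟨s, hm, rfl⟩⟩
  obtain ⟨t', ht', hcl, he⟩ := exists_of_mem_stabList hc hm
  have h1 := mul_eq_mul_of_unit hs ht h.1 huv
  -- The partner t is determined by s and c, so it is the one whose class is already known.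
  have : unit t = unit t' := by
    have e2 : unit s * unit c = unit c * unit t' := by
      rw [← unit_mul (ne_zero_of_mem_octaList hs) h.1, he,
        unit_mul h.1 (ne_zero_of_mem_octaList ht')]
    exact mul_left_cancel (huv.symm.trans e2)
  rw [unit_injOn_octaList ht ht' this, hcl]

theorem exists_of_mem_stabClass {i : Fin 6} {c : ℍ[ℤ]} (hc : c ∈ form i) (h0 : c ≠ 0)
    {d : DihedralGroup 3} (hd : d ∈ stabClass i) :
    ∃ u v, Oct u d ∧ Oct v d ∧ u * unit c = unit c * v := by
  obtain ⟨s, hs, rfl⟩ := mem_stabClass.1 hd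
  have hso := mem_octaList_of_mem_stabList i s hs
  obtain ⟨t, ht, hcl, he⟩ := exists_of_mem_stabList hc hs
  refine ⟨unit s, unit t, oct_unit hso, ⟨t, ht, rfl, hcl⟩, ?_⟩
  rw [← unit_mul (ne_zero_of_mem_octaList hso) h0, he, unit_mul h0 (ne_zero_of_mem_octaList ht)]

/-! ### Splitting of the double cosets of `coverF` -/

theorem mem_dcoset {A : Type*} [Group A] {G : Subgroup A} {a b : A} :
    b ∈ dcoset G a ↔ ∃ x ∈ G, ∃ y ∈ G, b = x * a * y := DoubleCoset.mem_doubleCoset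

theorem self_mem_dcoset {A : Type*} [Group A] (G : Subgroup A) (a : A) : a ∈ dcoset G a :=
  DoubleCoset.mem_doubleCoset_self G G a

theorem dcoset_eq_of_mem {A : Type*} [Group A] {G : Subgroup A} {a b : A} (h : b ∈ dcoset G a) :
    dcoset G b = dcoset G a := DoubleCoset.doubleCoset_eq_of_mem h

theorem dcoset_mono {A : Type*} [Group A] {G H : Subgroup A} (h : G ≤ H) (a : A) :
    dcoset G a ⊆ dcoset H a := by
  intro b hb
  obtain ⟨x, hx, y, hy, rfl⟩ := mem_dcoset.1 hb
  exact mem_dcoset.2 ⟨x, h hx, y, h hy, rfl⟩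

/-- For canonical quaternions `p`, `q` of types `i`, `j`: the words `(a, b)` and `(a', b')` give the
same double coset of `coverP`. -/
def WordEquiv (i j : Fin 6) (w w' : Fin 3 × Fin 3) : Prop :=
  ∃ x ∈ stabClass i, ∃ y ∈ stabClass j,
    x = rho w'.1 * y * (rho w.1)⁻¹ ∧ x = (rho w'.2)⁻¹ * y * rho w.2

instance (i j : Fin 6) (w w' : Fin 3 × Fin 3) : Decidable (WordEquiv i j w w') := by
  unfold WordEquiv; infer_instance

/-- The double coset of a word. -/
noncomputable def word (g : Spin) (w : Fin 3 × Fin 3) : Spin := s w.1 * g * s w.2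

/-- Classes x and y are realised by elements that pass through c and d. Inserting them into the word
produces two outer factors, and the two equations in S₃ say that these lie in `coverP`. -/
theorem WordEquiv.mem_dcoset {i j : Fin 6} {c d : ℍ[ℤ]} (hc : c ∈ form i) (hc0 : c ≠ 0)
    (hd : d ∈ form j) (hd0 : d ≠ 0) {w w' : Fin 3 × Fin 3} (h : WordEquiv i j w w') :
    word (pair c d) w' ∈ dcoset coverP (word (pair c d) w) := by
  obtain ⟨x, hx, y, hy, h1, h2⟩ := h
  obtain ⟨u, v, hu, hv, huv⟩ := exists_of_mem_stabClass hc hc0 hx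
  obtain ⟨u', v', hu', hv', huv'⟩ := exists_of_mem_stabClass hd hd0 hy
  refine Hypercubic.mem_dcoset.2 ⟨s w'.1 * (u, u') * (s w.1)⁻¹, ?_,
    (s w.2)⁻¹ * (v, v')⁻¹ * s w'.2, ?_, ?_⟩
  · rw [s_eq, s_eq]
    refine mem_coverP_iff.2 ⟨x, ?_, ?_⟩
    · simpa using hu
    · rw [h1]
      exact ((oct_omega _).mul hu').mul (oct_omega _).inv
  · have : (s w.2)⁻¹ * (v, v')⁻¹ * s w'.2 = ((s w'.2)⁻¹ * (v, v') * s w.2)⁻¹ := by group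
    rw [this]
    apply inv_mem
    rw [s_eq, s_eq]
    refine mem_coverP_iff.2 ⟨x, ?_, ?_⟩
    · simpa using hv
    · rw [h2]
      exact ((oct_omega _).inv.mul hv').mul (oct_omega _)
  · have e : (u, u') * pair c d = pair c d * (v, v') := Prod.ext huv huv'
    calc word (pair c d) w' = s w'.1 * (pair c d * (v, v')) * (v, v')⁻¹ * s w'.2 := by
          rw [word]; group
      _ = _ := by rw [← e, word]; group

/-- Cancelling the letters s_a from both sides leaves elements that pass through c and d, and
`stabClass_of_unit` controls their classes. Here the type hypothesis excludes accidental
coincidences. -/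
theorem wordEquiv_of_mem_dcoset {i j : Fin 6} {c d : ℍ[ℤ]} (hc : c ∈ form i) (hci : HasType c i)
    (hd : d ∈ form j) (hdj : HasType d j) {w w' : Fin 3 × Fin 3}
    (h : word (pair c d) w' ∈ dcoset coverP (word (pair c d) w)) : WordEquiv i j w w' := by
  obtain ⟨x, hx, y, hy, h⟩ := Hypercubic.mem_dcoset.1 h
  obtain ⟨e, hx1, hx2⟩ := mem_coverP_iff.1 hx
  obtain ⟨f, hy1, hy2⟩ := mem_coverP_iff.1 (inv_mem hy)
  have key : ((s w'.1)⁻¹ * x * s w.1) * pair c d = pair c d * (s w'.2 * y⁻¹ * (s w.2)⁻¹) := by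
    rw [word, word] at h
    have : pair c d = (s w'.1)⁻¹ * (x * (s w.1 * pair c d * s w.2) * y) * (s w'.2)⁻¹ := by
      rw [← h]; group
    conv_rhs => rw [this]
    group
  rw [s_eq, s_eq, s_eq, s_eq] at key
  obtain ⟨k1, k2⟩ := Prod.mk.inj key
  have hx1' : Oct (((1 : unitary ℍ[ℝ])⁻¹ * x.1) * 1) e := by simpa using hx1
  have hy1' : Oct ((1 : unitary ℍ[ℝ]) * y⁻¹.1 * 1⁻¹) f := by simpa using hy1
  obtain ⟨e1, e2⟩ := stabClass_of_unit hc hci hx1' hy1' k1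
  obtain ⟨e3, e4⟩ := stabClass_of_unit hd hdj
    (((oct_omega w'.1).inv.mul hx2).mul (oct_omega w.1))
    (((oct_omega w'.2).mul hy2).mul (oct_omega w.2).inv) k2
  refine ⟨e, e2, _, e4, ?_, ?_⟩
  · group
  · rw [e3, e1]
    group

/-- A finite check in S₃: the table is a transversal of the nine words modulo `WordEquiv`. -/
theorem splitTable_words : ∀ r ∈ splitTable,
    (∀ a b : Fin 3, ∃ w ∈ r.words, WordEquiv r.i r.j w (a, b)) ∧
    ∀ w ∈ r.words, ∀ w' ∈ r.words, w ≠ w' → ¬ WordEquiv r.i r.j w w' := by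
  decide +kernel

/-- The powers of `s 1` represent the cosets of `coverP` in `coverF` on both sides, so the outer
factors of a double coset reduce to letters. -/
theorem dcoset_coverF_eq (g : Spin) :
    dcoset coverF g = {x | ∃ a b : Fin 3, x ∈ dcoset coverP (word g (a, b))} := by
  ext x
  constructor
  · intro hx
    obtain ⟨u, hu, v, hv, rfl⟩ := mem_dcoset.1 hx
    obtain ⟨a, h, hh, e1⟩ := exists_s_mul (inv_mem hu)
    obtain ⟨b, k, hk, rfl⟩ := exists_s_mul hv
    have hu' : u = h⁻¹ * (s a)⁻¹ := by rw [← inv_inv u, e1, mul_inv_rev]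
    have hs : (s a)⁻¹ ∈ coverF := inv_mem (s_mem_coverF a)
    -- a left coset representative of `(s a)⁻¹`
    have key : ∃ a' : Fin 3, ∃ ε ∈ coverP, (s a)⁻¹ = ε * s a' := by
      have h3 : ∃ a' : Fin 3, (rho a)⁻¹ = rho a' := by
        have : ∀ a : Fin 3, ∃ a' : Fin 3, (rho a)⁻¹ = rho a' := by decide
        exact this a
      obtain ⟨a', ha'⟩ := h3
      refine ⟨a', (s a)⁻¹ * (s a')⁻¹, ?_, by group⟩
      rw [s_eq, s_eq]
      refine mem_coverP_iff.2 ⟨1, ?_, ?_⟩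
      · simpa using oct_one
      · have := (oct_omega a).inv.mul (oct_omega a').inv
        rwa [ha', mul_inv_cancel] at this
    obtain ⟨a', ε, hε, e2⟩ := key
    refine ⟨a', b, mem_dcoset.2 ⟨h⁻¹ * ε, mul_mem (inv_mem hh) hε, k, hk, ?_⟩⟩
    rw [hu', e2, word]
    group
  · rintro ⟨a, b, hx⟩
    obtain ⟨u, hu, v, hv, rfl⟩ := mem_dcoset.1 hx
    refine mem_dcoset.2 ⟨u * s a, mul_mem (coverP_le_coverF hu) (s_mem_coverF a), s b * v,
      mul_mem (s_mem_coverF b) (coverP_le_coverF hv), ?_⟩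
    rw [word]
    group

theorem splitsAs_of_table {r : SplitRow} (hr : r ∈ splitTable) {x : ℍ[ℤ] × ℍ[ℤ]}
    (hx : x ∈ r.pairs) : SplitsAs (pair x.1 x.2) s r.words := by
  obtain ⟨⟨hc, hd⟩, hci, hdj⟩ := hx
  obtain ⟨h1, h2⟩ := splitTable_words r hr
  constructor
  · rw [dcoset_coverF_eq]
    ext y
    constructor
    · rintro ⟨a, b, hy⟩
      obtain ⟨w, hw, hwe⟩ := h1 a b
      refine ⟨w, hw, ?_⟩
      have := dcoset_eq_of_mem (hwe.mem_dcoset hc hci.1 hd hdj.1)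
      rwa [this] at hy
    · rintro ⟨w, hw, hy⟩
      exact ⟨w.1, w.2, hy⟩
  · intro w hw w' hw' hne
    by_contra hdis
    apply h2 w hw w' hw' hne
    apply wordEquiv_of_mem_dcoset hc hci hd hdj
    have := DoubleCoset.eq_of_not_disjoint hdis
    change dcoset coverP (word (pair x.1 x.2) w) = dcoset coverP (word (pair x.1 x.2) w') at this
    rw [this]
    exact self_mem_dcoset _ _

/-! ### Interchanging the two components -/

theorem swap_mem_coverP {g : Spin} : g.swap ∈ coverP ↔ g ∈ coverP := by
  rw [mem_coverP_iff, mem_coverP_iff]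
  exact ⟨fun ⟨d, h1, h2⟩ => ⟨d, h2, h1⟩, fun ⟨d, h1, h2⟩ => ⟨d, h2, h1⟩⟩

theorem swap_mem_coverF {g : Spin} : g.swap ∈ coverF ↔ g ∈ coverF := by
  rw [mem_coverF_iff, mem_coverF_iff]
  exact ⟨fun ⟨d, e, h1, h2, h⟩ => ⟨e, d, h2, h1, h.symm⟩,
    fun ⟨d, e, h1, h2, h⟩ => ⟨e, d, h2, h1, h.symm⟩⟩

theorem mem_dcoset_swap {G : Subgroup Spin} (hG : ∀ g : Spin, g.swap ∈ G ↔ g ∈ G) {g x : Spin} :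
    x ∈ dcoset G g.swap ↔ x.swap ∈ dcoset G g := by
  rw [mem_dcoset, mem_dcoset]
  constructor
  · rintro ⟨u, hu, v, hv, rfl⟩
    exact ⟨u.swap, (hG u).2 hu, v.swap, (hG v).2 hv, rfl⟩
  · rintro ⟨u, hu, v, hv, h⟩
    refine ⟨u.swap, (hG u).2 hu, v.swap, (hG v).2 hv, ?_⟩
    rw [← Prod.swap_swap x, h]
    rfl

theorem SplitsAs.swap {g : Spin} {t : Fin 3 → Spin} {words : List (Fin 3 × Fin 3)}
    (h : SplitsAs g t words) : SplitsAs g.swap (fun k => (t k).swap) words := by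
  constructor
  · ext x
    rw [mem_dcoset_swap (fun _ => swap_mem_coverF), h.1]
    constructor
    · rintro ⟨w, hw, hx⟩
      exact ⟨w, hw, (mem_dcoset_swap (g := t w.1 * g * t w.2) (fun _ => swap_mem_coverP)).2 hx⟩
    · rintro ⟨w, hw, hx⟩
      exact ⟨w, hw, (mem_dcoset_swap (g := t w.1 * g * t w.2) (fun _ => swap_mem_coverP)).1 hx⟩
  · intro w hw w' hw' hne
    have hd := h.2 w hw w' hw' hne
    rw [Set.disjoint_left] at hd ⊢
    intro x hx hx'
    exact hd ((mem_dcoset_swap (g := t w.1 * g * t w.2) (fun _ => swap_mem_coverP)).1 hx)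
      ((mem_dcoset_swap (g := t w'.1 * g * t w'.2) (fun _ => swap_mem_coverP)).1 hx')

/-! ### Sizes of double cosets -/

/-- Orbit and stabiliser for H × H acting by (x, y)·b = x b y⁻¹. The orbit of a is the double coset,
and projection to the first component identifies the stabiliser with H ∩ a H a⁻¹. -/
theorem ncard_dcoset_mul_card {A : Type*} [Group A] (H : Subgroup A) [Finite H] (a : A) :
    (dcoset H a).ncard * Nat.card (H ⊓ H.map (MulAut.conj a).toMonoidHom : Subgroup A) =
      Nat.card H ^ 2 := by
  let _ : MulAction (H × H) A :=
    { smul := fun x y => (x.1 : A) * y * (x.2 : A)⁻¹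
      one_smul := fun y => by
        change ((1 : H) : A) * y * ((1 : H) : A)⁻¹ = y
        simp
      mul_smul := fun x x' y => by
        change ((x.1 * x'.1 : H) : A) * y * ((x.2 * x'.2 : H) : A)⁻¹ =
          (x.1 : A) * ((x'.1 : A) * y * (x'.2 : A)⁻¹) * (x.2 : A)⁻¹
        push_cast
        group }
  have smul_def : ∀ (x : H × H) (y : A), x • y = (x.1 : A) * y * (x.2 : A)⁻¹ := fun _ _ => rfl
  have horb : MulAction.orbit (H × H) a = dcoset H a := by
    ext b
    rw [MulAction.mem_orbit_iff, mem_dcoset]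
    constructor
    · rintro ⟨x, rfl⟩
      exact ⟨x.1, x.1.2, (x.2 : A)⁻¹, inv_mem x.2.2, rfl⟩
    · rintro ⟨x, hx, y, hy, rfl⟩
      exact ⟨(⟨x, hx⟩, ⟨y⁻¹, inv_mem hy⟩), by rw [smul_def]; simp⟩
  have hstab : Nat.card (MulAction.stabilizer (H × H) a) =
      Nat.card (H ⊓ H.map (MulAut.conj a).toMonoidHom : Subgroup A) := by
    refine Nat.card_congr ⟨fun x => ⟨x.1.1, ?_⟩, fun y => ⟨(⟨y, y.2.1⟩, ⟨a⁻¹ * y * a, ?_⟩), ?_⟩,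
      ?_, ?_⟩
    · refine ⟨x.1.1.2, x.1.2, x.1.2.2, ?_⟩
      have := x.2
      rw [MulAction.mem_stabilizer_iff, smul_def] at this
      change a * (x.1.2 : A) * a⁻¹ = x.1.1
      rw [mul_inv_eq_iff_eq_mul] at this ⊢
      exact this.symm
    · obtain ⟨-, z, hz, h⟩ := y.2
      rw [← h]
      change a⁻¹ * (a * z * a⁻¹) * a ∈ H
      have : a⁻¹ * (a * z * a⁻¹) * a = z := by group
      rwa [this]
    · rw [MulAction.mem_stabilizer_iff, smul_def]
      dsimp only
      group
    · rintro ⟨x, hx⟩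
      rw [MulAction.mem_stabilizer_iff, smul_def, mul_inv_eq_iff_eq_mul] at hx
      apply Subtype.ext
      refine Prod.ext (Subtype.ext rfl) (Subtype.ext ?_)
      change a⁻¹ * (x.1 : A) * a = x.2
      rw [mul_assoc, hx]
      group
    · intro y
      rfl
  rw [← horb, ← MulAction.index_stabilizer, ← hstab, mul_comm, Subgroup.card_mul_index,
    Nat.card_prod, sq]

/-- The kernel of `rot` is {(1,1), (-1,-1)}, of order two. -/
theorem card_comap_rot {K : Subgroup Iso4} (hK : K ≤ rot.range) :
    Nat.card (K.comap rot) = 2 * Nat.card K := by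
  have hker : Nat.card rot.ker = 2 := by
    rw [← SetLike.coe_sort_coe, Nat.card_coe_set_eq]
    have : (rot.ker : Set Spin) = {1, (-1, -1)} := by
      ext g
      rw [SetLike.mem_coe, MonoidHom.mem_ker, rot_eq_one_iff]
      rfl
    rw [this, Set.ncard_pair]
    intro h
    have := congrArg (fun x : Spin => ((x.1 : ℍ[ℝ])).re) h
    norm_num [Unitary.coe_neg] at this
  have h1 : (⊥ : Subgroup Spin).relIndex rot.ker * rot.ker.relIndex (K.comap rot) =
      (⊥ : Subgroup Spin).relIndex (K.comap rot) :=
    Subgroup.relIndex_mul_relIndex _ _ _ bot_le (by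
      rw [← MonoidHom.comap_bot]
      exact Subgroup.comap_mono bot_le)
  rw [Subgroup.relIndex_bot_left, Subgroup.relIndex_bot_left, hker, ← MonoidHom.comap_bot,
    Subgroup.relIndex_comap, Subgroup.map_comap_eq_self hK, Subgroup.relIndex_bot_left] at h1
  exact h1.symm

theorem rotP_le_range : rotP ≤ rot.range := by
  intro A hA
  obtain ⟨g, -, rfl⟩ := exists_mem_coverP_of_mem_rotP hA
  exact ⟨g, rfl⟩

theorem card_rotP : Nat.card rotP = 192 := by
  have := card_comap_rot rotP_le_range
  have h2 := card_coverP
  rw [coverP] at h2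
  omega

/-- The intersection downstairs has half the order of `stabP g`, so the double coset has 192² · 2 /
order = 192 · 384 / order elements. -/
theorem ncard_dcoset_rotP (g : Spin) {order mult : ℕ} (h : Nat.card (stabP g) = order)
    (h0 : order * mult = 384) (h1 : order ≠ 0) : (dcoset rotP (rot g)).ncard = mult * 192 := by
  have : Finite rotP := Nat.finite_of_card_ne_zero (by rw [card_rotP]; decide)
  have h2 := ncard_dcoset_mul_card rotP (rot g)
  rw [stabP, card_comap_rot (inf_le_left.trans rotP_le_range)] at h
  rw [card_rotP] at h2
  apply Nat.eq_of_mul_eq_mul_right (Nat.pos_of_ne_zero h1)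
  rw [← h]
  rw [← h] at h0
  nlinarith

theorem mem_stabP {g x : Spin} : x ∈ stabP g ↔ x ∈ coverP ∧ g⁻¹ * x * g ∈ coverP := by
  rw [stabP, Subgroup.mem_comap, Subgroup.mem_inf, Subgroup.mem_map]
  refine and_congr Iff.rfl ⟨?_, ?_⟩
  · rintro ⟨A, hA, h⟩
    change rot g * A * (rot g)⁻¹ = rot x at h
    change rot (g⁻¹ * x * g) ∈ rotP
    rw [map_mul, map_mul, map_inv, ← h]
    have : (rot g)⁻¹ * (rot g * A * (rot g)⁻¹) * rot g = A := by group
    rwa [this]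
  · intro h
    refine ⟨rot (g⁻¹ * x * g), h, ?_⟩
    change rot g * rot (g⁻¹ * x * g) * (rot g)⁻¹ = rot x
    rw [← map_inv, ← map_mul, ← map_mul]
    congr 1
    group

theorem swap_mem_stabP {g x : Spin} : x.swap ∈ stabP g.swap ↔ x ∈ stabP g := by
  rw [mem_stabP, mem_stabP, swap_mem_coverP]
  exact and_congr Iff.rfl (swap_mem_coverP (g := g⁻¹ * x * g))

theorem stabP_swap (g : Spin) :
    stabP g.swap = (stabP g).map (MulEquiv.prodComm (M := unitary ℍ[ℝ])
      (N := unitary ℍ[ℝ])).toMonoidHom := by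
  ext x
  rw [Subgroup.mem_map]
  constructor
  · intro h
    exact ⟨x.swap, swap_mem_stabP.1 h, rfl⟩
  · rintro ⟨y, hy, rfl⟩
    exact swap_mem_stabP.2 hy

/-- The pair (1,-1) is central, so the sign of q does not affect the stabiliser. -/
theorem stabP_neg_mul (g : Spin) : stabP ((1, -1) * g) = stabP g := by
  ext x
  rw [mem_stabP, mem_stabP]
  have : ((1, -1) * g : Spin)⁻¹ * x * ((1, -1) * g) = g⁻¹ * x * g := by
    apply Prod.ext
    · simp
    · simp
  rw [this]

/-- The stabiliser of a word in canonical quaternions of types `i`, `j`. -/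
def wordStab (i j : Fin 6) (a b : Fin 3) : List (ℍ[ℤ] × ℍ[ℤ]) :=
  (stabList i ×ˢ stabList j).filter fun x =>
    octaClass x.1 = rho a * octaClass x.2 * (rho a)⁻¹ ∧
      octaClass x.1 = (rho b)⁻¹ * octaClass x.2 * rho b

theorem mem_wordStab {i j : Fin 6} {a b : Fin 3} {x : ℍ[ℤ] × ℍ[ℤ]} :
    x ∈ wordStab i j a b ↔ (x.1 ∈ stabList i ∧ x.2 ∈ stabList j) ∧
      octaClass x.1 = rho a * octaClass x.2 * (rho a)⁻¹ ∧
      octaClass x.1 = (rho b)⁻¹ * octaClass x.2 * rho b := by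
  rw [wordStab, List.mem_filter, decide_eq_true_eq]
  exact and_congr List.pair_mem_product Iff.rfl

theorem wordStab_nodup (i j : Fin 6) (a b : Fin 3) : (wordStab i j a b).Nodup :=
  ((stabList_nodup i).product (stabList_nodup j)).filter _

/-- An element x stabilises s_a (c,d) s_b when x and its conjugate by the word are both in `coverP`.
This makes x.1 and ω_a⁻¹ x.2 ω_a pass through c and d without change of class; the two class
equations of `wordStab` are what membership in `coverP` then says. -/
theorem coe_stabP_word {i j : Fin 6} {c d : ℍ[ℤ]} (hc : c ∈ form i) (hci : HasType c i)
    (hd : d ∈ form j) (hdj : HasType d j) (a b : Fin 3) :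
    (stabP (word (pair c d) (a, b)) : Set Spin) = {g : Spin | ∃ x ∈ wordStab i j a b,
      g = (unit x.1, unit (omega a) * unit x.2 * (unit (omega a))⁻¹)} := by
  have hinv : ∀ x : Spin, (word (pair c d) (a, b))⁻¹ * x * word (pair c d) (a, b) =
      ((unit c)⁻¹ * x.1 * unit c, (unit (omega b))⁻¹ * ((unit d)⁻¹ *
        ((unit (omega a))⁻¹ * x.2 * unit (omega a)) * unit d) * unit (omega b)) := by
    intro x
    rw [word, s_eq, s_eq]
    apply Prod.ext
    · simp [pair]
    · simp [pair]
      group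
  ext g
  rw [SetLike.mem_coe, mem_stabP, hinv, mem_coverP_iff, mem_coverP_iff, Set.mem_ofPred_eq]
  constructor
  · rintro ⟨⟨k, h1, h2⟩, l, h3, h4⟩
    obtain ⟨e1, -⟩ := stabClass_of_unit hc hci h1 h3 (by group)
    subst e1
    have h5 := ((oct_omega a).inv.mul h2).mul (oct_omega a)
    have h6 := ((oct_omega b).mul h4).mul (oct_omega b).inv
    have h7 : (unit (omega a))⁻¹ * g.2 * unit (omega a) * unit d = unit d *
        (unit (omega b) * ((unit (omega b))⁻¹ * ((unit d)⁻¹ *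
          ((unit (omega a))⁻¹ * g.2 * unit (omega a)) * unit d) * unit (omega b)) *
          (unit (omega b))⁻¹) := by group
    obtain ⟨e2, -⟩ := stabClass_of_unit hd hdj h5 h6 h7
    obtain ⟨x, hx, h1, rfl⟩ := h1
    obtain ⟨x', hx', h3', -⟩ := h3
    obtain ⟨y, hy, h5, h8⟩ := h5
    obtain ⟨y', hy', h6, -⟩ := h6
    refine ⟨(x, y), mem_wordStab.2 ⟨⟨?_, ?_⟩, ?_, ?_⟩, Prod.ext h1 ?_⟩
    · apply mem_stabList_of_unit hc hci hx hx'
      rw [← h1, ← h3']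
      group
    · apply mem_stabList_of_unit hd hdj hy hy'
      rw [← h5, ← h6]
      exact h7
    · change octaClass x = rho a * octaClass y * (rho a)⁻¹
      rw [h8]
      group
    · change octaClass x = (rho b)⁻¹ * octaClass y * rho b
      rw [h8, e2]
      group
    · dsimp only
      rw [← h5]
      group
  · rintro ⟨x, hx, rfl⟩
    obtain ⟨⟨hx1, hx2⟩, h1, h2⟩ := mem_wordStab.1 hx
    obtain ⟨t, ht, ht1, ht2⟩ := exists_of_mem_stabList hc hx1
    obtain ⟨u, hu, hu1, hu2⟩ := exists_of_mem_stabList hd hx2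
    have ho1 := mem_octaList_of_mem_stabList i _ hx1
    have ho2 := mem_octaList_of_mem_stabList j _ hx2
    have e1 : (unit c)⁻¹ * unit x.1 * unit c = unit t := by
      rw [mul_assoc, ← unit_mul (ne_zero_of_mem_octaList ho1) hci.1, ht2,
        unit_mul hci.1 (ne_zero_of_mem_octaList ht)]
      group
    have e2 : (unit d)⁻¹ * unit x.2 * unit d = unit u := by
      rw [mul_assoc, ← unit_mul (ne_zero_of_mem_octaList ho2) hdj.1, hu2,
        unit_mul hdj.1 (ne_zero_of_mem_octaList hu)]
      group
    refine ⟨⟨octaClass x.1, oct_unit ho1, ?_⟩, octaClass x.1, ?_, ?_⟩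
    · rw [h1]
      exact ((oct_omega a).mul (oct_unit ho2)).mul (oct_omega a).inv
    · dsimp only
      rw [e1, ← ht1]
      exact oct_unit ht
    · dsimp only
      have : (unit (omega a))⁻¹ * (unit (omega a) * unit x.2 * (unit (omega a))⁻¹) *
          unit (omega a) = unit x.2 := by group
      rw [this, e2, h2, ← hu1]
      exact ((oct_omega b).inv.mul (oct_unit hu)).mul (oct_omega b)

theorem card_stabP_word {i j : Fin 6} {c d : ℍ[ℤ]} (hc : c ∈ form i) (hci : HasType c i)
    (hd : d ∈ form j) (hdj : HasType d j) (a b : Fin 3) :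
    Nat.card (stabP (word (pair c d) (a, b))) = (wordStab i j a b).length := by
  rw [← SetLike.coe_sort_coe, Nat.card_coe_set_eq, coe_stabP_word hc hci hd hdj,
    ncard_unit_pairs _ (wordStab_nodup i j a b)]
  intro x hx
  obtain ⟨⟨h1, h2⟩, -⟩ := mem_wordStab.1 hx
  exact ⟨mem_octaList_of_mem_stabList i _ h1, mem_octaList_of_mem_stabList j _ h2⟩

/-! ### The rows of the table of P-classes -/

/-- `q` and `ω_a c ω_b` are proportional. -/
def WordRel (w : Fin 3 × Fin 3) (q c : ℍ[ℤ]) : Prop :=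
  ∃ k l : ℤ, k ≠ 0 ∧ l ≠ 0 ∧ k • q = l • (omega w.1 * c * omega w.2)

/-- The data of a row of `tableP`: the types, the word, generators of the stabiliser together with
exponents, and the numbers. -/
structure RowSpec where
  i : Fin 6
  j : Fin 6
  label : Fin 3 × Fin 3
  full : Bool
  gens : List ((ℍ[ℤ] × ℍ[ℤ]) × ℕ)
  order : ℕ
  mult : ℕ
  countEq : ℕ
  countDouble : ℕ

/-- The row `r` is described by `ρ`. -/
structure RowSpec.Matches (r : PRow) (ρ : RowSpec) : Prop where
  i : r.i = ρ.i
  j : r.j = ρ.j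
  formP : r.formP = form ρ.i
  formQ_rel : ∀ q ∈ r.formQ, ∃ c ∈ form ρ.j, WordRel ρ.label q c
  rel_formQ : ∀ c ∈ form ρ.j, ∃ q ∈ r.formQ, WordRel ρ.label q c
  gens : r.gens = if ρ.full then (coverP : Set Spin) else
    {x | ∃ y ∈ ρ.gens.map Prod.fst, x = pair y.1 y.2}
  order : r.order = ρ.order
  mult : r.mult = ρ.mult
  countEq : r.countEq = ρ.countEq
  countDouble : r.countDouble = ρ.countDouble

/-- The description of `tableP` by words. -/
def rowSpecs : List RowSpec :=
  let u1 : ℍ[ℤ] := quat 0 1 0 0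
  let u2 : ℍ[ℤ] := quat 0 0 1 0
  let u3 : ℍ[ℤ] := quat 0 0 0 1
  let w : ℍ[ℤ] := quat 1 1 1 1
  let a := ((u1, (1 : ℍ[ℤ])), 2)
  let b := ((u2, (1 : ℍ[ℤ])), 2)
  let ww := ((w, w), 3)
  [⟨0, 0, (0, 0), true, [], 384, 1, 1, 0⟩,
   ⟨0, 0, (0, 1), false, [a, b, ((1, u1), 2), ((1, u2), 2), ww], 192, 2, 0, 1⟩,
   ⟨0, 2, (0, 0), false, [a, b, ww], 48, 8, 1, 2⟩,
   ⟨0, 3, (0, 0), false, [a, b, ((quat 1 1 0 0, quat 1 1 0 0), 4)], 64, 6, 1, 0⟩,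
   ⟨0, 3, (0, 1), false, [a, b, ((1, u1), 2)], 32, 12, 0, 1⟩,
   ⟨0, 4, (0, 0), false, [a, b, ((quat 0 1 1 0, quat 0 1 1 0), 2)], 32, 12, 1, 0⟩,
   ⟨0, 4, (0, 1), false, [a, b], 16, 24, 0, 1⟩,
   ⟨0, 5, (0, 0), false, [a, b], 16, 24, 1, 2⟩,
   ⟨1, 1, (0, 0), false, [ww, ((quat 0 1 (-1) 0, quat 0 1 (-1) 0), 2)], 24, 16, 1, 0⟩,
   ⟨1, 1, (0, 2), false, [ww], 12, 32, 0, 1⟩,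
   ⟨1, 2, (0, 0), false, [ww], 12, 32, 1, 2⟩,
   ⟨1, 3, (0, 0), false, [((quat 0 0 1 (-1), quat 1 1 0 0), 4)], 16, 24, 0, 0⟩,
   ⟨1, 3, (0, 1), false, [((1, u1), 2)], 8, 48, 0, 0⟩,
   ⟨1, 4, (0, 0), false, [((quat 0 1 (-1) 0, quat 0 1 1 0), 2)], 8, 48, 1, 0⟩,
   ⟨1, 4, (0, 1), false, [], 4, 96, 0, 1⟩,
   ⟨1, 5, (0, 0), false, [], 4, 96, 1, 2⟩,
   ⟨2, 2, (0, 0), false, [ww], 12, 32, 1, 2⟩,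
   ⟨2, 3, (0, 0), false, [((1, u1), 2)], 8, 48, 1, 2⟩,
   ⟨2, 4, (0, 0), false, [], 4, 96, 1, 2⟩,
   ⟨2, 5, (0, 0), false, [], 4, 96, 1, 2⟩,
   ⟨3, 3, (0, 0), false, [((quat 1 1 0 0, quat 1 1 0 0), 4), ((quat 1 1 0 0, quat 1 (-1) 0 0), 2)],
     32, 12, 1, 0⟩,
   ⟨3, 3, (1, 2), false, [a, ((1, u2), 2)], 16, 24, 1, 0⟩,
   ⟨3, 3, (0, 1), false, [a, ((1, u1), 2)], 16, 24, 0, 1⟩,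
   ⟨3, 3, (1, 0), false, [a, ((1, u2), 2)], 16, 24, 0, 1⟩,
   ⟨3, 3, (2, 2), false, [a, ((1, u3), 2)], 16, 24, 0, 1⟩,
   ⟨3, 4, (0, 0), false, [a], 8, 48, 1, 0⟩,
   ⟨3, 4, (1, 2), false, [((quat 1 1 0 0, quat 0 0 1 1), 4)], 16, 24, 1, 0⟩,
   ⟨3, 4, (0, 1), false, [a], 8, 48, 0, 1⟩,
   ⟨3, 4, (0, 2), false, [a], 8, 48, 0, 1⟩,
   ⟨3, 4, (1, 0), false, [a], 8, 48, 0, 1⟩,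
   ⟨3, 5, (0, 0), false, [a], 8, 48, 3, 6⟩,
   ⟨4, 4, (0, 0), false, [((quat 0 1 1 0, quat 0 1 1 0), 2)], 8, 48, 1, 0⟩,
   ⟨4, 4, (1, 2), false, [], 4, 96, 1, 0⟩,
   ⟨4, 4, (0, 1), false, [], 4, 96, 0, 1⟩,
   ⟨4, 4, (1, 1), false, [], 4, 96, 0, 1⟩,
   ⟨4, 4, (1, 0), false, [], 4, 96, 0, 1⟩,
   ⟨4, 5, (0, 0), false, [], 4, 96, 3, 6⟩,
   ⟨5, 5, (0, 0), false, [], 4, 96, 3, 6⟩]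

theorem wordRel_refl (q : ℍ[ℤ]) : WordRel (0, 0) q q :=
  ⟨1, 1, one_ne_zero, one_ne_zero, by
    change _ = (1 : ℤ) • (1 * q * 1)
    rw [one_mul, mul_one]⟩

theorem omega_eq : omega 0 = quat 1 0 0 0 ∧ omega 1 = quat 1 1 1 1 ∧
    omega 2 = quat (-1) 1 1 1 := ⟨rfl, rfl, rfl⟩

theorem form_eq : form 0 = {quat 1 0 0 0} ∧ form 1 = {quat 0 1 1 1} ∧
    form 2 = fam (fun m n => quat m n n n) ∧ form 3 = fam (fun m n => quat m n 0 0) ∧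
    form 4 = fam (fun m n => quat m n n 0) := ⟨rfl, rfl, rfl, rfl, rfl⟩

theorem fam_wordRel {w : Fin 3 × Fin 3} {f g : ℤ → ℤ → ℍ[ℤ]} (k l : ℤ) (hk : k ≠ 0) (hl : l ≠ 0)
    (h : ∀ m n, k • f m n = l • (omega w.1 * g m n * omega w.2)) :
    (∀ q ∈ fam f, ∃ c ∈ fam g, WordRel w q c) ∧ ∀ c ∈ fam g, ∃ q ∈ fam f, WordRel w q c := by
  constructor
  · rintro _ ⟨m, n, rfl⟩
    exact ⟨_, ⟨m, n, rfl⟩, k, l, hk, hl, h m n⟩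
  · rintro _ ⟨m, n, rfl⟩
    exact ⟨_, ⟨m, n, rfl⟩, k, l, hk, hl, h m n⟩

theorem zsmul_quat (k a b c d : ℤ) : k • quat a b c d = quat (k * a) (k * b) (k * c) (k * d) :=
  zsmul_eq_mk k _

theorem quat_mul_quat (a b c d a' b' c' d' : ℤ) : quat a b c d * quat a' b' c' d' =
    quat (a * a' - b * b' - c * c' - d * d') (a * b' + b * a' + c * d' - d * c')
      (a * c' - b * d' + c * a' + d * b') (a * d' + b * c' - c * b' + d * a') := by
  ext <;> simp

theorem fam_wordRel_quat {w : Fin 3 × Fin 3} {f g : ℤ → ℤ → ℍ[ℤ]} (k l : ℤ) (hk : k ≠ 0)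
    (hl : l ≠ 0) (h : ∀ m n, k • f m n = l • (omega w.1 * g m n * omega w.2)) {j : Fin 6}
    (hj : form j = fam g) :
    (∀ q ∈ fam f, ∃ c ∈ form j, WordRel w q c) ∧ ∀ c ∈ form j, ∃ q ∈ fam f, WordRel w q c := by
  rw [hj]
  exact fam_wordRel k l hk hl h

theorem singleton_wordRel {w : Fin 3 × Fin 3} {p q : ℍ[ℤ]} (h : WordRel w p q) {j : Fin 6}
    (hj : form j = {q}) :
    (∀ p' ∈ ({p} : Set ℍ[ℤ]), ∃ c ∈ form j, WordRel w p' c) ∧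
      ∀ c ∈ form j, ∃ p' ∈ ({p} : Set ℍ[ℤ]), WordRel w p' c := by
  rw [hj]
  exact ⟨fun _ h' => ⟨q, rfl, by rwa [Set.mem_singleton_iff.1 h']⟩,
    fun _ h' => ⟨p, rfl, by rwa [Set.mem_singleton_iff.1 h']⟩⟩

theorem matches_of_rel {i j : Fin 6} {Q : Set ℍ[ℤ]} {G : Set Spin} {w : Fin 3 × Fin 3}
    {l : List ((ℍ[ℤ] × ℍ[ℤ]) × ℕ)} {o m e d : ℕ}
    (hQ : (∀ q ∈ Q, ∃ c ∈ form j, WordRel w q c) ∧ ∀ c ∈ form j, ∃ q ∈ Q, WordRel w q c)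
    (hG : G = {x | ∃ y ∈ l.map Prod.fst, x = pair y.1 y.2}) :
    RowSpec.Matches ⟨i, j, form i, Q, G, o, m, e, d⟩ ⟨i, j, w, false, l, o, m, e, d⟩ :=
  ⟨rfl, rfl, rfl, hQ.1, hQ.2, hG, rfl, rfl, rfl, rfl⟩

theorem form_wordRel (j : Fin 6) :
    (∀ q ∈ form j, ∃ c ∈ form j, WordRel (0, 0) q c) ∧
      ∀ c ∈ form j, ∃ q ∈ form j, WordRel (0, 0) q c :=
  ⟨fun q hq => ⟨q, hq, wordRel_refl q⟩, fun q hq => ⟨q, hq, wordRel_refl q⟩⟩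

theorem gens_nil : {x | ∃ y ∈ ([] : List ((ℍ[ℤ] × ℍ[ℤ]) × ℕ)).map Prod.fst, x = pair y.1 y.2} =
    (∅ : Set Spin) := by
  ext x
  simp

theorem gens_cons (y : (ℍ[ℤ] × ℍ[ℤ]) × ℕ) (l : List ((ℍ[ℤ] × ℍ[ℤ]) × ℕ)) :
    {x | ∃ z ∈ (y :: l).map Prod.fst, x = pair z.1 z.2} =
      insert (pair y.1.1 y.1.2) {x : Spin | ∃ z ∈ l.map Prod.fst, x = pair z.1 z.2} := by
  ext x
  rw [Set.mem_insert_iff, Set.mem_ofPred_eq, Set.mem_ofPred_eq, List.map_cons]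
  constructor
  · rintro ⟨z, hz, rfl⟩
    rcases List.mem_cons.1 hz with rfl | hz
    · exact Or.inl rfl
    · exact Or.inr ⟨z, hz, rfl⟩
  · rintro (rfl | ⟨z, hz, rfl⟩)
    · exact ⟨y.1, List.mem_cons_self, rfl⟩
    · exact ⟨z, List.mem_cons_of_mem _ hz, rfl⟩

theorem form3a_wordRel :
    (∀ q ∈ fam fun m n => quat (m - n) (m + n) (m - n) (m + n), ∃ c ∈ form 3, WordRel (0, 1) q c) ∧
      ∀ c ∈ form 3, ∃ q ∈ fam fun m n => quat (m - n) (m + n) (m - n) (m + n),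
        WordRel (0, 1) q c := by
  refine fam_wordRel_quat 1 1 (by decide) (by decide) (fun m n => ?_) form_eq.2.2.2.1
  simp only [omega_eq, zsmul_quat, quat_mul_quat]
  congr 1 <;> ring

theorem form4a_wordRel :
    (∀ q ∈ fam fun m n => quat (m - 2 * n) (m + 2 * n) m m, ∃ c ∈ form 4, WordRel (0, 1) q c) ∧
      ∀ c ∈ form 4, ∃ q ∈ fam fun m n => quat (m - 2 * n) (m + 2 * n) m m,
        WordRel (0, 1) q c := by
  refine fam_wordRel_quat 1 1 (by decide) (by decide) (fun m n => ?_) form_eq.2.2.2.2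
  simp only [omega_eq, zsmul_quat, quat_mul_quat]
  congr 1 <;> ring

/-- Up to nonzero integer factors, the second form of each row is ω_a c ω_b for its label (a, b) and
the canonical form c. Each instance is an identity of linear forms in m and n. -/
theorem tableP_matches : List.Forall₂ RowSpec.Matches tableP rowSpecs := by
  have G : ∀ {s t : Set Spin}, t = s → s = t := fun h => h.symm
  unfold tableP rowSpecs
  dsimp only
  refine .cons ⟨rfl, rfl, rfl, (form_wordRel 0).1, (form_wordRel 0).2, rfl, rfl, rfl, rfl, rfl⟩
    (.cons (matches_of_rel (singleton_wordRel (p := quat 1 1 1 1) ?_ form_eq.1) ?_)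
    (.cons (matches_of_rel (form_wordRel 2) ?_)
    (.cons (matches_of_rel (form_wordRel 3) ?_)
    (.cons (matches_of_rel form3a_wordRel ?_)
    (.cons (matches_of_rel (form_wordRel 4) ?_)
    (.cons (matches_of_rel form4a_wordRel ?_)
    (.cons (matches_of_rel (form_wordRel 5) ?_)
    (.cons (matches_of_rel (form_wordRel 1) ?_)
    (.cons (matches_of_rel (singleton_wordRel (p := quat 3 1 1 1) ?_ form_eq.2.1) ?_)
    (.cons (matches_of_rel (form_wordRel 2) ?_)
    (.cons (matches_of_rel (form_wordRel 3) ?_)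
    (.cons (matches_of_rel form3a_wordRel ?_)
    (.cons (matches_of_rel (form_wordRel 4) ?_)
    (.cons (matches_of_rel form4a_wordRel ?_)
    (.cons (matches_of_rel (form_wordRel 5) ?_)
    (.cons (matches_of_rel (form_wordRel 2) ?_)
    (.cons (matches_of_rel (form_wordRel 3) ?_)
    (.cons (matches_of_rel (form_wordRel 4) ?_)
    (.cons (matches_of_rel (form_wordRel 5) ?_)
    (.cons (matches_of_rel (form_wordRel 3) ?_)
    (.cons (matches_of_rel (fam_wordRel_quat (f := fun m n => quat m 0 n 0) 4 (-1) (by decide)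
      (by decide) (fun m n => ?_) form_eq.2.2.2.1) ?_)
    (.cons (matches_of_rel form3a_wordRel ?_)
    (.cons (matches_of_rel (fam_wordRel_quat
      (f := fun m n => quat (m - n) (m + n) (m + n) (m - n)) 1 1 (by decide)
      (by decide) (fun m n => ?_) form_eq.2.2.2.1) ?_)
    (.cons (matches_of_rel (fam_wordRel_quat
      (f := fun m n => quat (m - n) (m - n) (m + n) (m + n)) 2 (-1) (by decide)
      (by decide) (fun m n => ?_) form_eq.2.2.2.1) ?_)
    (.cons (matches_of_rel (form_wordRel 4) ?_)
    (.cons (matches_of_rel (fam_wordRel_quat (f := fun m n => quat m 0 n n) 4 (-1) (by decide)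
      (by decide) (fun m n => ?_) form_eq.2.2.2.2) ?_)
    (.cons (matches_of_rel form4a_wordRel ?_)
    (.cons (matches_of_rel (fam_wordRel_quat
      (f := fun m n => quat (-m - 2 * n) m (m - 2 * n) m) 1 1 (by decide)
      (by decide) (fun m n => ?_) form_eq.2.2.2.2) ?_)
    (.cons (matches_of_rel (fam_wordRel_quat
      (f := fun m n => quat (m - 2 * n) m (m + 2 * n) m) 1 1 (by decide)
      (by decide) (fun m n => ?_) form_eq.2.2.2.2) ?_)
    (.cons (matches_of_rel (form_wordRel 5) ?_)
    (.cons (matches_of_rel (form_wordRel 4) ?_)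
    (.cons (matches_of_rel (fam_wordRel_quat (f := fun m n => quat m 0 n n) 4 (-1) (by decide)
      (by decide) (fun m n => ?_) form_eq.2.2.2.2) ?_)
    (.cons (matches_of_rel form4a_wordRel ?_)
    (.cons (matches_of_rel (fam_wordRel_quat
      (f := fun m n => quat (-m - 2 * n) m m (m - 2 * n)) 2 1 (by decide)
      (by decide) (fun m n => ?_) form_eq.2.2.2.2) ?_)
    (.cons (matches_of_rel (fam_wordRel_quat
      (f := fun m n => quat (m - 2 * n) m (m + 2 * n) m) 1 1 (by decide)
      (by decide) (fun m n => ?_) form_eq.2.2.2.2) ?_)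
    (.cons (matches_of_rel (form_wordRel 5) ?_)
    (.cons (matches_of_rel (form_wordRel 5) ?_)
    .nil)))))))))))))))))))))))))))))))))))))
  all_goals first
    | (refine G ?_
       simp only [gens_cons, gens_nil, insert_empty_eq]
       rfl)
    | (simp only [omega_eq, zsmul_quat, quat_mul_quat]
       congr 1 <;> ring)
    | exact ⟨1, 1, by decide, by decide, by decide +kernel⟩
    | exact ⟨1, -1, by decide, by decide, by decide +kernel⟩
    | exact gens_nil.symm

/-! ### Generation of the stabilisers by the listed elements -/

/-- The product of two pairs from `octaList`, as a pair in `octaList`. -/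
def octaMul (x y : ℍ[ℤ] × ℍ[ℤ]) : ℍ[ℤ] × ℍ[ℤ] :=
  (half (half (x.1 * y.1)), half (half (x.2 * y.2)))

/-- The products `x`, `g x`, …, `g ^ (n - 1) x`. -/
def octaOrbit (g : ℍ[ℤ] × ℍ[ℤ]) : ℕ → ℍ[ℤ] × ℍ[ℤ] → List (ℍ[ℤ] × ℍ[ℤ])
  | 0, _ => []
  | n + 1, x => x :: octaOrbit g n (octaMul g x)

/-- All products of powers of given elements, with bounded exponents. -/
def octaSpan : List ((ℍ[ℤ] × ℍ[ℤ]) × ℕ) → List (ℍ[ℤ] × ℍ[ℤ])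
  | [] => [(1, 1)]
  | g :: l => (octaSpan l).flatMap (octaOrbit g.1 g.2)

theorem unit_half_half_mul {p q : ℍ[ℤ]} (hp : p ∈ octaList) (hq : q ∈ octaList) :
    half (half (p * q)) ∈ octaList ∧ unit (half (half (p * q))) = unit p * unit q := by
  have hp0 := ne_zero_of_mem_octaList hp
  have hq0 := ne_zero_of_mem_octaList hq
  refine ⟨mem_octaList_iff.2 (half_half_mul_mem p hp q hq).1, ?_⟩
  have h1 := unit_half (quat_mul_ne_zero hp0 hq0)
  rw [(unit_half h1.1).2, h1.2, unit_mul hp0 hq0]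

theorem octaMul_spec {x y : ℍ[ℤ] × ℍ[ℤ]} (hx : x.1 ∈ octaList ∧ x.2 ∈ octaList)
    (hy : y.1 ∈ octaList ∧ y.2 ∈ octaList) :
    ((octaMul x y).1 ∈ octaList ∧ (octaMul x y).2 ∈ octaList) ∧
      pair (octaMul x y).1 (octaMul x y).2 = pair x.1 x.2 * pair y.1 y.2 := by
  obtain ⟨h1, h2⟩ := unit_half_half_mul hx.1 hy.1
  obtain ⟨h3, h4⟩ := unit_half_half_mul hx.2 hy.2
  exact ⟨⟨h1, h3⟩, Prod.ext h2 h4⟩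

theorem octaOrbit_spec {H : Subgroup Spin} {g : ℍ[ℤ] × ℍ[ℤ]}
    (hg : g.1 ∈ octaList ∧ g.2 ∈ octaList) (hgH : pair g.1 g.2 ∈ H) (n : ℕ) :
    ∀ {x : ℍ[ℤ] × ℍ[ℤ]}, x.1 ∈ octaList ∧ x.2 ∈ octaList → pair x.1 x.2 ∈ H →
      ∀ z ∈ octaOrbit g n x, (z.1 ∈ octaList ∧ z.2 ∈ octaList) ∧ pair z.1 z.2 ∈ H := by
  induction n with
  | zero => intro x _ _ z hz; simp [octaOrbit] at hz
  | succ n ih =>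
    intro x hx hxH z hz
    rcases List.mem_cons.1 hz with rfl | hz
    · exact ⟨hx, hxH⟩
    · obtain ⟨h1, h2⟩ := octaMul_spec hg hx
      exact ih h1 (by rw [h2]; exact mul_mem hgH hxH) z hz

/-- Only soundness is needed here: every listed product lies in any subgroup containing the
generators. That the list is long enough is checked in `rowSpecs_span`. -/
theorem octaSpan_spec {H : Subgroup Spin} (l : List ((ℍ[ℤ] × ℍ[ℤ]) × ℕ))
    (hl : ∀ g ∈ l, (g.1.1 ∈ octaList ∧ g.1.2 ∈ octaList) ∧ pair g.1.1 g.1.2 ∈ H) :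
    ∀ z ∈ octaSpan l, (z.1 ∈ octaList ∧ z.2 ∈ octaList) ∧ pair z.1 z.2 ∈ H := by
  induction l with
  | nil =>
    intro z hz
    rw [octaSpan, List.mem_singleton] at hz
    subst hz
    refine ⟨⟨one_mem_octaList, one_mem_octaList⟩, ?_⟩
    have : pair 1 1 = 1 := by rw [pair, unit_one]; rfl
    rw [this]
    exact one_mem H
  | cons g l ih =>
    intro z hz
    rw [octaSpan, List.mem_flatMap] at hz
    obtain ⟨x, hx, hz⟩ := hz
    obtain ⟨h1, h2⟩ := ih (fun g hg => hl g (List.mem_cons_of_mem _ hg)) x hx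
    obtain ⟨h3, h4⟩ := hl g List.mem_cons_self
    exact octaOrbit_spec h3 h4 _ h1 h2 z hz

/-- Conjugation of an element of `octaList` by `ω_a`. -/
def omegaConj (a : Fin 3) (q : ℍ[ℤ]) : ℍ[ℤ] :=
  half (half (half (half (omega a * q)) * star (omega a)))

theorem omegaConj_spec (a : Fin 3) {q : ℍ[ℤ]} (hq : q ∈ octaList) :
    omegaConj a q ∈ octaList ∧
      unit (omegaConj a q) = unit (omega a) * unit q * (unit (omega a))⁻¹ := by
  obtain ⟨h1, h2⟩ := unit_half_half_mul (omega_mem a) hq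
  obtain ⟨h3, h4⟩ := unit_half_half_mul h1 (star_mem (omega_mem a))
  exact ⟨h3, by rw [omegaConj, h4, h2, unit_star (omega_ne_zero a)]⟩

/-- The generators of a row, including the trivial ones. -/
def RowSpec.allGens (ρ : RowSpec) : List ((ℍ[ℤ] × ℍ[ℤ]) × ℕ) :=
  ρ.gens ++ [((-1, 1), 2), ((1, -1), 2)]

/-- The elements of the stabiliser of a row. -/
def RowSpec.stab (ρ : RowSpec) : List (ℍ[ℤ] × ℍ[ℤ]) :=
  (wordStab ρ.i ρ.j ρ.label.1 ρ.label.2).map fun x => (x.1, omegaConj ρ.label.1 x.2)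

theorem rowSpecs_order : ∀ ρ ∈ rowSpecs,
    (wordStab ρ.i ρ.j ρ.label.1 ρ.label.2).length = ρ.order ∧ ρ.order * ρ.mult = 384 := by
  decide +kernel

theorem rowSpecs_full : ∀ ρ ∈ rowSpecs, ρ.full = true →
    ρ.i = 0 ∧ ρ.j = 0 ∧ ρ.label = (0, 0) := by
  decide +kernel

theorem rowSpecs_gens : ∀ ρ ∈ rowSpecs, ρ.full = false → ∀ g ∈ ρ.allGens, g.1 ∈ ρ.stab := by
  decide +kernel

/-- Each stabiliser element is an ordered product of powers of the generators; the exponents stored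
in `rowSpecs` bound how many powers are tried. -/
theorem rowSpecs_span : ∀ ρ ∈ rowSpecs, ρ.full = false → ∀ x ∈ ρ.stab, x ∈ octaSpan ρ.allGens := by
  decide +kernel

theorem nrm_omega : ∀ k, nrm (omega k) = 1 ∨ nrm (omega k) = 2 ^ 2 := by decide

theorem WordRel.ne_zero {w : Fin 3 × Fin 3} {q c : ℍ[ℤ]} (h : WordRel w q c) :
    q ≠ 0 ↔ c ≠ 0 := by
  obtain ⟨k, l, hk, hl, e⟩ := h
  constructor
  · rintro hq rfl
    rw [mul_zero, zero_mul, smul_zero] at e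
    exact quat_smul_ne_zero hk hq e
  · rintro hc rfl
    rw [smul_zero] at e
    exact quat_smul_ne_zero hl
      (quat_mul_ne_zero (quat_mul_ne_zero (omega_ne_zero _) hc) (omega_ne_zero _)) e.symm

theorem WordRel.sim {w : Fin 3 × Fin 3} {q c : ℍ[ℤ]} (h : WordRel w q c) (hc : c ≠ 0) :
    Sim q c := by
  have hq := h.ne_zero.2 hc
  obtain ⟨k, l, hk, hl, e⟩ := h
  exact sim_of_smul hq (omega_mem _) (omega_mem _) hc hk hl e

/-- The representatives of the powers of ω have norm 1 or 4, both squares. -/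
theorem WordRel.evenTwo {w : Fin 3 × Fin 3} {q c : ℍ[ℤ]} (h : WordRel w q c) (hc : c ≠ 0) :
    EvenTwo q ↔ EvenTwo c := by
  have hq := h.ne_zero.2 hc
  obtain ⟨k, l, hk, hl, e⟩ := h
  have h1 := congrArg nrm e
  rw [nrm_zsmul, nrm_zsmul, nrm_mul, nrm_mul] at h1
  have sq_omega : ∀ k, ∃ n : ℤ, n ≠ 0 ∧ nrm (omega k) = n ^ 2 := fun k => by
    rcases nrm_omega k with h | h
    · exact ⟨1, one_ne_zero, by rw [h, one_pow]⟩
    · exact ⟨2, two_ne_zero, h⟩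
  obtain ⟨m, hm, e1⟩ := sq_omega w.1
  obtain ⟨n, hn, e2⟩ := sq_omega w.2
  rw [EvenTwo, EvenTwo, normSq_eq_nrm, normSq_eq_nrm]
  refine even_val_iff_of_sq (b := l * m * n) hk (mul_ne_zero (mul_ne_zero hl hm) hn)
    (nrm_pos hq).ne' (nrm_pos hc).ne' ?_
  rw [h1, e1, e2]
  ring

theorem unit_eq_or_neg_of_smul {p q : ℍ[ℤ]} (hp : p ≠ 0) (hq : q ≠ 0) {k l : ℤ} (hk : k ≠ 0)
    (hl : l ≠ 0) (h : k • p = l • q) : unit p = unit q ∨ unit p = -unit q := by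
  have h1 : (k * k) • p = (k * l) • q := by rw [mul_smul, h, ← mul_smul]
  have hkk : 0 < k * k := mul_self_pos.2 hk
  rcases lt_or_gt_of_ne (mul_ne_zero hk hl) with h2 | h2
  · right
    rw [← unit_neg hq]
    apply unit_eq_of_smul hp hkk (n := -(k * l)) (by omega)
    rw [h1, neg_smul_neg]
  · left
    exact unit_eq_of_smul hp hkk h2 h1

/-- Proportionality fixes the direction up to sign, and a negative factor is accounted for by
(1,-1). -/
theorem WordRel.pair_eq {w : Fin 3 × Fin 3} {q c : ℍ[ℤ]} (h : WordRel w q c) (hc : c ≠ 0)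
    (p : ℍ[ℤ]) : pair p q = word (pair p c) w ∨ pair p q = (1, -1) * word (pair p c) w := by
  have hq := h.ne_zero.2 hc
  obtain ⟨k, l, hk, hl, e⟩ := h
  have h1 := quat_mul_ne_zero (omega_ne_zero w.1) hc
  have e2 : word (pair p c) w = (unit p, unit (omega w.1 * c * omega w.2)) := by
    rw [unit_mul h1 (omega_ne_zero _), unit_mul (omega_ne_zero _) hc, word, s_eq, s_eq]
    apply Prod.ext <;> simp [pair]
  rw [e2]
  rcases unit_eq_or_neg_of_smul hq (quat_mul_ne_zero h1 (omega_ne_zero _)) hk hl e with h | h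
  · left
    rw [pair, h]
  · right
    rw [pair, h]
    apply Prod.ext <;> simp

theorem neg_mem_coverP : ((1, -1) : Spin) ∈ coverP :=
  mem_coverP_iff.2 ⟨1, oct_one, oct_neg_one⟩

theorem stabP_eq_closure {i j : Fin 6} {c d : ℍ[ℤ]} (hc : c ∈ form i) (hci : HasType c i)
    (hd : d ∈ form j) (hdj : HasType d j) {ρ : RowSpec} (hρ : ρ ∈ rowSpecs) (hi : ρ.i = i)
    (hj : ρ.j = j) :
    stabP (word (pair c d) ρ.label) =
      Subgroup.closure ((if ρ.full then (coverP : Set Spin) else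
        {x | ∃ y ∈ ρ.gens.map Prod.fst, x = pair y.1 y.2}) ∪ {pair (-1) 1, pair 1 (-1)}) := by
  subst hi hj
  have hset : (stabP (word (pair c d) ρ.label) : Set Spin) =
      {x | ∃ y ∈ ρ.stab, x = pair y.1 y.2} := by
    rw [coe_stabP_word hc hci hd hdj]
    ext x
    constructor
    · rintro ⟨y, hy, rfl⟩
      refine ⟨_, List.mem_map.2 ⟨y, hy, rfl⟩, Prod.ext rfl ?_⟩
      exact (omegaConj_spec _ (mem_octaList_of_mem_stabList _ _ (mem_wordStab.1 hy).1.2)).2.symm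
    · rintro ⟨y, hy, rfl⟩
      obtain ⟨z, hz, rfl⟩ := List.mem_map.1 hy
      refine ⟨z, hz, Prod.ext rfl ?_⟩
      exact (omegaConj_spec _ (mem_octaList_of_mem_stabList _ _ (mem_wordStab.1 hz).1.2)).2
  -- The row whose generating set is all of `coverP` belongs to the identity rotation, with nothing
  -- to generate.
  by_cases hf : ρ.full = true
  · rw [if_pos hf]
    obtain ⟨h1, h2, h3⟩ := rowSpecs_full ρ hρ hf
    rw [h1] at hc
    rw [h2] at hd
    obtain rfl : c = 1 := hc
    obtain rfl : d = 1 := hd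
    rw [h3]
    have e : word (pair 1 1) (0, 0) = 1 := by
      rw [word, s_eq, pair]
      apply Prod.ext <;> simp [unit_one, omega]
    rw [e]
    have e2 : stabP 1 = coverP := by
      ext x
      rw [mem_stabP]
      simp
    rw [e2]
    apply le_antisymm
    · intro x hx
      exact Subgroup.subset_closure (Or.inl hx)
    · rw [Subgroup.closure_le]
      rintro x (hx | rfl | rfl)
      · exact hx
      · refine mem_coverP_iff.2 ⟨1, ?_, ?_⟩
        · rw [pair, unit_neg_one]
          exact oct_neg_one
        · rw [pair, unit_one]
          exact oct_one
      · refine mem_coverP_iff.2 ⟨1, ?_, ?_⟩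
        · rw [pair, unit_one]
          exact oct_one
        · rw [pair, unit_neg_one]
          exact oct_neg_one
  · have hf' : ρ.full = false := by simpa using hf
    rw [if_neg hf]
    have key : {x : Spin | ∃ y ∈ ρ.gens.map Prod.fst, x = pair y.1 y.2} ∪
        {pair (-1) 1, pair 1 (-1)} = {x | ∃ g ∈ ρ.allGens, x = pair g.1.1 g.1.2} := by
      ext x
      rw [RowSpec.allGens]
      constructor
      · rintro (⟨y, hy, rfl⟩ | rfl | rfl)
        · obtain ⟨g, hg, rfl⟩ := List.mem_map.1 hy
          exact ⟨g, List.mem_append_left _ hg, rfl⟩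
        · exact ⟨((-1, 1), 2), List.mem_append_right _ (by simp), rfl⟩
        · exact ⟨((1, -1), 2), List.mem_append_right _ (by simp), rfl⟩
      · rintro ⟨g, hg, rfl⟩
        rcases List.mem_append.1 hg with hg | hg
        · exact Or.inl ⟨_, List.mem_map.2 ⟨g, hg, rfl⟩, rfl⟩
        · rcases List.mem_cons.1 hg with rfl | hg
          · exact Or.inr (Or.inl rfl)
          · rw [List.mem_singleton] at hg
            subst hg
            exact Or.inr (Or.inr rfl)
    rw [key]
    have hmem : ∀ y ∈ ρ.stab, y.1 ∈ octaList ∧ y.2 ∈ octaList := by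
      intro y hy
      obtain ⟨z, hz, rfl⟩ := List.mem_map.1 hy
      have := (mem_wordStab.1 hz).1
      exact ⟨mem_octaList_of_mem_stabList _ _ this.1,
        (omegaConj_spec _ (mem_octaList_of_mem_stabList _ _ this.2)).1⟩
    apply le_antisymm
    · intro x hx
      have hx' : x ∈ (stabP (word (pair c d) ρ.label) : Set Spin) := hx
      rw [hset] at hx'
      obtain ⟨y, hy, rfl⟩ := hx'
      refine (octaSpan_spec ρ.allGens (fun g hg => ⟨?_, ?_⟩) y
        (rowSpecs_span ρ hρ hf' y hy)).2
      · exact hmem _ (rowSpecs_gens ρ hρ hf' g hg)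
      · exact Subgroup.subset_closure ⟨g, hg, rfl⟩
    · rw [Subgroup.closure_le, hset]
      rintro x ⟨g, hg, rfl⟩
      exact ⟨_, rowSpecs_gens ρ hρ hf' g hg, rfl⟩

/-- The description of the pairs of a row by words. -/
theorem RowSpec.Matches.exists_word {r : PRow} {ρ : RowSpec} (h : RowSpec.Matches r ρ)
    {x : ℍ[ℤ] × ℍ[ℤ]} (hx : x ∈ r.pairs) :
    (x.1 ∈ form ρ.i ∧ HasType x.1 ρ.i) ∧ ∃ d ∈ form ρ.j, HasType d ρ.j ∧ WordRel ρ.label x.2 d := by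
  obtain ⟨⟨h1, h2⟩, h3, h4⟩ := hx
  obtain ⟨d, hd, hw⟩ := h.formQ_rel _ h2
  have hd0 := hw.ne_zero.1 h4.1
  rw [h.formP] at h1
  rw [h.i] at h3
  rw [h.j] at h4
  exact ⟨⟨h1, h3⟩, d, hd, h4.of_sim hd0 (hw.sim hd0), hw⟩

theorem stabP_of_matches {r : PRow} {ρ : RowSpec} (hρ : ρ ∈ rowSpecs) (h : RowSpec.Matches r ρ)
    {x : ℍ[ℤ] × ℍ[ℤ]} (hx : x ∈ r.pairs) :
    stabP (pair x.1 x.2) = Subgroup.closure r.allGens ∧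
      Nat.card (stabP (pair x.1 x.2)) = r.order := by
  obtain ⟨⟨h1, h2⟩, d, hd, hdj, hw⟩ := h.exists_word hx
  have e : stabP (pair x.1 x.2) = stabP (word (pair x.1 d) ρ.label) := by
    rcases hw.pair_eq hdj.1 x.1 with h | h
    · rw [h]
    · rw [h, stabP_neg_mul]
  rw [e, PRow.allGens, h.gens, h.order]
  exact ⟨stabP_eq_closure h1 h2 hd hdj hρ rfl rfl, by
    rw [card_stabP_word h1 h2 hd hdj, (rowSpecs_order ρ hρ).1]⟩

theorem exists_matches {r : PRow} (hr : r ∈ tableP) :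
    ∃ ρ ∈ rowSpecs, RowSpec.Matches r ρ := by
  have := tableP_matches
  obtain ⟨n, hn, rfl⟩ := List.getElem_of_mem hr
  have h2 := List.Forall₂.length_eq this
  exact ⟨_, List.getElem_mem (h2 ▸ hn), List.Forall₂.get this hn (h2 ▸ hn)⟩

theorem stabilisers {r : PRow} (hr : r ∈ tableP) {x : ℍ[ℤ] × ℍ[ℤ]} (hx : x ∈ r.pairs) :
    (stabP (pair x.1 x.2) = Subgroup.closure r.allGens ∧
      Nat.card (stabP (pair x.1 x.2)) = r.order ∧
      (dcoset rotP (R x.1 x.2)).ncard = r.mult * 192) ∧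
    (stabP (pair x.2 x.1) = Subgroup.closure (Prod.swap '' r.allGens) ∧
      Nat.card (stabP (pair x.2 x.1)) = r.order ∧
      (dcoset rotP (R x.2 x.1)).ncard = r.mult * 192) := by
  obtain ⟨ρ, hρ, h⟩ := exists_matches hr
  obtain ⟨h1, h2⟩ := stabP_of_matches hρ h hx
  have h3 : r.order * r.mult = 384 := by
    rw [h.order, h.mult]
    exact (rowSpecs_order ρ hρ).2
  have h4 : r.order ≠ 0 := by
    intro h0
    rw [h0, zero_mul] at h3
    exact absurd h3 (by decide)
  have e : pair x.2 x.1 = (pair x.1 x.2).swap := rfl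
  have h5 : Nat.card (stabP (pair x.2 x.1)) = r.order := by
    rw [e, stabP_swap, ← h2]
    exact (Nat.card_congr (Subgroup.equivMapOfInjective _ _ (MulEquiv.injective _)).toEquiv).symm
  refine ⟨⟨h1, h2, ncard_dcoset_rotP _ h2 h3 h4⟩, ?_, h5, ncard_dcoset_rotP _ h5 h3 h4⟩
  rw [e, stabP_swap, h1, MonoidHom.map_closure]
  rfl

/-! ### Square classes of norms -/

theorem isSquare_of_mul_self_mul {b t : ℤ} (hb : b ≠ 0) (h : IsSquare (b * b * t)) :
    IsSquare t := by
  obtain ⟨s, hs⟩ := h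
  have h1 : b ^ 2 ∣ s ^ 2 := ⟨t, by rw [sq, sq, ← hs]⟩
  obtain ⟨r, rfl⟩ := (Int.pow_dvd_pow_iff two_ne_zero).1 h1
  refine ⟨r, mul_left_cancel₀ (mul_ne_zero hb hb) ?_⟩
  linear_combination hs

theorem isSquare_mul_of_eq {k l m n : ℤ} (hk : k ≠ 0) (h : k ^ 2 * m = l ^ 2 * n) :
    IsSquare (m * n) :=
  isSquare_of_mul_self_mul hk ⟨l * n, by linear_combination n * h⟩

theorem isSquare_mul_trans {a b c : ℤ} (hb : b ≠ 0) (h : IsSquare (a * b)) (h' : IsSquare (b * c)) :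
    IsSquare (a * c) := by
  apply isSquare_of_mul_self_mul hb
  have := h.mul h'
  have e : b * b * (a * c) = a * b * (b * c) := by ring
  rwa [e]

theorem even_val_iff {m n : ℤ} (hm : m ≠ 0) (hn : n ≠ 0) (h : IsSquare (m * n)) :
    Even (padicValInt 2 m) ↔ Even (padicValInt 2 n) := by
  obtain ⟨s, hs⟩ := h
  have hs0 : s ≠ 0 := by
    rintro rfl
    exact mul_ne_zero hm hn hs
  have h1 := congrArg (padicValInt 2) hs
  rw [padicValInt.mul hm hn, padicValInt.mul hs0 hs0] at h1
  rw [Nat.even_iff, Nat.even_iff]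
  omega

theorem even_val_iff_not {m n : ℤ} (hm : m ≠ 0) (hn : n ≠ 0) (h : IsSquare (2 * (m * n))) :
    Even (padicValInt 2 m) ↔ ¬ Even (padicValInt 2 n) := by
  rw [← mul_assoc] at h
  have h1 := even_val_iff (mul_ne_zero two_ne_zero hm) hn h
  rw [padicValInt.mul two_ne_zero hm, padicValInt_two_two, Nat.even_iff, Nat.even_iff] at h1
  rw [Nat.even_iff, Nat.even_iff]
  omega

theorem isSquare_nrm_of_unit_eq {p q : ℍ[ℤ]} (hp : p ≠ 0) (hq : q ≠ 0) (h : unit p = unit q) :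
    IsSquare (nrm p * nrm q) := by
  obtain ⟨k, l, hk, -, e⟩ := exists_smul_of_unit_eq hp hq h
  have := congrArg nrm e
  rw [nrm_zsmul, nrm_zsmul] at this
  exact isSquare_mul_of_eq hk.ne' this

/-- Even classes have representatives of norm 1 or 4, odd classes of norm 2. -/
theorem isSquare_nrm_octa : ∀ x ∈ octaList, ∀ y ∈ octaList,
    if isR (octaClass x) = isR (octaClass y) then
      nrm x * nrm y = 1 ^ 2 ∨ nrm x * nrm y = 2 ^ 2 ∨ nrm x * nrm y = 4 ^ 2
    else 2 * (nrm x * nrm y) = 2 ^ 2 ∨ 2 * (nrm x * nrm y) = 4 ^ 2 := by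
  decide +kernel

/-- Equivalence changes the square class of the norm only by the factor 2 contributed by each odd
octahedral element. -/
theorem isSquare_of_unit_eq_mul {p c : ℍ[ℤ]} (hp : p ≠ 0) (hc : c ≠ 0) {u v : unitary ℍ[ℝ]}
    {d e : DihedralGroup 3} (hu : Oct u d) (hv : Oct v e) (h : unit p = u * unit c * v) :
    if isR d = isR e then IsSquare (nrm p * nrm c) else IsSquare (2 * (nrm p * nrm c)) := by
  obtain ⟨x, hx, rfl, rfl⟩ := hu
  obtain ⟨y, hy, rfl, rfl⟩ := hv
  have hx0 := ne_zero_of_mem_octaList hx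
  have hy0 := ne_zero_of_mem_octaList hy
  have hz := quat_mul_ne_zero (quat_mul_ne_zero hx0 hc) hy0
  rw [← unit_mul hx0 hc, ← unit_mul (quat_mul_ne_zero hx0 hc) hy0] at h
  have h1 := isSquare_nrm_of_unit_eq hp hz h
  rw [nrm_mul, nrm_mul] at h1
  have h2 := isSquare_nrm_octa x hx y hy
  have h3 : (nrm x * nrm y) ≠ 0 := mul_ne_zero (nrm_pos hx0).ne' (nrm_pos hy0).ne'
  split_ifs at h2 ⊢
  · refine isSquare_of_mul_self_mul h3 ?_
    have e1 : nrm x * nrm y * (nrm x * nrm y) * (nrm p * nrm c) =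
        (nrm x * nrm y) * (nrm p * (nrm x * nrm c * nrm y)) := by ring
    rw [e1]
    refine IsSquare.mul ?_ h1
    rcases h2 with h | h | h <;> rw [h] <;> exact IsSquare.sq _
  · refine isSquare_of_mul_self_mul h3 ?_
    have e1 : nrm x * nrm y * (nrm x * nrm y) * (2 * (nrm p * nrm c)) =
        (2 * (nrm x * nrm y)) * (nrm p * (nrm x * nrm c * nrm y)) := by ring
    rw [e1]
    refine IsSquare.mul ?_ h1
    rcases h2 with h | h <;> rw [h] <;> exact IsSquare.sq _

/-- Links parities in S₃ to norms: normalised quaternions can only be related by outer factors of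
equal parity. The matching of parities for F-classes rests on this. -/
theorem evenTwo_iff {p c : ℍ[ℤ]} (hp : p ≠ 0) (hc : c ≠ 0) {u v : unitary ℍ[ℝ]}
    {d e : DihedralGroup 3} (hu : Oct u d) (hv : Oct v e) (h : unit p = u * unit c * v) :
    EvenTwo p ↔ (EvenTwo c ↔ isR d = isR e) := by
  have := isSquare_of_unit_eq_mul hp hc hu hv h
  rw [EvenTwo, EvenTwo, normSq_eq_nrm, normSq_eq_nrm]
  split_ifs at this with hde
  · rw [even_val_iff (nrm_pos hp).ne' (nrm_pos hc).ne' this]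
    simp [hde]
  · rw [even_val_iff_not (nrm_pos hp).ne' (nrm_pos hc).ne' this]
    simp [hde]

/-! ### Dividing out powers of two -/

/-- All coordinates are even. -/
def AllEven (q : ℍ[ℤ]) : Prop := 2 ∣ q.re ∧ 2 ∣ q.imI ∧ 2 ∣ q.imJ ∧ 2 ∣ q.imK

theorem AllEven.exists_smul {q : ℍ[ℤ]} (h : AllEven q) : ∃ y : ℍ[ℤ], q = (2 : ℤ) • y := by
  obtain ⟨⟨a, ha⟩, ⟨b, hb⟩, ⟨c, hc⟩, ⟨d, hd⟩⟩ := h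
  refine ⟨quat a b c d, ?_⟩
  rw [zsmul_quat]
  exact QuaternionAlgebra.ext ha hb hc hd

theorem exists_two_pow_smul {q : ℍ[ℤ]} (hq : q ≠ 0) :
    ∃ (k : ℕ) (y : ℍ[ℤ]), q = ((2 : ℤ) ^ k) • y ∧ ¬ AllEven y := by
  induction h : (nrm q).toNat using Nat.strong_induction_on generalizing q with
  | _ n ih =>
    by_cases hE : AllEven q
    · obtain ⟨y, rfl⟩ := hE.exists_smul
      have hy : y ≠ 0 := by
        rintro rfl
        exact hq (smul_zero _)
      have hpos := nrm_pos hy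
      have hlt : (nrm y).toNat < n := by
        rw [nrm_zsmul] at h
        omega
      obtain ⟨k, z, hz, hz2⟩ := ih _ hlt hy rfl
      refine ⟨k + 1, z, ?_, hz2⟩
      rw [hz, ← mul_smul, pow_succ']
    · exact ⟨0, q, by rw [pow_zero, one_smul], hE⟩

theorem mul_self_emod_eight (a : ℤ) :
    (a % 2 = 0 ∧ (a * a % 8 = 0 ∨ a * a % 8 = 4)) ∨ (a % 2 = 1 ∧ a * a % 8 = 1) := by
  have h : a % 8 = 0 ∨ a % 8 = 1 ∨ a % 8 = 2 ∨ a % 8 = 3 ∨ a % 8 = 4 ∨ a % 8 = 5 ∨ a % 8 = 6 ∨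
      a % 8 = 7 := by omega
  rcases h with h | h | h | h | h | h | h | h <;>
    (have h2 : a * a % 8 = _ := Int.mul_emod a a 8
     rw [h] at h2
     norm_num at h2
     omega)

/-- Squares are 0, 4 or 1 modulo 8, so the residue depends on the number of odd coordinates: one or
three, two, or four. -/
theorem nrm_emod {q : ℍ[ℤ]} (h : ¬ AllEven q) :
    nrm q % 2 = 1 ∨ nrm q % 4 = 2 ∨ (nrm q % 8 = 4 ∧ q.re % 2 = 1 ∧ q.imI % 2 = 1 ∧
      q.imJ % 2 = 1 ∧ q.imK % 2 = 1) := by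
  have h1 := mul_self_emod_eight q.re
  have h2 := mul_self_emod_eight q.imI
  have h3 := mul_self_emod_eight q.imJ
  have h4 := mul_self_emod_eight q.imK
  unfold AllEven at h
  unfold nrm
  generalize q.re * q.re = a at *
  generalize q.imI * q.imI = b at *
  generalize q.imJ * q.imJ = c at *
  generalize q.imK * q.imK = d at *
  omega

theorem even_val_of_odd {n : ℤ} (h : n % 2 = 1) : Even (padicValInt 2 n) := by
  rw [padicValInt.eq_zero_of_not_dvd (by omega)]
  exact Even.zero

theorem even_val_of_emod_eight {n : ℤ} (h : n % 8 = 4) : Even (padicValInt 2 n) := by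
  obtain ⟨m, rfl⟩ : ∃ m, n = 4 * m := ⟨n / 4, by omega⟩
  have : (2 : ℤ) ^ 2 * m = 1 ^ 2 * (4 * m) := by ring
  exact (even_val_iff_of_sq two_ne_zero one_ne_zero (by omega) (by omega) this).1
    (even_val_of_odd (by omega))

theorem not_even_val_of_emod_four {n : ℤ} (h : n % 4 = 2) : ¬ Even (padicValInt 2 n) := by
  obtain ⟨m, rfl⟩ : ∃ m, n = 2 * m := ⟨n / 2, by omega⟩
  rw [padicValInt.mul two_ne_zero (by omega), padicValInt_two_two,
    padicValInt.eq_zero_of_not_dvd (by omega)]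
  decide

theorem evenTwo_two_pow_smul {k : ℕ} {y : ℍ[ℤ]} (hy : y ≠ 0) :
    EvenTwo (((2 : ℤ) ^ k) • y) ↔ Even (padicValInt 2 (nrm y)) := by
  have h2 : ((2 : ℤ) ^ k) ≠ 0 := pow_ne_zero _ two_ne_zero
  rw [EvenTwo, normSq_eq_nrm, nrm_zsmul]
  refine even_val_iff_of_sq (a := 1) (b := 2 ^ k) one_ne_zero h2
    (mul_ne_zero (pow_ne_zero 2 h2) (nrm_pos hy).ne') (nrm_pos hy).ne' (by ring)

theorem ne_zero_of_not_allEven {y : ℍ[ℤ]} (h : ¬ AllEven y) : y ≠ 0 := by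
  rintro rfl
  exact h ⟨dvd_zero _, dvd_zero _, dvd_zero _, dvd_zero _⟩

/-- After removal of powers of 2, a vector (a,b,b,b) has one, three or four odd coordinates, never
two. -/
theorem evenTwo_form_two {m n : ℤ} (h : quat m n n n ≠ 0) : EvenTwo (quat m n n n) := by
  obtain ⟨k, y, hy, hE⟩ := exists_two_pow_smul h
  rw [hy, evenTwo_two_pow_smul (ne_zero_of_not_allEven hE)]
  have h2 : ((2 : ℤ) ^ k) ≠ 0 := pow_ne_zero _ two_ne_zero
  have hy' := hy
  rw [zsmul_eq_mk] at hy'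
  have e2 : n = 2 ^ k * y.imI := congrArg QuaternionAlgebra.imI hy'
  have e3 : n = 2 ^ k * y.imJ := congrArg QuaternionAlgebra.imJ hy'
  have e4 : n = 2 ^ k * y.imK := congrArg QuaternionAlgebra.imK hy'
  have e5 : y.imI = y.imJ := mul_left_cancel₀ h2 (by rw [← e2, ← e3])
  have e6 : y.imI = y.imK := mul_left_cancel₀ h2 (by rw [← e2, ← e4])
  rcases nrm_emod hE with h | h | h
  · exact even_val_of_odd h
  · exfalso
    have h1 := mul_self_emod_eight y.re
    have h3 := mul_self_emod_eight y.imI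
    unfold nrm at h
    rw [← e5, ← e6] at h
    omega
  · exact even_val_of_emod_eight h.1

/-! ### Canonical representatives of the F-classes -/

/-- `c` is a canonical quaternion of type `i` whose norm contains an even power of two. -/
structure Canon (i : Fin 6) (c : ℍ[ℤ]) : Prop where
  mem : c ∈ form i
  hasType : HasType c i
  even : EvenTwo c

theorem Canon.ne_zero {i : Fin 6} {c : ℍ[ℤ]} (h : Canon i c) : c ≠ 0 := h.hasType.1

theorem evenTwo_of_odd {q : ℍ[ℤ]} (h : nrm q % 2 = 1) : EvenTwo q := by
  rw [EvenTwo, normSq_eq_nrm]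
  exact even_val_of_odd h

/-- Types 0, 1 and 2 have even 2-exponent automatically. Otherwise multiplication by an octahedral
element of norm 2 that preserves the form changes the parity. -/
theorem exists_canon_mul {i : Fin 6} {c : ℍ[ℤ]} (hc : c ∈ form i) (h : HasType c i) :
    ∃ c', Canon i c' ∧ ∃ d u, Oct u d ∧ unit c = unit c' * u := by
  by_cases hE : EvenTwo c
  · exact ⟨c, ⟨hc, h, hE⟩, 1, 1, oct_one, (mul_one _).symm⟩
  have key : ∀ t ∈ octaList, isR (octaClass t) = false → c * t ∈ form i →
      ∃ c', Canon i c' ∧ ∃ d u, Oct u d ∧ unit c = unit c' * u := by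
    intro t ht hR hf
    have ht0 := ne_zero_of_mem_octaList ht
    have h0 := quat_mul_ne_zero h.1 ht0
    have hu : unit (c * t) = 1 * unit c * unit t := by rw [unit_mul h.1 ht0, one_mul]
    refine ⟨c * t, ⟨hf, h.of_sim h0 ⟨1, oct_one.mem, _, (oct_unit ht).mem, hu⟩, ?_⟩,
      _, _, (oct_unit ht).inv, by rw [hu]; group⟩
    rw [evenTwo_iff h0 h.1 oct_one (oct_unit ht) hu, hR]
    simp only [hE, false_iff]
    decide
  fin_cases i
  · exfalso
    obtain rfl : c = 1 := hc
    exact hE (evenTwo_of_odd (by decide))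
  · exfalso
    obtain rfl : c = quat 0 1 1 1 := hc
    exact hE (evenTwo_of_odd (by decide))
  · exfalso
    obtain ⟨m, n, rfl⟩ := hc
    exact hE (evenTwo_form_two h.1)
  · refine key (quat 1 1 0 0) (by decide +kernel) (by decide +kernel) ?_
    obtain ⟨m, n, rfl⟩ := hc
    refine ⟨m - n, m + n, ?_⟩
    change quat m n 0 0 * quat 1 1 0 0 = quat (m - n) (m + n) 0 0
    rw [quat_mul_quat]
    congr 1 <;> ring
  · refine key (quat 0 1 1 0) (by decide +kernel) (by decide +kernel) ?_
    obtain ⟨m, n, rfl⟩ := hc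
    refine ⟨-2 * n, m, ?_⟩
    change quat m n n 0 * quat 0 1 1 0 = quat (-2 * n) m m 0
    rw [quat_mul_quat]
    congr 1 <;> ring
  · exact key (quat 1 1 0 0) (by decide +kernel) (by decide +kernel) (Set.mem_univ _)

/-- Provides the freedom to flip the parities of both outer factors at once. For types 0, 1, 3 and 4
the stabiliser of c contains an odd class. For type 2, multiplying by (0,1,-1,0) on both sides
preserves the form; type 5 imposes no condition. -/
theorem Canon.exists_odd {i : Fin 6} {c : ℍ[ℤ]} (h : Canon i c) :
    ∃ c', Canon i c' ∧ ∃ d e u v, Oct u d ∧ Oct v e ∧ isR d = false ∧ isR e = false ∧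
      unit c = u * unit c' * v := by
  have key : ∀ t ∈ octaList, ∀ t' ∈ octaList, isR (octaClass t) = false →
      isR (octaClass t') = false → t * c * t' ∈ form i →
      ∃ c', Canon i c' ∧ ∃ d e u v, Oct u d ∧ Oct v e ∧ isR d = false ∧ isR e = false ∧
        unit c = u * unit c' * v := by
    intro t ht t' ht' hR hR' hf
    have ht0 := ne_zero_of_mem_octaList ht
    have ht0' := ne_zero_of_mem_octaList ht'
    have h1 := quat_mul_ne_zero ht0 h.ne_zero
    have h0 := quat_mul_ne_zero h1 ht0'
    have hu : unit (t * c * t') = unit t * unit c * unit t' := by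
      rw [unit_mul h1 ht0', unit_mul ht0 h.ne_zero]
    refine ⟨t * c * t', ⟨hf, h.hasType.of_sim h0
      ⟨_, (oct_unit ht).mem, _, (oct_unit ht').mem, hu⟩, ?_⟩,
      _, _, _, _, (oct_unit ht).inv, (oct_unit ht').inv, by rw [isR_inv, hR], by rw [isR_inv, hR'],
      by rw [hu]; group⟩
    rw [evenTwo_iff h0 h.ne_zero (oct_unit ht) (oct_unit ht') hu, hR, hR']
    simpa using h.even
  have comm : ∀ d ∈ stabClass i, isR d = false →
      ∃ c', Canon i c' ∧ ∃ d e u v, Oct u d ∧ Oct v e ∧ isR d = false ∧ isR e = false ∧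
        unit c = u * unit c' * v := by
    intro d hd hR
    obtain ⟨u, v, hu, hv, huv⟩ := exists_of_mem_stabClass h.mem h.ne_zero hd
    exact ⟨c, h, d, d⁻¹, u, v⁻¹, hu, hv.inv, hR, by rw [isR_inv, hR], by rw [huv]; group⟩
  fin_cases i
  · exact comm (.sr 0) (by decide) rfl
  · exact comm (.sr 0) (by decide) rfl
  · have hc := h.mem
    obtain ⟨m, n, hmn⟩ := hc
    refine key (quat 0 1 (-1) 0) (by decide +kernel) (quat 0 1 (-1) 0) (by decide +kernel)
      (by decide +kernel) (by decide +kernel) ⟨-2 * m, 2 * n, ?_⟩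
    rw [hmn]
    change quat 0 1 (-1) 0 * quat m n n n * quat 0 1 (-1) 0 = quat (-2 * m) (2 * n) (2 * n) (2 * n)
    rw [quat_mul_quat, quat_mul_quat]
    congr 1 <;> ring
  · exact comm (.sr 0) (by decide) rfl
  · exact comm (.sr 2) (by decide) rfl
  · exact key (quat 1 1 0 0) (by decide +kernel) (quat 1 1 0 0) (by decide +kernel)
      (by decide +kernel) (by decide +kernel) (Set.mem_univ _)

theorem exists_canon {i : Fin 6} {p : ℍ[ℤ]} (h : HasType p i) :
    ∃ c, Canon i c ∧ ∃ d e u v, Oct u d ∧ Oct v e ∧ unit p = u * unit c * v := by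
  obtain ⟨c, hc, hci, x, hx, y, hy, hxy⟩ := h.exists_form
  obtain ⟨c', hc', d, u, hu, hcu⟩ := exists_canon_mul hc hci
  obtain ⟨e, hx⟩ := mem_octa_iff.1 (inv_mem hx)
  obtain ⟨f, hy⟩ := mem_octa_iff.1 (inv_mem hy)
  exact ⟨c', hc', _, _, _, _, hx, hu.mul hy, by
    have : unit p = x⁻¹ * unit c * y⁻¹ := by rw [hxy]; group
    rw [this, hcu]; group⟩

theorem admissible_iff {p q : ℍ[ℤ]} :
    Admissible p q ↔ p ≠ 0 ∧ q ≠ 0 ∧ IsSquare (nrm p * nrm q) := by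
  rw [Admissible, normSq_eq_nrm, normSq_eq_nrm]

theorem Admissible.evenTwo_iff {p q : ℍ[ℤ]} (h : Admissible p q) : EvenTwo p ↔ EvenTwo q := by
  obtain ⟨hp, hq, h⟩ := admissible_iff.1 h
  rw [EvenTwo, EvenTwo, normSq_eq_nrm, normSq_eq_nrm]
  exact even_val_iff (nrm_pos hp).ne' (nrm_pos hq).ne' h

theorem isSquare_of_two_mul {m n : ℤ} (h : IsSquare (2 * m)) (h' : IsSquare (2 * n)) :
    IsSquare (m * n) := by
  apply isSquare_of_mul_self_mul two_ne_zero
  have := h.mul h'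
  have e : 2 * 2 * (m * n) = 2 * m * (2 * n) := by ring
  rwa [e]

/-- Admissibility only depends on the F-class. -/
theorem Admissible.of_oct {p q c d : ℍ[ℤ]} (h : Admissible p q) (hc : c ≠ 0) (hd : d ≠ 0)
    {u v u' v' : unitary ℍ[ℝ]} {a b a' b' : DihedralGroup 3} (hu : Oct u a) (hv : Oct v b)
    (hu' : Oct u' a') (hv' : Oct v' b') (hp : unit p = u * unit c * v)
    (hq : unit q = u' * unit d * v') (hR : (isR a = isR b) ↔ (isR a' = isR b')) :
    Admissible c d := by
  obtain ⟨hp0, hq0, h⟩ := admissible_iff.1 h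
  refine admissible_iff.2 ⟨hc, hd, ?_⟩
  have h1 := isSquare_of_unit_eq_mul hp0 hc hu hv hp
  have h2 := isSquare_of_unit_eq_mul hq0 hd hu' hv' hq
  have h3 : IsSquare ((nrm p * nrm c) * (nrm q * nrm d)) := by
    by_cases hab : isR a = isR b
    · rw [if_pos hab] at h1
      rw [if_pos (hR.1 hab)] at h2
      exact h1.mul h2
    · rw [if_neg hab] at h1
      rw [if_neg (fun h => hab (hR.2 h))] at h2
      exact isSquare_of_two_mul h1 h2
  apply isSquare_of_mul_self_mul (mul_ne_zero (nrm_pos hp0).ne' (nrm_pos hq0).ne')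
  have e : nrm p * nrm q * (nrm p * nrm q) * (nrm c * nrm d) =
      (nrm p * nrm q) * ((nrm p * nrm c) * (nrm q * nrm d)) := by ring
  rw [e]
  exact h.mul h3

/-- Write p = u c v and q = u' d v'. Admissibility makes the parity of u match that of v exactly
when the parities of u' and v' match. So it is enough to match u with u'; if they differ, c is
replaced by means of `Canon.exists_odd`. -/
theorem exists_canon_pair {i j : Fin 6} {p q : ℍ[ℤ]} (h : Admissible p q) (hp : HasType p i)
    (hq : HasType q j) :
    ∃ c d, Canon i c ∧ Canon j d ∧ Admissible c d ∧ pair p q ∈ dcoset coverF (pair c d) := by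
  obtain ⟨c, hc, a, b, u, v, hu, hv, hpu⟩ := exists_canon hp
  obtain ⟨d, hd, a', b', u', v', hu', hv', hqu⟩ := exists_canon hq
  have hR : (isR a = isR b) ↔ (isR a' = isR b') := by
    have h1 := evenTwo_iff hp.1 hc.ne_zero hu hv hpu
    have h2 := evenTwo_iff hq.1 hd.ne_zero hu' hv' hqu
    have h3 := h.evenTwo_iff
    have h4 := hc.even
    have h5 := hd.even
    tauto
  have fin : ∀ {c d : ℍ[ℤ]} {u v u' v' : unitary ℍ[ℝ]} {a b a' b' : DihedralGroup 3},
      Oct u a → Oct v b → Oct u' a' → Oct v' b' → unit p = u * unit c * v →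
      unit q = u' * unit d * v' → isR a = isR a' → isR b = isR b' →
      pair p q ∈ dcoset coverF (pair c d) := by
    intro c d u v u' v' a b a' b' hu hv hu' hv' hpu hqu h1 h2
    exact mem_dcoset.2 ⟨(u, u'), mem_coverF_iff.2 ⟨a, a', hu, hu', h1⟩, (v, v'),
      mem_coverF_iff.2 ⟨b, b', hv, hv', h2⟩, Prod.ext hpu hqu⟩
  by_cases hab : isR a = isR a'
  · refine ⟨c, d, hc, hd, h.of_oct hc.ne_zero hd.ne_zero hu hv hu' hv' hpu hqu hR,
      fin hu hv hu' hv' hpu hqu hab ?_⟩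
    revert hR hab
    generalize isR a = x
    generalize isR b = y
    generalize isR a' = x'
    generalize isR b' = y'
    revert x y x' y'
    decide
  · obtain ⟨c', hc', e, f, x, y, hx, hy, he, hf, hxy⟩ := hc.exists_odd
    have hpu' : unit p = (u * x) * unit c' * (y * v) := by rw [hpu, hxy]; group
    have hR' : (isR (a * e) = isR (f * b)) ↔ (isR a' = isR b') := by
      rw [← hR, isR_mul, isR_mul, he, hf]
      generalize isR a = x
      generalize isR b = y
      revert x y
      decide
    refine ⟨c', d, hc', hd, h.of_oct hc'.ne_zero hd.ne_zero (hu.mul hx) (hy.mul hv) hu' hv' hpu'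
      hqu hR', fin (hu.mul hx) (hy.mul hv) hu' hv' hpu' hqu ?_ ?_⟩
    · rw [isR_mul, he]
      revert hab
      generalize isR a = x
      generalize isR a' = x'
      revert x x'
      decide
    · rw [isR_mul, hf]
      revert hR hab
      generalize isR a = x
      generalize isR b = y
      generalize isR a' = x'
      generalize isR b' = y'
      revert x y x' y'
      decide

/-! ### Pairs that are not admissible -/

theorem not_admissible_zero_one {c d : ℍ[ℤ]} (hc : c ∈ form 0) (hd : d ∈ form 1) :
    ¬ Admissible c d := by
  obtain rfl : c = 1 := hc
  obtain rfl : d = quat 0 1 1 1 := hd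
  rw [admissible_iff]
  rintro ⟨-, -, h⟩
  exact absurd h (by decide +kernel)

/-- Admissibility would make 3(m²+n²) a square, hence 3t² a sum of two squares with t ≠ 0; but the
prime 3 has odd exponent in it. -/
theorem not_admissible_one_three {c d : ℍ[ℤ]} (hc : c ∈ form 1) (hd : d ∈ form 3) :
    ¬ Admissible c d := by
  obtain rfl : c = quat 0 1 1 1 := hc
  obtain ⟨m, n, rfl⟩ := hd
  change ¬ Admissible (quat 0 1 1 1) (quat m n 0 0)
  rw [admissible_iff]
  rintro ⟨-, h0, s, hs⟩
  have e1 : nrm (quat (0 : ℤ) 1 1 1) = 3 := by decide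
  have e2 : nrm (quat m n 0 0) = m * m + n * n := by
    simp [nrm]
  have hpos := nrm_pos h0
  rw [e1] at hs
  rw [e2] at hs hpos
  have h3 : (3 : ℤ) ∣ s := by
    have : (3 : ℤ) ∣ s * s := ⟨_, hs.symm⟩
    exact (or_self_iff).1 (Int.prime_three.dvd_mul.1 this)
  obtain ⟨t, rfl⟩ := h3
  have h4 : m * m + n * n = 3 * t ^ 2 := by linarith
  have h5 : 3 * t.natAbs ^ 2 = m.natAbs ^ 2 + n.natAbs ^ 2 := by
    zify
    rw [sq_abs, sq_abs, sq_abs, ← h4]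
    ring
  have ht : t.natAbs ≠ 0 := by
    intro h
    rw [Int.natAbs_eq_zero] at h
    rw [h] at h4
    omega
  have h6 := Nat.eq_sq_add_sq_iff.1 ⟨_, _, h5⟩ 3
    (Nat.mem_primeFactors.2 ⟨Nat.prime_three, dvd_mul_right _ _,
      mul_ne_zero (by decide) (pow_ne_zero _ ht)⟩) (by decide)
  have : Fact (Nat.Prime 3) := ⟨Nat.prime_three⟩
  rw [padicValNat.mul (by decide) (pow_ne_zero _ ht), padicValNat.pow, padicValNat.self
    (by decide), Nat.even_iff] at h6
  omega

/-! ### Coincidence indices -/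

theorem image_relIndex_image (Q : Iso4) (L M : AddSubgroup ℍ[ℝ]) :
    (image Q L).relIndex (image Q M) = L.relIndex M :=
  AddSubgroup.relIndex_map_map_of_injective _ _ Q.injective

theorem coincIndex_eq (L : AddSubgroup ℍ[ℝ]) (A : Iso4) :
    coincIndex L A = (image A L).relIndex L := by
  rw [coincIndex, inf_comm, AddSubgroup.inf_relIndex_right]

theorem coincIndex_mul_mul {L : AddSubgroup ℍ[ℝ]} {Q A Q' : Iso4} (hQ : image Q L = L)
    (hQ' : image Q' L = L) : coincIndex L (Q * A * Q') = coincIndex L A := by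
  have h : (image Q (image A L)).relIndex (image Q L) = (image A L).relIndex L :=
    image_relIndex_image _ _ _
  rw [coincIndex_eq, coincIndex_eq, image_mul, image_mul, hQ', ← h, hQ]

theorem coincIndex_of_mem_dcoset {L : AddSubgroup ℍ[ℝ]} {A B : Iso4}
    (h : B ∈ dcoset (symGroup L) A) : coincIndex L B = coincIndex L A := by
  obtain ⟨x, hx, y, hy, rfl⟩ := mem_dcoset.1 h
  exact coincIndex_mul_mul hx.2 hy.2

theorem coincIndex_one (L : AddSubgroup ℍ[ℝ]) : coincIndex L 1 = 1 := by
  rw [coincIndex_eq, image_one, AddSubgroup.relIndex_self]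

/-! ### D₄ inside ℤ⁴ and the comparison of the two indices -/

/-- `ofInt` as a homomorphism. -/
noncomputable def ofIntHom : ℍ[ℤ] →+ ℍ[ℝ] where
  toFun := ofInt
  map_zero' := ofInt_zero
  map_add' := ofInt_add

/-- The integral quaternions of even norm. -/
noncomputable def evenQuat : AddSubgroup ℍ[ℤ] := latF.comap ofIntHom

theorem mem_evenQuat {q : ℍ[ℤ]} : q ∈ evenQuat ↔ Even (nrm q) := by
  change ofInt q ∈ latF ↔ _
  rw [mem_latF_iff]
  constructor
  · rintro ⟨p, hp, h⟩
    rwa [ofInt_injective h]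
  · intro h
    exact ⟨q, h, rfl⟩

theorem ofInt_mem_latF {q : ℍ[ℤ]} : ofInt q ∈ latF ↔ Even (nrm q) := mem_evenQuat

theorem map_evenQuat : evenQuat.map ofIntHom = latF := by
  rw [evenQuat, AddSubgroup.map_comap_eq, inf_eq_right]
  rintro _ ⟨q, -, rfl⟩
  exact ⟨q, rfl⟩

theorem latF_fg : latF.FG := by
  rw [← map_evenQuat]
  have h : (AddSubgroup.toIntSubmodule evenQuat).FG := IsNoetherian.noetherian _
  rw [Submodule.fg_iff_addSubgroup_fg] at h
  obtain ⟨S, hS⟩ := h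
  classical
  refine ⟨S.image ofIntHom, ?_⟩
  rw [Finset.coe_image, ← AddMonoidHom.map_closure, hS, AddSubgroup.toIntSubmodule_toAddSubgroup]

theorem latF_le_latP : latF ≤ latP := by
  rintro _ ⟨q, -, rfl⟩
  exact ⟨q, rfl⟩

/-- The quotient is finitely generated and killed by an odd number, so it is finite and by Cauchy
its order is odd. -/
theorem odd_relIndex {A : Type*} [AddCommGroup A] {L B : AddSubgroup A} (hL : L.FG) {N : ℕ}
    (hN : Odd N) (h : ∀ x ∈ L, N • x ∈ B) : Odd (B.relIndex L) := by
  have hfg : AddGroup.FG L := (AddGroup.fg_iff_addSubgroup_fg L).2 hL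
  have hN0 : 0 < N := hN.pos
  have hker : ∀ y : L ⧸ B.addSubgroupOf L, N • y = 0 := by
    intro y
    obtain ⟨x, rfl⟩ := QuotientAddGroup.mk_surjective y
    rw [← QuotientAddGroup.mk_nsmul, QuotientAddGroup.eq_zero_iff, AddSubgroup.mem_addSubgroupOf]
    exact h x x.2
  have : Finite (L ⧸ B.addSubgroupOf L) := by
    apply AddCommGroup.finite_of_fg_isAddTorsion
    intro y
    exact isOfFinAddOrder_iff_nsmul_eq_zero.2 ⟨N, hN0, hker y⟩
  rw [AddSubgroup.relIndex, AddSubgroup.index, ← Nat.not_even_iff_odd, even_iff_two_dvd]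
  intro h2
  have : Fact (Nat.Prime 2) := ⟨Nat.prime_two⟩
  obtain ⟨y, hy⟩ := exists_prime_addOrderOf_dvd_card' 2 h2
  have h3 := addOrderOf_dvd_of_nsmul_eq_zero (hker y)
  rw [hy] at h3
  exact Nat.not_even_iff_odd.2 hN (even_iff_two_dvd.2 h3)

/-- The parity of the norm is that of the coordinate sum, hence additive; one odd vector in K makes
the even ones a subgroup of index two. -/
theorem latF_relIndex {K : AddSubgroup ℍ[ℝ]} (hK : K ≤ latP) {a : ℍ[ℝ]} (ha : a ∈ K)
    (ha' : a ∉ latF) : latF.relIndex K = 2 := by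
  rw [AddSubgroup.relIndex_eq_two_iff]
  refine ⟨a, ha, fun b hb => ?_⟩
  obtain ⟨x, rfl⟩ := hK ha
  obtain ⟨y, rfl⟩ := hK hb
  rw [← ofInt_add, ofInt_mem_latF, ofInt_mem_latF]
  rw [ofInt_mem_latF] at ha'
  rw [even_nrm_iff] at ha' ⊢
  rw [even_nrm_iff]
  simp only [Quaternion.re_add, Quaternion.imI_add, Quaternion.imJ_add, Quaternion.imK_add]
  rw [xor_iff_iff_not]
  omega

/-- The index of D₄ ∩ A D₄ in ℤ⁴ is computed through D₄ and through K = ℤ⁴ ∩ A ℤ⁴. The remaining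
factor [K : K ∩ D₄] is 1 or 2, according to whether K contains an odd vector. -/
theorem coincIndex_latP_mul (A : Iso4) :
    coincIndex latP A * latF.relIndex (latP ⊓ image A latP) = 2 * coincIndex latF A := by
  -- An even vector A y has an even preimage y, because A preserves norms.
  have hB : latF ⊓ (latP ⊓ image A latP) = latF ⊓ image A latF := by
    apply le_antisymm
    · rintro x ⟨hx, -, y, ⟨q, rfl⟩, h⟩
      refine ⟨hx, _, ?_, h⟩
      obtain ⟨p, hp, rfl⟩ := mem_latF_iff.1 hx
      rw [SetLike.mem_coe, ofInt_mem_latF, nrm_eq_of_isometry h]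
      exact hp
    · rintro x ⟨hx, y, hy, h⟩
      exact ⟨hx, latF_le_latP hx, y, latF_le_latP hy, h⟩
  have h2 : latF.relIndex latP = 2 := by
    refine latF_relIndex le_rfl (ofInt_mem_latP 1) ?_
    rw [ofInt_mem_latF]
    decide
  have e1 := AddSubgroup.relIndex_mul_relIndex (latF ⊓ image A latF) latF latP inf_le_left
    latF_le_latP
  have e2 := AddSubgroup.relIndex_mul_relIndex (latF ⊓ (latP ⊓ image A latP))
    (latP ⊓ image A latP) latP inf_le_right inf_le_left
  rw [AddSubgroup.inf_relIndex_right, hB, ← e1, h2] at e2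
  rw [coincIndex, coincIndex, mul_comm, e2, mul_comm]

theorem coincIndex_latP_of_le {A : Iso4}
    (h : ∀ x : ℍ[ℤ], A (ofInt x) ∈ latP → Even (nrm x)) :
    coincIndex latP A = 2 * coincIndex latF A := by
  have h1 : latF.relIndex (latP ⊓ image A latP) = 1 := by
    rw [AddSubgroup.relIndex_eq_one]
    rintro _ ⟨hx, y, ⟨q, rfl⟩, rfl⟩
    obtain ⟨p, hp⟩ := hx
    change A (ofInt q) = ofInt p at hp
    change A (ofInt q) ∈ latF
    rw [hp, ofInt_mem_latF, ← nrm_eq_of_isometry hp]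
    exact h q (by rw [hp]; exact ofInt_mem_latP p)
  rw [← coincIndex_latP_mul, h1, mul_one]

theorem coincIndex_latP_of_odd {A : Iso4} {x : ℍ[ℤ]} (hx : ¬ Even (nrm x))
    (h : A (ofInt x) ∈ latP) : coincIndex latP A = coincIndex latF A := by
  have h1 : latF.relIndex (latP ⊓ image A latP) = 2 := by
    refine latF_relIndex inf_le_left (a := A (ofInt x)) ⟨h, _, ofInt_mem_latP x, rfl⟩ ?_
    obtain ⟨p, hp⟩ := h
    rw [hp, ofInt_mem_latF, ← nrm_eq_of_isometry hp]
    exact hx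
  have := coincIndex_latP_mul A
  rw [h1] at this
  omega

theorem coincIndex_latP_cases (A : Iso4) : coincIndex latP A = coincIndex latF A ∨
    coincIndex latP A = 2 * coincIndex latF A := by
  by_cases h : ∀ x : ℍ[ℤ], A (ofInt x) ∈ latP → Even (nrm x)
  · exact Or.inr (coincIndex_latP_of_le h)
  · push Not at h
    obtain ⟨x, hx, hx'⟩ := h
    exact Or.inl (coincIndex_latP_of_odd (by simpa using hx') hx)

/-! ### The index of the centred lattice is odd -/

/-- A norm divisible by 8 forces all coordinates to be even; iterating removes 2^k and leaves an
even norm. -/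
theorem exists_two_pow_smul_even (k : ℕ) : ∀ y : ℍ[ℤ], 2 * 4 ^ k ∣ nrm y →
    ∃ z : ℍ[ℤ], y = ((2 : ℤ) ^ k) • z ∧ Even (nrm z) := by
  induction k with
  | zero =>
    intro y hy
    exact ⟨y, by rw [pow_zero, one_smul], even_iff_two_dvd.2 (by simpa using hy)⟩
  | succ k ih =>
    intro y hy
    have h8 : 8 ∣ nrm y := dvd_trans ⟨4 ^ k, by ring⟩ hy
    have hE : AllEven y := by
      by_contra hE
      have := nrm_emod hE
      omega
    obtain ⟨x, rfl⟩ := hE.exists_smul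
    rw [nrm_zsmul] at hy
    have : 2 * 4 ^ k ∣ nrm x := by
      obtain ⟨t, ht⟩ := hy
      exact ⟨t, mul_left_cancel₀ (four_ne_zero) (by rw [pow_succ] at ht; linear_combination ht)⟩
    obtain ⟨z, hz, hz'⟩ := ih x this
    exact ⟨z, by rw [hz, ← mul_smul, pow_succ'], hz'⟩

theorem norm_mul_norm_ofInt {p q : ℍ[ℤ]} {m : ℕ} (h : nrm p * nrm q = m * m) :
    ‖ofInt p‖ * ‖ofInt q‖ = m := by
  have h1 : (‖ofInt p‖ * ‖ofInt q‖) ^ 2 = (m : ℝ) ^ 2 := by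
    rw [mul_pow, norm_ofInt_sq, norm_ofInt_sq, normSq_eq_nrm, normSq_eq_nrm, sq]
    exact_mod_cast h
  exact (pow_left_inj₀ (by positivity) (by positivity) two_ne_zero).1 h1

theorem smul_R_apply {p q : ℍ[ℤ]} (hp : p ≠ 0) (hq : q ≠ 0) {m : ℕ}
    (h : nrm p * nrm q = m * m) (x : ℍ[ℤ]) :
    (m : ℝ) • R p q (ofInt x) = ofInt (p * x * star q) := by
  rw [← norm_mul_norm_ofInt h, R, rot_apply, ofInt_mul, ofInt_mul, ofInt_star]
  conv_rhs => rw [← norm_smul_unit hp, ← norm_smul_unit hq]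
  simp only [pair, Quaternion.star_smul, smul_mul_assoc, mul_smul_comm, smul_smul]
  rw [mul_comm ‖ofInt q‖]

theorem Admissible.exists_nat {p q : ℍ[ℤ]} (h : Admissible p q) :
    ∃ m : ℕ, 0 < m ∧ nrm p * nrm q = m * m := by
  obtain ⟨hp, hq, m, hm⟩ := admissible_iff.1 h
  refine ⟨m.natAbs, Int.natAbs_pos.2 ?_, by rw [hm]; exact (Int.natAbs_mul_self' m).symm⟩
  rintro rfl
  exact mul_ne_zero (nrm_pos hp).ne' (nrm_pos hq).ne' hm

/-- With m = |pq| = 2^k N, the norm of p x q̄ is m² |x|², divisible by 2·4^k when |x|² is even.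
Hence p x q̄ is 2^k times a vector of D₄, which is N R x. -/
theorem Admissible.exists_odd {p q : ℍ[ℤ]} (h : Admissible p q) :
    ∃ N : ℕ, Odd N ∧ ∀ x ∈ latF, N • R p q x ∈ latF := by
  obtain ⟨m, hm, hpq⟩ := h.exists_nat
  obtain ⟨k, N, hN, rfl⟩ := Nat.exists_eq_two_pow_mul_odd hm.ne'
  refine ⟨N, hN, fun x hx => ?_⟩
  obtain ⟨y, hy, rfl⟩ := mem_latF_iff.1 hx
  have h1 := smul_R_apply h.1 h.2.1 hpq y
  obtain ⟨z, hz, hz'⟩ := exists_two_pow_smul_even k (p * y * star q) (by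
    obtain ⟨t, ht⟩ := even_iff_two_dvd.1 hy
    refine ⟨t * N ^ 2, ?_⟩
    rw [nrm_mul, nrm_mul, nrm_star, ht]
    push_cast at hpq
    have : (4 : ℤ) ^ k = 2 ^ k * 2 ^ k := by rw [← mul_pow]; norm_num
    rw [this]
    linear_combination 2 * t * hpq)
  refine mem_latF_iff.2 ⟨z, hz', ?_⟩
  rw [hz, ofInt_zsmul] at h1
  push_cast at h1
  rw [mul_smul] at h1
  rw [← Nat.cast_smul_eq_nsmul ℝ]
  exact smul_right_injective _ (pow_ne_zero k two_ne_zero) h1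

theorem R_inv {p q : ℍ[ℤ]} (hp : p ≠ 0) (hq : q ≠ 0) : (R p q)⁻¹ = R (star p) (star q) := by
  rw [R, R, ← map_inv, pair, pair, unit_star hp, unit_star hq]
  rfl

theorem Admissible.star {p q : ℍ[ℤ]} (h : Admissible p q) : Admissible (star p) (star q) := by
  obtain ⟨hp, hq, h⟩ := admissible_iff.1 h
  refine admissible_iff.2 ⟨star_quat_ne_zero hp, star_quat_ne_zero hq, ?_⟩
  rwa [nrm_star, nrm_star]

/-- The multiplier N is taken for the inverse rotation: N R⁻¹x in D₄ means N x in R D₄. -/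
theorem Admissible.odd_coincIndex {p q : ℍ[ℤ]} (h : Admissible p q) :
    Odd (coincIndex latF (R p q)) := by
  obtain ⟨N, hN, hx⟩ := h.star.exists_odd
  rw [coincIndex_eq]
  refine odd_relIndex latF_fg hN fun x hxF => ?_
  refine ⟨_, hx x hxF, ?_⟩
  change R p q (N • R (Star.star p) (Star.star q) x) = N • x
  rw [← R_inv h.1 h.2.1, map_nsmul]
  congr 1
  exact (R p q).apply_symm_apply x

theorem Admissible.coincIndex_ne_zero {p q : ℍ[ℤ]} (h : Admissible p q) :
    coincIndex latF (R p q) ≠ 0 := h.odd_coincIndex.pos.ne'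

/-! ### Finiteness -/

theorem finite_nrm_le (M : ℤ) : {q : ℍ[ℤ] | nrm q ≤ M}.Finite := by
  refine Set.Finite.subset ((Set.finite_Icc ((-M, -M, -M, -M) : ℤ × ℤ × ℤ × ℤ)
    (M, M, M, M)).image fun x => quat x.1 x.2.1 x.2.2.1 x.2.2.2) ?_
  intro q hq
  have hq' : nrm q ≤ M := hq
  unfold nrm at hq'
  have key : ∀ a : ℤ, a * a ≤ M → -M ≤ a ∧ a ≤ M := fun a ha => ⟨by nlinarith, by nlinarith⟩
  have h1 := key q.re (by nlinarith)
  have h2 := key q.imI (by nlinarith)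
  have h3 := key q.imJ (by nlinarith)
  have h4 := key q.imK (by nlinarith)
  exact ⟨(q.re, q.imI, q.imJ, q.imK), ⟨⟨h1.1, h2.1, h3.1, h4.1⟩, ⟨h1.2, h2.2, h3.2, h4.2⟩⟩, rfl⟩

/-- The index of a subgroup annihilates the quotient. -/
theorem smul_symm_mem_latF {A : Iso4} {x : ℍ[ℝ]} (hx : x ∈ latF) :
    coincIndex latF A • A.symm x ∈ latF := by
  have h := AddSubgroup.nsmul_index_mem ((image A latF).addSubgroupOf latF) ⟨x, hx⟩
  rw [AddSubgroup.mem_addSubgroupOf] at h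
  obtain ⟨y, hy, e⟩ := h
  have e' : A y = coincIndex latF A • x := by
    rw [coincIndex_eq]
    exact e
  rw [← map_nsmul, ← e', A.symm_apply_apply]
  exact hy

/-- An isometry is determined by the vectors σ A⁻¹(2e), which lie in D₄ and have norm 4σ², so each
has finitely many possible values. -/
theorem finite_coincIndex {σ : ℕ} (hσ : σ ≠ 0) : {A : Iso4 | coincIndex latF A = σ}.Finite := by
  let e : Fin 4 → ℍ[ℤ] := fun k => stdUnits.get k
  refine Set.Finite.of_injOn (f := fun (A : Iso4) (k : Fin 4) =>
    σ • A.symm (ofInt ((2 : ℤ) • e k)))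
    (t := Set.pi Set.univ fun _ => ofInt '' {q | nrm q ≤ σ ^ 2 * 4}) ?_ ?_
    (Set.Finite.pi fun _ => (finite_nrm_le _).image _)
  · rintro A rfl k -
    have hk : nrm (e k) = 1 := by
      have : ∀ k : Fin 4, nrm (stdUnits.get k) = 1 := by decide
      exact this k
    have h4 : nrm ((2 : ℤ) • e k) = 4 := by rw [nrm_zsmul, hk]; norm_num
    obtain ⟨y, hy, h⟩ := mem_latF_iff.1
      (smul_symm_mem_latF (A := A) (ofInt_mem_latF.2 (by rw [h4]; decide) :
        ofInt ((2 : ℤ) • e k) ∈ latF))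
    refine ⟨y, ?_, h.symm⟩
    rw [← map_nsmul, LinearIsometryEquiv.symm_apply_eq, ← Nat.cast_smul_eq_nsmul ℤ,
      ← Int.cast_smul_eq_zsmul ℝ, ← ofInt_zsmul] at h
    have := nrm_eq_of_isometry h.symm
    rw [nrm_zsmul, h4] at this
    exact le_of_eq this
  · intro A hA B hB h
    have : A.symm = B.symm := by
      apply isometry_ext
      intro q hq
      obtain ⟨k, hk, rfl⟩ := List.getElem_of_mem hq
      have h1 := congrFun h ⟨k, hk⟩
      have h2 : A.symm (ofInt ((2 : ℤ) • e ⟨k, hk⟩)) = B.symm (ofInt ((2 : ℤ) • e ⟨k, hk⟩)) := by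
        rw [← sub_eq_zero]
        have : σ • (A.symm (ofInt ((2 : ℤ) • e ⟨k, hk⟩)) - B.symm (ofInt ((2 : ℤ) • e ⟨k, hk⟩))) =
            0 := by rw [smul_sub, sub_eq_zero]; exact h1
        rw [← Nat.cast_smul_eq_nsmul ℝ] at this
        exact (smul_eq_zero.1 this).resolve_left (by exact_mod_cast hσ)
      rw [ofInt_zsmul, LinearIsometryEquiv.map_smul, LinearIsometryEquiv.map_smul] at h2
      exact smul_right_injective _ (by norm_num) h2
    rw [← A.symm_symm, this, B.symm_symm]

theorem finite_classesF (i j : Fin 6) (σ : ℕ) : (classesF i j σ).Finite := by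
  by_cases hσ : σ = 0
  -- Index 0 encodes an infinite index, which does not occur for admissible pairs.
  · refine Set.Finite.subset Set.finite_empty ?_
    rintro _ ⟨p, q, h, -, -, h0, -⟩
    exact h.coincIndex_ne_zero (h0.trans hσ)
  · refine Set.Finite.subset ((finite_coincIndex hσ).image (dcoset rotF)) ?_
    rintro _ ⟨p, q, h, -, -, h0, rfl⟩
    exact ⟨_, h0, rfl⟩

theorem finite_classesP (S : Set (ℍ[ℤ] × ℍ[ℤ])) (σ τ : ℕ) : (classesP S σ τ).Finite := by
  by_cases hσ : σ = 0
  · refine Set.Finite.subset Set.finite_empty ?_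
    rintro _ ⟨p, q, -, h, h0, -, -⟩
    exact h.coincIndex_ne_zero (h0.trans hσ)
  · refine Set.Finite.subset ((finite_coincIndex hσ).image (dcoset rotP)) ?_
    rintro _ ⟨p, q, -, h, h0, -, rfl⟩
    exact ⟨_, h0, rfl⟩

/-! ### Interchanging `p` and `q` -/

/-- Quaternion conjugation. -/
noncomputable def starIso : Iso4 where
  toFun := star
  invFun := star
  map_add' := star_add
  map_smul' := Quaternion.star_smul
  left_inv := star_star
  right_inv := star_star
  norm_map' := norm_star

/-- Quaternion conjugation preserves both lattices and interchanges left with right multiplication,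
so all statements about (p,q) transfer to (q,p). -/
theorem starIso_mul_rot_mul (g : Spin) : starIso * rot g * starIso = rot g.swap := by
  ext1 x
  change star (rot g (star x)) = rot g.swap x
  rw [rot_apply, rot_apply]
  simp [mul_assoc]

theorem starIso_mul_self : starIso * starIso = 1 := by
  ext1 x
  exact star_star x

theorem image_starIso_latP : image starIso latP = latP := by
  ext x
  constructor
  · rintro ⟨_, ⟨q, rfl⟩, rfl⟩
    exact ⟨star q, (ofInt_star q).symm⟩
  · rintro ⟨q, rfl⟩
    exact ⟨_, ofInt_mem_latP (star q), by
      change star (ofInt (star q)) = ofInt q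
      rw [ofInt_star, star_star]⟩

theorem image_starIso_latF : image starIso latF = latF := by
  ext x
  constructor
  · rintro ⟨y, hy, rfl⟩
    obtain ⟨q, hq, rfl⟩ := mem_latF_iff.1 hy
    change star (ofInt q) ∈ latF
    rwa [← ofInt_star, ofInt_mem_latF, nrm_star]
  · intro hx
    obtain ⟨q, hq, rfl⟩ := mem_latF_iff.1 hx
    refine ⟨ofInt (star q), ?_, ?_⟩
    · rwa [SetLike.mem_coe, ofInt_mem_latF, nrm_star]
    · change star (ofInt (star q)) = ofInt q
      rw [ofInt_star, star_star]

/-- The interchange of `p` and `q` on rotations. -/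
noncomputable def flip (A : Iso4) : Iso4 := starIso * A * starIso

theorem flip_flip (A : Iso4) : flip (flip A) = A := by
  have : flip (flip A) = (starIso * starIso) * A * (starIso * starIso) := by
    rw [flip, flip]
    group
  rw [this, starIso_mul_self, one_mul, mul_one]

theorem flip_R (p q : ℍ[ℤ]) : flip (R p q) = R q p := starIso_mul_rot_mul _

theorem coincIndex_flip_latP (A : Iso4) : coincIndex latP (flip A) = coincIndex latP A :=
  coincIndex_mul_mul image_starIso_latP image_starIso_latP

theorem coincIndex_flip_latF (A : Iso4) : coincIndex latF (flip A) = coincIndex latF A :=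
  coincIndex_mul_mul image_starIso_latF image_starIso_latF

theorem flip_injective : Function.Injective flip :=
  Function.LeftInverse.injective flip_flip

theorem flip_mul (A B : Iso4) : flip (A * B) = flip A * flip B := by
  have : flip A * flip B = starIso * A * (starIso * starIso) * B * starIso := by
    rw [flip, flip]
    group
  rw [this, starIso_mul_self, flip]
  group

theorem image_flip_dcoset {G : Subgroup Iso4} (hG : ∀ A ∈ G, flip A ∈ G) (A : Iso4) :
    flip '' dcoset G A = dcoset G (flip A) := by
  ext B
  constructor
  · rintro ⟨C, hC, rfl⟩
    obtain ⟨x, hx, y, hy, rfl⟩ := mem_dcoset.1 hC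
    exact mem_dcoset.2 ⟨_, hG x hx, _, hG y hy, by rw [flip_mul, flip_mul]⟩
  · intro hB
    obtain ⟨x, hx, y, hy, rfl⟩ := mem_dcoset.1 hB
    refine ⟨flip x * A * flip y, mem_dcoset.2 ⟨_, hG x hx, _, hG y hy, rfl⟩, ?_⟩
    rw [flip_mul, flip_mul, flip_flip, flip_flip]

theorem flip_mem_rotP {A : Iso4} (h : A ∈ rotP) : flip A ∈ rotP := by
  obtain ⟨g, hg, rfl⟩ := exists_mem_coverP_of_mem_rotP h
  rw [flip, starIso_mul_rot_mul]
  exact swap_mem_coverP.2 hg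

theorem flip_mem_rotF {A : Iso4} (h : A ∈ rotF) : flip A ∈ rotF := by
  obtain ⟨g, hg, rfl⟩ := exists_mem_coverF_of_mem_rotF h
  rw [flip, starIso_mul_rot_mul]
  exact swap_mem_coverF.2 hg

theorem Admissible.swap {p q : ℍ[ℤ]} (h : Admissible p q) : Admissible q p :=
  ⟨h.2.1, h.1, by rw [mul_comm]; exact h.2.2⟩

theorem image_classesF (i j : Fin 6) (σ : ℕ) :
    Set.image flip '' classesF i j σ = classesF j i σ := by
  have key : ∀ i j, ∀ C ∈ classesF i j σ, flip '' C ∈ classesF j i σ := by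
    rintro i j _ ⟨p, q, h, hp, hq, hσ, rfl⟩
    refine ⟨q, p, h.swap, hq, hp, ?_, ?_⟩
    · rw [← flip_R, coincIndex_flip_latF, hσ]
    · rw [image_flip_dcoset (fun _ => flip_mem_rotF), flip_R]
  ext C
  constructor
  · rintro ⟨D, hD, rfl⟩
    exact key i j D hD
  · intro hC
    refine ⟨_, key j i C hC, ?_⟩
    rw [Set.image_image]
    simp [flip_flip]

theorem nF_comm (i j : Fin 6) (σ : ℕ) : nF i j σ = nF j i σ := by
  rw [nF, nF, ← image_classesF i j, Set.ncard_image_of_injective _ flip_injective.image_injective]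

theorem image_classesP (S : Set (ℍ[ℤ] × ℍ[ℤ])) (σ τ : ℕ) :
    Set.image flip '' classesP S σ τ = classesP (Prod.swap '' S) σ τ := by
  have key : ∀ S : Set (ℍ[ℤ] × ℍ[ℤ]), ∀ C ∈ classesP S σ τ,
      flip '' C ∈ classesP (Prod.swap '' S) σ τ := by
    rintro S _ ⟨p, q, hS, h, hσ, hτ, rfl⟩
    refine ⟨q, p, ⟨_, hS, rfl⟩, h.swap, ?_, ?_, ?_⟩
    · rw [← flip_R, coincIndex_flip_latF, hσ]
    · rw [← flip_R, coincIndex_flip_latP, hτ]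
    · rw [image_flip_dcoset (fun _ => flip_mem_rotP), flip_R]
  ext C
  constructor
  · rintro ⟨D, hD, rfl⟩
    exact key S D hD
  · intro hC
    refine ⟨flip '' C, ?_, ?_⟩
    · have := key _ C hC
      rw [Set.image_image] at this
      simpa using this
    · rw [Set.image_image]
      simp [flip_flip]

theorem ncard_classesP_swap (S : Set (ℍ[ℤ] × ℍ[ℤ])) (σ τ : ℕ) :
    (classesP (Prod.swap '' S) σ τ).ncard = (classesP S σ τ).ncard := by
  rw [← image_classesP, Set.ncard_image_of_injective _ flip_injective.image_injective]

/-! ### The comparison of the two indices -/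

/-- `u` is the direction of `z ω ^ k`, where `z` is integral of odd norm `N`. -/
def Par (u : unitary ℍ[ℝ]) (N : ℤ) (k : Fin 3) : Prop :=
  ∃ z : ℍ[ℤ], ¬ Even (nrm z) ∧ nrm z = N ∧ u = unit z * unit (omega k)

/-- Conjugation by `ω ^ k`. -/
def cyc (k : Fin 3) (z : ℍ[ℤ]) : ℍ[ℤ] :=
  match k with
  | 0 => z
  | 1 => quat z.re z.imK z.imI z.imJ
  | 2 => quat z.re z.imJ z.imK z.imI

/-- Conjugation by ω permutes i, j, k cyclically; hence ω can be moved past an integral factor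
without changing its norm. -/
theorem omega_mul_eq_cyc_mul (k : Fin 3) (z : ℍ[ℤ]) : omega k * z = cyc k z * omega k := by
  have hz : z = quat z.re z.imI z.imJ z.imK := rfl
  fin_cases k
  · change 1 * z = z * 1
    rw [one_mul, mul_one]
  · change quat 1 1 1 1 * z = quat z.re z.imK z.imI z.imJ * quat 1 1 1 1
    rw [hz, quat_mul_quat, quat_mul_quat]
    congr 1 <;> simp <;> ring
  · change quat (-1) 1 1 1 * z = quat z.re z.imJ z.imK z.imI * quat (-1) 1 1 1
    rw [hz, quat_mul_quat, quat_mul_quat]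
    congr 1 <;> simp <;> ring

theorem nrm_cyc (k : Fin 3) (z : ℍ[ℤ]) : nrm (cyc k z) = nrm z := by
  fin_cases k
  · rfl
  · change nrm (quat z.re z.imK z.imI z.imJ) = nrm z
    simp [nrm]
    ring
  · change nrm (quat z.re z.imJ z.imK z.imI) = nrm z
    simp [nrm]
    ring

theorem ne_zero_of_not_even {z : ℍ[ℤ]} (h : ¬ Even (nrm z)) : z ≠ 0 := by
  rintro rfl
  exact h (by decide)

theorem Par.neg {u : unitary ℍ[ℝ]} {N : ℤ} {k : Fin 3} (h : Par u N k) : Par (-u) N k := by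
  obtain ⟨z, hz, rfl, rfl⟩ := h
  have h0 := ne_zero_of_not_even hz
  have e : nrm (-z) = nrm z := by simp [nrm]
  exact ⟨-z, by rwa [e], e, by rw [unit_neg h0, neg_mul]⟩

theorem unit_omega_mul (a b : Fin 3) : unit (omega a) * unit (omega b) = unit (omega (a + b)) ∨
    unit (omega a) * unit (omega b) = -unit (omega (a + b)) := by
  have key : ∀ a b : Fin 3, ∃ l ∈ ([1, 2, -2, -4] : List ℤ),
      omega a * omega b = l • omega (a + b) := by
    decide +kernel
  obtain ⟨l, hl, e⟩ := key a b
  have hl0 : l ≠ 0 := by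
    rintro rfl
    simp at hl
  rw [← unit_mul (omega_ne_zero a) (omega_ne_zero b)]
  exact unit_eq_or_neg_of_smul (quat_mul_ne_zero (omega_ne_zero a) (omega_ne_zero b))
    (omega_ne_zero _) one_ne_zero hl0 (by rw [one_smul, e])

theorem Par.mul_omega {u : unitary ℍ[ℝ]} {N : ℤ} {k : Fin 3} (h : Par u N k) (b : Fin 3) :
    Par (u * unit (omega b)) N (k + b) := by
  obtain ⟨z, hz, rfl, rfl⟩ := h
  rcases unit_omega_mul k b with h | h
  · exact ⟨z, hz, rfl, by rw [mul_assoc, h]⟩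
  · have : Par (unit z * unit (omega (k + b))) (nrm z) (k + b) := ⟨z, hz, rfl, rfl⟩
    rw [mul_assoc, h, mul_neg]
    exact this.neg

theorem Par.omega_mul {u : unitary ℍ[ℝ]} {N : ℤ} {k : Fin 3} (h : Par u N k) (a : Fin 3) :
    Par (unit (omega a) * u) N (a + k) := by
  obtain ⟨z, hz, rfl, rfl⟩ := h
  have h0 := ne_zero_of_not_even hz
  have h1 : ¬ Even (nrm (cyc a z)) := by rwa [nrm_cyc]
  have e : unit (omega a) * unit z = unit (cyc a z) * unit (omega a) := by
    rw [← unit_mul (omega_ne_zero a) h0, omega_mul_eq_cyc_mul,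
      unit_mul (ne_zero_of_not_even h1) (omega_ne_zero a)]
  have : Par (unit (cyc a z) * unit (omega a)) (nrm z) a := ⟨_, h1, nrm_cyc a z, rfl⟩
  rw [← mul_assoc, e]
  exact this.mul_omega k

/-- For k ≠ l the real part of X is, up to sign changes of coordinates and a factor t/2, the
coordinate sum S of x. The hypothesis becomes n S = 2A with n odd, so S is even. -/
theorem not_even_re {x X : ℍ[ℤ]} {k l : Fin 3} (hkl : k ≠ l) (hX : X = omega k * x * star (omega l))
    {t n A : ℤ} (ht : nrm (omega k) * nrm (omega l) = t * t) (ht0 : 0 < t) (hn : ¬ Even n)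
    (h : t * A = n * X.re) : Even (nrm x) := by
  have hx : x = quat x.re x.imI x.imJ x.imK := rfl
  rw [even_nrm_iff]
  have key : ∀ S : ℤ, n * S = 2 * A → S % 2 = 0 := by
    intro S hS
    have : Even (n * S) := ⟨A, by linarith⟩
    rw [← Int.even_iff]
    exact (Int.even_mul.1 this).resolve_left hn
  have tt : ∀ t c : ℤ, 0 < t → 0 < c → c * c = t * t → t = c := by
    intro t c h1 h2 h3
    nlinarith
  subst hX
  fin_cases k <;> fin_cases l
  · exact absurd rfl hkl
  · have := tt t 2 ht0 (by decide) (by rw [← ht]; decide)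
    subst this
    have := key (x.re + x.imI + x.imJ + x.imK) (by
      rw [h]
      change _ = n * (1 * x * star (quat 1 1 1 1)).re
      simp)
    omega
  · have := tt t 2 ht0 (by decide) (by rw [← ht]; decide)
    subst this
    have := key (-x.re + x.imI + x.imJ + x.imK) (by
      rw [h]
      change _ = n * (1 * x * star (quat (-1) 1 1 1)).re
      simp)
    omega
  · have := tt t 2 ht0 (by decide) (by rw [← ht]; decide)
    subst this
    have := key (x.re - x.imI - x.imJ - x.imK) (by
      rw [h]
      change _ = n * (quat 1 1 1 1 * x * star 1).re
      simp)
    omega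
  · exact absurd rfl hkl
  · have := tt t 4 ht0 (by decide) (by rw [← ht]; decide)
    subst this
    have := key (x.re + x.imI + x.imJ + x.imK) (by
      have h' : 4 * A = n * (quat 1 1 1 1 * x * star (quat (-1) 1 1 1)).re := h
      simp at h'
      linarith)
    omega
  · have := tt t 2 ht0 (by decide) (by rw [← ht]; decide)
    subst this
    have := key (-x.re - x.imI - x.imJ - x.imK) (by
      rw [h]
      change _ = n * (quat (-1) 1 1 1 * x * star 1).re
      simp)
    omega
  · have := tt t 4 ht0 (by decide) (by rw [← ht]; decide)
    subst this
    have := key (x.re - x.imI - x.imJ - x.imK) (by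
      have h' : 4 * A = n * (quat (-1) 1 1 1 * x * star (quat 1 1 1 1)).re := h
      simp at h'
      linarith)
    omega
  · exact absurd rfl hkl

theorem exists_nat_of_isSquare {m : ℤ} (h : IsSquare m) : ∃ n : ℕ, m = n * n := by
  obtain ⟨s, rfl⟩ := h
  exact ⟨s.natAbs, (Int.natAbs_mul_self' s).symm⟩

/-- Only the existence of an odd integral vector with integral image matters. For k = l a multiple
of 1 is such a vector; for k ≠ l integrality of the image forces an even coordinate sum. -/
theorem coincIndex_latP_of_par {u v : unitary ℍ[ℝ]} {M N : ℤ} {k l : Fin 3} (hu : Par u M k)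
    (hv : Par v N l) (h : IsSquare (M * N)) :
    coincIndex latP (rot (u, v)) =
      if k = l then coincIndex latF (rot (u, v)) else 2 * coincIndex latF (rot (u, v)) := by
  obtain ⟨z, hz, rfl, rfl⟩ := hu
  obtain ⟨y, hy, rfl, rfl⟩ := hv
  obtain ⟨n, hn⟩ := exists_nat_of_isSquare h
  have hz0 := ne_zero_of_not_even hz
  have hy0 := ne_zero_of_not_even hy
  have hn2 : ¬ Even (n : ℤ) := by
    intro h
    have : Even (nrm z * nrm y) := by
      rw [hn]
      exact h.mul_left _
    rcases Int.even_mul.1 this with h | h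
    · exact hz h
    · exact hy h
  have hn0 : (n : ℤ) ≠ 0 := by
    intro h
    rw [h] at hn2
    exact hn2 (by decide)
  have hrot : ∀ x, rot (unit z * unit (omega k), unit y * unit (omega l)) x =
      R z y (R (omega k) (omega l) x) := fun x => by
    have : ((unit z * unit (omega k), unit y * unit (omega l)) : Spin) =
        pair z y * pair (omega k) (omega l) := rfl
    rw [this, map_mul]
    rfl
  split_ifs with hkl
  · subst hkl
    -- The pair (ω^k, ω^k) fixes 1, and (z, y) maps n = |zy| to the integral quaternion z ȳ.
    refine coincIndex_latP_of_odd (x := (n : ℤ) • 1) ?_ ?_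
    · rw [nrm_zsmul, Int.even_mul]
      have : nrm (1 : ℍ[ℤ]) = 1 := by decide
      rw [this]
      rintro (h | h)
      · exact hn2 ((Int.even_pow.1 h).1)
      · exact absurd h (by decide)
    · rw [hrot]
      have e1 : R (omega k) (omega k) (ofInt ((n : ℤ) • 1)) = ofInt ((n : ℤ) • 1) := by
        rw [ofInt_zsmul, LinearIsometryEquiv.map_smul, ofInt_one, R, rot_apply]
        simp [pair]
      rw [e1, ofInt_zsmul, LinearIsometryEquiv.map_smul]
      have := smul_R_apply hz0 hy0 hn 1
      rw [Int.cast_natCast, this]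
      exact ofInt_mem_latP _
  · apply coincIndex_latP_of_le
    intro x hx
    rw [hrot] at hx
    obtain ⟨x', hx'⟩ := hx
    obtain ⟨t, ht0, ht⟩ : ∃ t : ℕ, 0 < t ∧ nrm (omega k) * nrm (omega l) = t * t := by
      have : ∀ k l, nrm (omega k) * nrm (omega l) = (1 : ℕ) * (1 : ℕ) ∨
          nrm (omega k) * nrm (omega l) = (2 : ℕ) * (2 : ℕ) ∨
          nrm (omega k) * nrm (omega l) = (4 : ℕ) * (4 : ℕ) := by decide
      rcases this k l with h | h | h
      · exact ⟨1, by decide, h⟩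
      · exact ⟨2, by decide, h⟩
      · exact ⟨4, by decide, h⟩
    have e1 := smul_R_apply (omega_ne_zero k) (omega_ne_zero l) ht x
    have e2 := smul_R_apply hz0 hy0 hn (omega k * x * star (omega l))
    rw [← e1, LinearIsometryEquiv.map_smul, hx'] at e2
    have e3 : ((n : ℤ) * t) • x' = z * (omega k * x * star (omega l)) * star y := by
      apply ofInt_injective
      rw [ofInt_zsmul, ← e2, smul_smul]
      push_cast
      rfl
    generalize hX : omega k * x * star (omega l) = X at e3
    -- Multiplication by z̄ on the left and y on the right cancels z and y, since |z|²|y|² = n².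
    -- Real parts then suffice.
    have e4 : (n : ℤ) • ((t : ℤ) • (star z * x' * y)) = (n : ℤ) • ((n : ℤ) • X) := by
      have c1 : star z * z = Quaternion.coe (nrm z) := by
        rw [Quaternion.star_mul_self, normSq_eq_nrm]
      have c2 : star y * y = Quaternion.coe (nrm y) := by
        rw [Quaternion.star_mul_self, normSq_eq_nrm]
      calc (n : ℤ) • ((t : ℤ) • (star z * x' * y)) = star z * (((n : ℤ) * t) • x') * y := by
            rw [mul_smul_comm, smul_mul_assoc, mul_smul]
        _ = (star z * z) * X * (star y * y) := by
            rw [e3]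
            noncomm_ring
        _ = (nrm z * nrm y) • X := by
            rw [c1, c2, Quaternion.coe_mul_eq_smul, Quaternion.mul_coe_eq_smul, smul_smul, mul_comm]
        _ = _ := by rw [hn, mul_smul]
    have e5 := congrArg QuaternionAlgebra.re e4
    rw [zsmul_re, zsmul_re, zsmul_re, zsmul_re] at e5
    exact not_even_re hkl hX.symm ht (by exact_mod_cast ht0) hn2 (mul_left_cancel₀ hn0 e5)

theorem par_of_odd {z : ℍ[ℤ]} (h : ¬ Even (nrm z)) : Par (unit z) (nrm z) 0 :=
  ⟨z, h, rfl, by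
    change unit z = unit z * unit 1
    rw [unit_one, mul_one]⟩

/-- Let y be c without its powers of 2. Its norm is odd, giving exponent 0, or y has four odd
coordinates and is z ω or z ω² with z of odd norm. The second case cannot occur if a coordinate of c
vanishes. -/
theorem exists_par {c : ℍ[ℤ]} (hc : c ≠ 0) (h : EvenTwo c) :
    ∃ k N, Par (unit c) N k ∧ IsSquare (nrm c * N) ∧ (c.re = 0 ∨ c.imK = 0 → k = 0) := by
  obtain ⟨n, y, rfl, hE⟩ := exists_two_pow_smul hc
  have hy := ne_zero_of_not_allEven hE
  have h2 : (0 : ℤ) < 2 ^ n := by positivity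
  rw [evenTwo_two_pow_smul hy] at h
  rw [unit_smul h2 hy, nrm_zsmul, zsmul_re]
  have hK : (((2 : ℤ) ^ n) • y).imK = 2 ^ n * y.imK := congrArg QuaternionAlgebra.imK
    (zsmul_eq_mk _ y)
  rw [hK]
  rcases nrm_emod hE with h1 | h1 | ⟨h1, ha, hb, hc, hd⟩
  · refine ⟨0, nrm y, par_of_odd (by rw [Int.even_iff]; omega), ⟨2 ^ n * nrm y, by ring⟩,
      fun _ => rfl⟩
  · exact absurd h (not_even_val_of_emod_four h1)
  · have key : ∀ e : Fin 3, nrm (omega e) = 4 → ∀ z : ℍ[ℤ], y * star (omega e) = (4 : ℤ) • z →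
        Par (unit y) (nrm z) e ∧ IsSquare ((2 ^ n) ^ 2 * nrm y * nrm z) := by
      intro e he z hz
      have e1 : nrm y = 4 * nrm z := by
        have := congrArg nrm hz
        rw [nrm_mul, nrm_star, he, nrm_zsmul] at this
        linarith
      have hz2 : ¬ Even (nrm z) := by
        rw [Int.even_iff]
        omega
      have e2 : y = z * omega e := by
        have c1 : star (omega e) * omega e = Quaternion.coe 4 := by
          rw [Quaternion.star_mul_self, normSq_eq_nrm, he]
        have : (4 : ℤ) • y = (4 : ℤ) • (z * omega e) := by
          rw [← smul_mul_assoc, ← hz, mul_assoc, c1, Quaternion.mul_coe_eq_smul]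
        have := congrArg ofInt this
        rw [ofInt_zsmul, ofInt_zsmul] at this
        exact ofInt_injective (smul_right_injective _ (by norm_num) this)
      refine ⟨⟨z, hz2, rfl, ?_⟩, ⟨2 ^ n * (2 * nrm z), by rw [e1]; ring⟩⟩
      rw [← unit_mul (ne_zero_of_not_even hz2) (omega_ne_zero e), ← e2]
    have hfalse : 2 ^ n * y.re = 0 ∨ 2 ^ n * y.imK = 0 → ∀ e : Fin 3, e = 0 := by
      rintro (h | h)
      · rw [(mul_eq_zero.1 h).resolve_left h2.ne'] at ha
        exact absurd ha (by decide)
      · rw [(mul_eq_zero.1 h).resolve_left h2.ne'] at hd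
        exact absurd hd (by decide)
    have hy' : y = quat y.re y.imI y.imJ y.imK := rfl
    -- With four odd coordinates the sum is 0 or 2 modulo 4. In the first case y ω̄ is divisible as
    -- required; in the second, changing the sign of the real part makes the sum divisible by 4,
    -- which is the condition for ω².
    by_cases hS : (y.re + y.imI + y.imJ + y.imK) % 4 = 0
    · refine ⟨1, _, (key 1 rfl (quat ((y.re + y.imI + y.imJ + y.imK) / 4)
        ((-y.re + y.imI - y.imJ + y.imK) / 4) ((-y.re + y.imI + y.imJ - y.imK) / 4)
        ((-y.re - y.imI + y.imJ + y.imK) / 4)) ?_).1, (key 1 rfl _ ?_).2, fun h => hfalse h _⟩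
      all_goals
        have hs : star (omega 1) = quat 1 (-1) (-1) (-1) := by decide
        rw [zsmul_quat, hs]
        refine (quat_mul_quat y.re y.imI y.imJ y.imK _ _ _ _).trans ?_
        congr 1 <;> omega
    · refine ⟨2, _, (key 2 rfl (quat ((-y.re + y.imI + y.imJ + y.imK) / 4)
        ((-y.re - y.imI - y.imJ + y.imK) / 4) ((-y.re + y.imI - y.imJ - y.imK) / 4)
        ((-y.re - y.imI + y.imJ - y.imK) / 4)) ?_).1, (key 2 rfl _ ?_).2, fun h => hfalse h _⟩
      all_goals
        have hs : star (omega 2) = quat (-1) (-1) (-1) (-1) := by decide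
        rw [zsmul_quat, hs]
        refine (quat_mul_quat y.re y.imI y.imJ y.imK _ _ _ _).trans ?_
        congr 1 <;> omega

/-! ### Double cosets of rotations and of pairs -/

/-- The ambiguity (-1,-1) of the lift lies in the preimage of K, so double cosets correspond. -/
theorem rot_mem_dcoset_iff {K : Subgroup Iso4} (hK : K ≤ rot.range) {g h : Spin} :
    rot h ∈ dcoset K (rot g) ↔ h ∈ dcoset (K.comap rot) g := by
  rw [mem_dcoset, mem_dcoset]
  constructor
  · rintro ⟨A, hA, B, hB, e⟩
    obtain ⟨x, rfl⟩ := hK hA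
    obtain ⟨y, rfl⟩ := hK hB
    rw [← map_mul, ← map_mul, rot_eq_iff] at e
    rcases e with e | e
    · exact ⟨x, hA, y, hB, e⟩
    · refine ⟨(-1, -1) * x, ?_, y, hB, by rw [e]; group⟩
      rw [Subgroup.mem_comap, map_mul, rot_eq_one_iff.2 (Or.inr rfl), one_mul]
      exact hA
  · rintro ⟨x, hx, y, hy, rfl⟩
    exact ⟨_, hx, _, hy, by rw [map_mul, map_mul]⟩

theorem rot_mem_dcoset_rotP {g h : Spin} : rot h ∈ dcoset rotP (rot g) ↔ h ∈ dcoset coverP g :=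
  rot_mem_dcoset_iff rotP_le_range

theorem rotF_le_range : rotF ≤ rot.range := by
  intro A hA
  obtain ⟨g, -, rfl⟩ := exists_mem_coverF_of_mem_rotF hA
  exact ⟨g, rfl⟩

theorem rot_mem_dcoset_rotF {g h : Spin} : rot h ∈ dcoset rotF (rot g) ↔ h ∈ dcoset coverF g :=
  rot_mem_dcoset_iff rotF_le_range

theorem word_mem_dcoset_coverF (g : Spin) (w : Fin 3 × Fin 3) : word g w ∈ dcoset coverF g :=
  mem_dcoset.2 ⟨_, s_mem_coverF w.1, _, s_mem_coverF w.2, rfl⟩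

theorem word_pair (c d : ℍ[ℤ]) (w : Fin 3 × Fin 3) :
    word (pair c d) w = (unit c, unit (omega w.1) * unit d * unit (omega w.2)) := by
  rw [word, s_eq, s_eq]
  apply Prod.ext <;> simp [pair]

theorem neg_mul_mem_dcoset {g h : Spin} : (1, -1) * h ∈ dcoset coverP g ↔ h ∈ dcoset coverP g := by
  have key : ∀ {h : Spin}, h ∈ dcoset coverP g → (1, -1) * h ∈ dcoset coverP g := by
    intro h hh
    obtain ⟨x, hx, y, hy, rfl⟩ := mem_dcoset.1 hh
    exact mem_dcoset.2 ⟨_, mul_mem neg_mem_coverP hx, y, hy, by group⟩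
  refine ⟨fun h' => ?_, key⟩
  have := key h'
  rw [← mul_assoc] at this
  have e : ((1, -1) : Spin) * (1, -1) = 1 := Prod.ext (by simp) (by simp)
  rwa [e, one_mul] at this

/-! ### Uniqueness of the canonical representatives -/

/-- The types for which every word can be absorbed into a canonical quaternion. -/
def FreeType (i : Fin 6) : Prop := i = 2 ∨ i = 5

instance (i : Fin 6) : Decidable (FreeType i) := by unfold FreeType; infer_instance

theorem commute_form_three {c : ℍ[ℤ]} (h : c ∈ form 3) :
    quat 1 1 0 0 * c = c * quat 1 1 0 0 := by
  obtain ⟨m, n, rfl⟩ := h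
  change quat 1 1 0 0 * quat m n 0 0 = quat m n 0 0 * quat 1 1 0 0
  rw [quat_mul_quat, quat_mul_quat]
  congr 1 <;> ring

theorem commute_form_four {c : ℍ[ℤ]} (h : c ∈ form 4) :
    quat 0 1 1 0 * c = c * quat 0 1 1 0 := by
  obtain ⟨m, n, rfl⟩ := h
  change quat 0 1 1 0 * quat m n n 0 = quat m n n 0 * quat 0 1 1 0
  rw [quat_mul_quat, quat_mul_quat]
  congr 1 <;> ring

/-- For types 3 and 4 the classes form {1, τ} with a single reflection τ, which is its own
centraliser apart from 1. -/
theorem stabClass_of_conj : ∀ i : Fin 6, i = 3 ∨ i = 4 → ∀ a t : DihedralGroup 3,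
    isR t = false → t ∈ stabClass i → a * t * a⁻¹ ∈ stabClass i → a ∈ stabClass i ∧ a⁻¹ = a := by
  decide

theorem eq_of_isR : ∀ i : Fin 6, i = 3 ∨ i = 4 → ∀ a b : DihedralGroup 3, a ∈ stabClass i →
    b ∈ stabClass i → isR a = isR b → a = b := by
  decide

/-- Rigidity. For types 0 and 1 the canonical quaternion is unique. For types 3 and 4, c and c'
commute with a common odd element t, and conjugating t by x or y stays in the stabiliser of c. So
both classes lie in {1, τ}, and even 2-exponents make their parities equal. -/
theorem Canon.class_eq {i : Fin 6} (hi : ¬ FreeType i) {c c' : ℍ[ℤ]} (hc : Canon i c)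
    (hc' : Canon i c') {x y : unitary ℍ[ℝ]} {a b : DihedralGroup 3} (hx : Oct x a) (hy : Oct y b)
    (h : unit c' = x * unit c * y) : b = a⁻¹ ∧ a ∈ stabClass i := by
  have same : c' = c → b = a⁻¹ ∧ a ∈ stabClass i := by
    rintro rfl
    obtain ⟨e1, e2⟩ := stabClass_of_unit hc.mem hc.hasType hx hy.inv (by
      rw [eq_mul_inv_iff_mul_eq]
      exact h.symm)
    exact ⟨by rw [e1, inv_inv], e2⟩
  have comm : ∀ t ∈ octaList, isR (octaClass t) = false → octaClass t ∈ stabClass i →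
      t * c = c * t → t * c' = c' * t → i = 3 ∨ i = 4 → b = a⁻¹ ∧ a ∈ stabClass i := by
    intro t ht hR htc h1 h2 hi
    have ht0 := ne_zero_of_mem_octaList ht
    have e1 : unit t * unit c = unit c * unit t := by
      rw [← unit_mul ht0 hc.ne_zero, h1, unit_mul hc.ne_zero ht0]
    have e2 : unit t * unit c' = unit c' * unit t := by
      rw [← unit_mul ht0 hc'.ne_zero, h2, unit_mul hc'.ne_zero ht0]
    rw [h] at e2
    have e3 : x⁻¹ * unit t * x * unit c = unit c * (y * unit t * y⁻¹) := by
      calc x⁻¹ * unit t * x * unit c = x⁻¹ * (unit t * (x * unit c * y)) * y⁻¹ := by group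
        _ = _ := by rw [e2]; group
    obtain ⟨k1, k2⟩ := stabClass_of_unit hc.mem hc.hasType ((hx.inv.mul (oct_unit ht)).mul hx)
      ((hy.mul (oct_unit ht)).mul hy.inv) e3
    have k3 := k2
    rw [k1] at k3
    obtain ⟨m1, m2⟩ := stabClass_of_conj i hi a⁻¹ _ hR htc (by rwa [inv_inv])
    obtain ⟨m3, m4⟩ := stabClass_of_conj i hi b _ hR htc k3
    rw [inv_inv] at m2
    have hE := (evenTwo_iff hc'.ne_zero hc.ne_zero hx hy h).1 hc'.even
    have := eq_of_isR i hi _ _ m1 m3 (by rw [isR_inv]; exact hE.1 hc.even)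
    exact ⟨this.symm, by rw [m2]; exact m1⟩
  have h1 := hc.mem
  have h2 := hc'.mem
  fin_cases i
  · exact same (h2.trans (Eq.symm h1))
  · exact same (h2.trans (Eq.symm h1))
  · exact absurd (Or.inl rfl) hi
  · exact comm (quat 1 1 0 0) (by decide +kernel) (by decide +kernel) (by decide +kernel)
      (commute_form_three h1) (commute_form_three h2) (Or.inl rfl)
  · exact comm (quat 0 1 1 0) (by decide +kernel) (by decide +kernel) (by decide +kernel)
      (commute_form_four h1) (commute_form_four h2) (Or.inr rfl)
  · exact absurd (Or.inr rfl) hi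

/-- By rigidity the outer factors can be corrected by an element passing through c, which leaves
factors in Q₈. -/
theorem Canon.exists_class_one {i : Fin 6} (hi : ¬ FreeType i) {c c' : ℍ[ℤ]} (hc : Canon i c)
    (hc' : Canon i c') {x y : unitary ℍ[ℝ]} {a b : DihedralGroup 3} (hx : Oct x a) (hy : Oct y b)
    (h : unit c' = x * unit c * y) :
    ∃ x' y', Oct x' 1 ∧ Oct y' 1 ∧ unit c' = x' * unit c * y' := by
  obtain ⟨rfl, ha⟩ := hc.class_eq hi hc' hx hy h
  obtain ⟨u, v, hu, hv, huv⟩ := exists_of_mem_stabClass hc.mem hc.ne_zero ha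
  refine ⟨x * u⁻¹, v * y, ?_, ?_, ?_⟩
  · have := hx.mul hu.inv
    rwa [mul_inv_cancel] at this
  · have := hv.mul hy
    rwa [mul_inv_cancel] at this
  · have : x * u⁻¹ * unit c * (v * y) = x * u⁻¹ * (unit c * v) * y := by group
    rw [this, ← huv, h]
    group

/-- Q₈ is normal in `octa`, so outer factors of trivial class can be moved past the letters of the
word and remain in `coverP`. -/
theorem word_mem_of_canon {i j : Fin 6} (hi : ¬ FreeType i) (hj : ¬ FreeType j)
    {c c' d d' : ℍ[ℤ]} (hc : Canon i c) (hc' : Canon i c') (hd : Canon j d) (hd' : Canon j d')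
    (h : pair c' d' ∈ dcoset coverF (pair c d)) (w : Fin 3 × Fin 3) :
    word (pair c' d') w ∈ dcoset coverP (word (pair c d) w) := by
  obtain ⟨x, hx, y, hy, e⟩ := mem_dcoset.1 h
  obtain ⟨a, a', hx1, hx2, -⟩ := mem_coverF_iff.1 hx
  obtain ⟨b, b', hy1, hy2, -⟩ := mem_coverF_iff.1 hy
  obtain ⟨e1, e2⟩ := Prod.mk.inj e
  obtain ⟨u, v, hu, hv, huv⟩ := hc.exists_class_one hi hc' hx1 hy1 e1
  obtain ⟨u', v', hu', hv', huv'⟩ := hd.exists_class_one hj hd' hx2 hy2 e2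
  rw [word_pair, word_pair]
  refine mem_dcoset.2 ⟨(u, unit (omega w.1) * u' * (unit (omega w.1))⁻¹),
    mem_coverP_iff.2 ⟨1, hu, ?_⟩, (v, (unit (omega w.2))⁻¹ * v' * unit (omega w.2)),
    mem_coverP_iff.2 ⟨1, hv, ?_⟩, Prod.ext huv ?_⟩
  · have := ((oct_omega w.1).mul hu').mul (oct_omega w.1).inv
    rwa [mul_one, mul_inv_cancel] at this
  · have := ((oct_omega w.2).inv.mul hv').mul (oct_omega w.2)
    rwa [mul_one, inv_mul_cancel] at this
  · change unit (omega w.1) * unit d' * unit (omega w.2) = _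
    rw [huv']
    dsimp only [Prod.mk_mul_mk]
    group

/-! ### Absorbing words into canonical quaternions -/

/-- The quaternions (m,n,n,n) form a commutative ring containing the powers of ω; type 5 imposes no
condition. -/
theorem omega_mul_mem_form {j : Fin 6} (hj : FreeType j) {d : ℍ[ℤ]} (hd : d ∈ form j) (a b : Fin 3) :
    omega a * d * omega b ∈ form j ∧ star (omega a) * d * star (omega b) ∈ form j := by
  rcases hj with rfl | rfl
  · obtain ⟨m, n, rfl⟩ := hd
    have h1 : ∀ a, ∃ r s : ℤ, omega a = quat r s s s := by
      intro a
      fin_cases a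
      · exact ⟨1, 0, rfl⟩
      · exact ⟨1, 1, rfl⟩
      · exact ⟨-1, 1, rfl⟩
    have h2 : ∀ a, ∃ r s : ℤ, star (omega a) = quat r s s s := by
      intro a
      fin_cases a
      · exact ⟨1, 0, by decide +kernel⟩
      · exact ⟨1, -1, by decide +kernel⟩
      · exact ⟨-1, -1, by decide +kernel⟩
    have key : ∀ r s t u : ℤ, quat r s s s * quat m n n n * quat t u u u ∈ form 2 := by
      intro r s t u
      refine ⟨(r * m - 3 * s * n) * t - 3 * (r * n + s * m) * u,
        (r * m - 3 * s * n) * u + (r * n + s * m) * t, ?_⟩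
      refine Eq.trans ?_ (rfl : quat _ _ _ _ = _)
      rw [quat_mul_quat, quat_mul_quat]
      congr 1 <;> ring
    constructor
    · obtain ⟨r, s, e⟩ := h1 a
      obtain ⟨t, u, e'⟩ := h1 b
      rw [e, e']
      exact key r s t u
    · obtain ⟨r, s, e⟩ := h2 a
      obtain ⟨t, u, e'⟩ := h2 b
      rw [e, e']
      exact key r s t u
  · exact ⟨Set.mem_univ _, Set.mem_univ _⟩

theorem Canon.of_even {j : Fin 6} {d d' : ℍ[ℤ]} (hd : Canon j d) (hd' : d' ∈ form j) (h0 : d' ≠ 0)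
    {u v : unitary ℍ[ℝ]} {a b : Fin 3} (hu : Oct u (rho a)) (hv : Oct v (rho b))
    (h : unit d' = u * unit d * v) : Canon j d' :=
  ⟨hd', hd.hasType.of_sim h0 ⟨u, hu.mem, v, hv.mem, h⟩,
    (evenTwo_iff h0 hd.ne_zero hu hv h).2 (iff_of_true hd.even rfl)⟩

theorem exists_canon_of_word {i j : Fin 6} (hij : FreeType i ∨ FreeType j) {c d : ℍ[ℤ]}
    (hc : Canon i c) (hd : Canon j d) (h : Admissible c d) (w : Fin 3 × Fin 3) :
    ∃ c' d', Canon i c' ∧ Canon j d' ∧ Admissible c' d' ∧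
      pair c' d' ∈ dcoset coverP (word (pair c d) w) := by
  have hinv : ∀ a : Fin 3, ∃ a' : Fin 3, (rho a)⁻¹ = rho a' := by decide
  have h1 := omega_ne_zero w.1
  have h2 := omega_ne_zero w.2
  have hw1 := oct_omega w.1
  have hw2 := oct_omega w.2
  have hw1' := hw1.inv
  have hw2' := hw2.inv
  obtain ⟨a', ha'⟩ := hinv w.1
  obtain ⟨b', hb'⟩ := hinv w.2
  rw [ha'] at hw1'
  rw [hb'] at hw2'
  rcases hij with hi | hj
  -- The diagonal pairs (ω, ω) lie in `coverP`, so multiplying by their inverses moves the word from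
  -- the second component to the first.
  · have h3 := quat_mul_ne_zero (star_quat_ne_zero h1) hc.ne_zero
    have h4 := quat_mul_ne_zero h3 (star_quat_ne_zero h2)
    have e : unit (star (omega w.1) * c * star (omega w.2)) =
        (unit (omega w.1))⁻¹ * unit c * (unit (omega w.2))⁻¹ := by
      rw [unit_mul h3 (star_quat_ne_zero h2), unit_mul (star_quat_ne_zero h1) hc.ne_zero,
        unit_star h1, unit_star h2]
    refine ⟨_, d, hc.of_even (omega_mul_mem_form hi hc.mem w.1 w.2).2 h4 hw1' hw2' e, hd,
      h.of_oct h4 hd.ne_zero hw1 hw2 oct_one oct_one (by rw [e]; group) (by simp)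
      (iff_of_true rfl rfl), ?_⟩
    rw [word_pair]
    refine mem_dcoset.2 ⟨((unit (omega w.1))⁻¹, (unit (omega w.1))⁻¹),
      mem_coverP_iff.2 ⟨_, hw1', hw1'⟩, ((unit (omega w.2))⁻¹, (unit (omega w.2))⁻¹),
      mem_coverP_iff.2 ⟨_, hw2', hw2'⟩, Prod.ext e ?_⟩
    change unit d = (unit (omega w.1))⁻¹ * (unit (omega w.1) * unit d * unit (omega w.2)) *
      (unit (omega w.2))⁻¹
    group
  · have h3 := quat_mul_ne_zero h1 hd.ne_zero
    have h4 := quat_mul_ne_zero h3 h2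
    have e : unit (omega w.1 * d * omega w.2) = unit (omega w.1) * unit d * unit (omega w.2) := by
      rw [unit_mul h3 h2, unit_mul h1 hd.ne_zero]
    refine ⟨c, _, hc, hd.of_even (omega_mul_mem_form hj hd.mem w.1 w.2).1 h4 hw1 hw2 e,
      h.of_oct hc.ne_zero h4 oct_one oct_one hw1' hw2' (by simp) (by rw [e]; group)
      (iff_of_true rfl rfl), ?_⟩
    rw [word_pair, pair, e]
    exact self_mem_dcoset _ _

theorem WordRel.isSquare {w : Fin 3 × Fin 3} {q c : ℍ[ℤ]} (h : WordRel w q c) :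
    IsSquare (nrm q * nrm c) := by
  obtain ⟨k, l, hk, hl, e⟩ := h
  have h1 := congrArg nrm e
  rw [nrm_zsmul, nrm_zsmul, nrm_mul, nrm_mul] at h1
  have sq_omega : ∀ k, ∃ n : ℤ, nrm (omega k) = n ^ 2 := fun k => by
    rcases nrm_omega k with h | h
    · exact ⟨1, by rw [h, one_pow]⟩
    · exact ⟨2, h⟩
  obtain ⟨m, e1⟩ := sq_omega w.1
  obtain ⟨n, e2⟩ := sq_omega w.2
  refine isSquare_mul_of_eq (l := l * m * n) hk ?_
  rw [h1, e1, e2]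
  ring

theorem Admissible.of_wordRel {w : Fin 3 × Fin 3} {p q d : ℍ[ℤ]} (h : Admissible p d)
    (hw : WordRel w q d) : Admissible p q := by
  obtain ⟨hp, hd, h⟩ := admissible_iff.1 h
  refine admissible_iff.2 ⟨hp, hw.ne_zero.2 hd, ?_⟩
  refine isSquare_mul_trans (nrm_pos hd).ne' h ?_
  rw [mul_comm]
  exact hw.isSquare

/-! ### The rows that meet a given double coset -/

/-- The condition for a row to meet the double coset of a word. -/
def RowSpec.Meets (ρ : RowSpec) (w : Fin 3 × Fin 3) : Prop :=
  FreeType ρ.i ∨ FreeType ρ.j ∨ WordEquiv ρ.i ρ.j ρ.label w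

instance (ρ : RowSpec) (w : Fin 3 × Fin 3) : Decidable (ρ.Meets w) := by
  unfold RowSpec.Meets; infer_instance

/-- The P-class of a word contains an admissible pair of `S`. -/
def Contains (S : Set (ℍ[ℤ] × ℍ[ℤ])) (g : Spin) : Prop :=
  ∃ p q, (p, q) ∈ S ∧ Admissible p q ∧ pair p q ∈ dcoset coverP g

theorem rowSpecs_free : ∀ ρ ∈ rowSpecs, FreeType ρ.i ∨ FreeType ρ.j → ρ.label = (0, 0) := by
  decide +kernel

theorem word_zero (c d : ℍ[ℤ]) : word (pair c d) (0, 0) = pair c d := by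
  rw [word_pair]
  change (unit c, unit 1 * unit d * unit 1) = _
  rw [unit_one, one_mul, mul_one, pair]

theorem RowSpec.Matches.contains_label {r : PRow} {ρ : RowSpec} (h : RowSpec.Matches r ρ)
    {c d : ℍ[ℤ]} (hc : Canon ρ.i c) (hd : Canon ρ.j d) (had : Admissible c d) :
    Contains r.normPairs (word (pair c d) ρ.label) := by
  obtain ⟨q, hq, hw⟩ := h.rel_formQ d hd.mem
  have hq0 := hw.ne_zero.2 hd.ne_zero
  have hp' : c ∈ r.formP := by rw [h.formP]; exact hc.mem
  refine ⟨c, q, ⟨⟨⟨hp', hq⟩, ?_⟩, hc.even, (hw.evenTwo hd.ne_zero).2 hd.even⟩,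
    had.of_wordRel hw, ?_⟩
  · refine ⟨?_, ?_⟩
    · rw [h.i]
      exact hc.hasType
    · rw [h.j]
      exact hd.hasType.of_sim hq0 (hw.sim hd.ne_zero).symm
  · rcases hw.pair_eq hd.ne_zero c with e | e
    · rw [e]
      exact self_mem_dcoset _ _
    · rw [e, neg_mul_mem_dcoset]
      exact self_mem_dcoset _ _

theorem Contains.of_eq {S : Set (ℍ[ℤ] × ℍ[ℤ])} {g h : Spin} (hS : Contains S g)
    (e : g ∈ dcoset coverP h) : Contains S h := by
  obtain ⟨p, q, h1, h2, h3⟩ := hS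
  exact ⟨p, q, h1, h2, by rwa [dcoset_eq_of_mem e] at h3⟩

theorem mem_dcoset_symm {A : Type*} [Group A] {G : Subgroup A} {a b : A} (h : b ∈ dcoset G a) :
    a ∈ dcoset G b := by
  rw [dcoset_eq_of_mem h]
  exact self_mem_dcoset _ _

/-- With a free type every word is absorbed into a canonical pair, which belongs to the row.
Otherwise a pair of the row is its label applied to another canonical pair in the same F-class, and
rigidity lets that pair be replaced by (c,d). -/
theorem RowSpec.Matches.contains_iff {r : PRow} {ρ : RowSpec} (hρ : ρ ∈ rowSpecs)
    (h : RowSpec.Matches r ρ) {c d : ℍ[ℤ]} (hc : Canon ρ.i c) (hd : Canon ρ.j d)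
    (had : Admissible c d) (w : Fin 3 × Fin 3) :
    Contains r.normPairs (word (pair c d) w) ↔ ρ.Meets w := by
  by_cases hfree : FreeType ρ.i ∨ FreeType ρ.j
  · refine iff_of_true ?_ (by rw [RowSpec.Meets, ← or_assoc]; exact Or.inl hfree)
    obtain ⟨c', d', hc', hd', had', hm⟩ := exists_canon_of_word hfree hc hd had w
    have := h.contains_label hc' hd' had'
    rw [rowSpecs_free ρ hρ hfree, word_zero] at this
    exact this.of_eq hm
  · have hi : ¬ FreeType ρ.i := fun h => hfree (Or.inl h)
    have hj : ¬ FreeType ρ.j := fun h => hfree (Or.inr h)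
    have hM : ρ.Meets w ↔ WordEquiv ρ.i ρ.j ρ.label w := by simp [RowSpec.Meets, hi, hj]
    rw [hM]
    constructor
    · rintro ⟨p, q, ⟨hpq, hp, hq⟩, hpq', hm⟩
      obtain ⟨⟨h1, h2⟩, d', hd', hdj, hw⟩ := h.exists_word hpq
      have hcp : Canon ρ.i p := ⟨h1, h2, hp⟩
      have hcd : Canon ρ.j d' := ⟨hd', hdj, (hw.evenTwo hdj.1).1 hq⟩
      have m1 : word (pair p d') ρ.label ∈ dcoset coverP (word (pair c d) w) := by
        rcases hw.pair_eq hdj.1 p with e | e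
        · rwa [← e]
        · rw [← neg_mul_mem_dcoset, ← e]
          exact hm
      have m2 : pair p d' ∈ dcoset coverF (pair c d) := by
        have k1 := mem_dcoset_symm (word_mem_dcoset_coverF (pair p d') ρ.label)
        have k2 := dcoset_mono coverP_le_coverF _ m1
        rw [dcoset_eq_of_mem k2, dcoset_eq_of_mem (word_mem_dcoset_coverF (pair c d) w)] at k1
        exact k1
      have m3 := word_mem_of_canon hi hj hc hcp hd hcd m2 ρ.label
      apply wordEquiv_of_mem_dcoset hc.mem hc.hasType hd.mem hd.hasType
      rw [← dcoset_eq_of_mem m3]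
      exact mem_dcoset_symm m1
    · intro hwe
      exact (h.contains_label hc hd had).of_eq
        (mem_dcoset_symm (hwe.mem_dcoset hc.mem hc.ne_zero hd.mem hd.ne_zero))

theorem contains_typePairs {i j : Fin 6} {c d : ℍ[ℤ]} (hc : HasType c i) (hd : HasType d j)
    (had : Admissible c d) (w : Fin 3 × Fin 3) :
    Contains (typePairs i j) (word (pair c d) w) := by
  have hw : WordRel w (omega w.1 * d * omega w.2) d :=
    ⟨1, 1, one_ne_zero, one_ne_zero, rfl⟩
  have hq0 := hw.ne_zero.2 hd.1
  refine ⟨c, _, ⟨hc, hd.of_sim hq0 (hw.sim hd.1).symm⟩, had.of_wordRel hw, ?_⟩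
  rcases hw.pair_eq hd.1 c with e | e
  · rw [e]
    exact self_mem_dcoset _ _
  · rw [e, neg_mul_mem_dcoset]
    exact self_mem_dcoset _ _

/-! ### Counting the P-classes in an F-class -/

theorem Forall₂.sum_eq {l : List PRow} {l' : List RowSpec} (h : List.Forall₂ RowSpec.Matches l l')
    (i j : Fin 6) :
    ((l.filter fun r => r.i = i ∧ r.j = j).map PRow.countEq).sum =
        ((l'.filter fun r => r.i = i ∧ r.j = j).map RowSpec.countEq).sum ∧
      ((l.filter fun r => r.i = i ∧ r.j = j).map PRow.countDouble).sum =
        ((l'.filter fun r => r.i = i ∧ r.j = j).map RowSpec.countDouble).sum := by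
  induction h with
  | nil => exact ⟨rfl, rfl⟩
  | cons h _ ih =>
    rw [List.filter_cons, List.filter_cons, h.i, h.j]
    split_ifs
    · simp only [List.map_cons, List.sum_cons, ih.1, ih.2, h.countEq, h.countDouble, and_self]
    · exact ih

/-- The words of a list that satisfy `P` and whose sum is (not) `δ`. -/
def selectWords (words : List (Fin 3 × Fin 3)) (P : Fin 3 × Fin 3 → Prop) [DecidablePred P]
    (δ : Fin 3) (e : Bool) : List (Fin 3 × Fin 3) :=
  words.filter fun w => P w ∧ decide (w.1 + w.2 = δ) = e

/-- Without a free type δ is 0. With a free type δ is arbitrary, but the words of the table take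
each value of a + b equally often, so the counts do not depend on δ. -/
theorem count_row : ∀ r ∈ splitTable, ∀ ρ ∈ rowSpecs, ρ.i = r.i → ρ.j = r.j →
    ¬ (ρ.i = 1 ∧ ρ.j = 3) → ∀ δ : Fin 3, FreeType r.i ∨ FreeType r.j ∨ δ = 0 →
    (selectWords r.words ρ.Meets δ true).length = ρ.countEq ∧
      (selectWords r.words ρ.Meets δ false).length = ρ.countDouble := by
  decide +kernel

theorem count_total : ∀ r ∈ splitTable, ¬ (r.i = 1 ∧ r.j = 3) →
    ∀ δ : Fin 3, FreeType r.i ∨ FreeType r.j ∨ δ = 0 →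
    (selectWords r.words (fun _ => True) δ true).length =
        ((rowSpecs.filter fun ρ => ρ.i = r.i ∧ ρ.j = r.j).map RowSpec.countEq).sum ∧
      (selectWords r.words (fun _ => True) δ false).length =
        ((rowSpecs.filter fun ρ => ρ.i = r.i ∧ ρ.j = r.j).map RowSpec.countDouble).sum := by
  decide +kernel

theorem count_nonadmissible : (∀ ρ ∈ rowSpecs, ¬ (ρ.i = 0 ∧ ρ.j = 1) ∧
    (ρ.i = 1 ∧ ρ.j = 3 → ρ.countEq = 0 ∧ ρ.countDouble = 0)) ∧
    ((rowSpecs.filter fun ρ => ρ.i = 0 ∧ ρ.j = 1).map RowSpec.countEq).sum = 0 ∧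
    ((rowSpecs.filter fun ρ => ρ.i = 0 ∧ ρ.j = 1).map RowSpec.countDouble).sum = 0 ∧
    ((rowSpecs.filter fun ρ => ρ.i = 1 ∧ ρ.j = 3).map RowSpec.countEq).sum = 0 ∧
    ((rowSpecs.filter fun ρ => ρ.i = 1 ∧ ρ.j = 3).map RowSpec.countDouble).sum = 0 := by
  decide +kernel

theorem exists_splitRow : ∀ i j : Fin 6, i ≤ j → ¬ (i = 0 ∧ j = 1) →
    ∃ r ∈ splitTable, r.i = i ∧ r.j = j := by
  decide +kernel

theorem exists_rowSpec : ∀ r ∈ splitTable, ∀ w ∈ r.words, ∃ ρ ∈ rowSpecs, ρ.i = r.i ∧ ρ.j = r.j ∧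
    ρ.Meets w := by
  decide +kernel

theorem words_nodup : ∀ r ∈ splitTable, r.words.Nodup := by
  decide +kernel

theorem form_zero_coordinate {i : Fin 6} (hi : ¬ FreeType i) {c : ℍ[ℤ]} (hc : c ∈ form i) :
    c.re = 0 ∨ c.imK = 0 := by
  fin_cases i
  · obtain rfl : c = 1 := hc
    exact Or.inr rfl
  · obtain rfl : c = quat 0 1 1 1 := hc
    exact Or.inl rfl
  · exact absurd (Or.inl rfl) hi
  · obtain ⟨m, n, rfl⟩ := hc
    exact Or.inr rfl
  · obtain ⟨m, n, rfl⟩ := hc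
    exact Or.inr rfl
  · exact absurd (Or.inr rfl) hi

/-- If c and d have ω-exponents k and l, the word (a,b) changes l to a + l + b, so δ = k - l.
Canonical forms without a free type have a zero coordinate and hence exponent 0. -/
theorem exists_sum_eq {i j : Fin 6} {c d : ℍ[ℤ]} (hc : Canon i c) (hd : Canon j d)
    (h : Admissible c d) :
    ∃ δ : Fin 3, (FreeType i ∨ FreeType j ∨ δ = 0) ∧ ∀ w : Fin 3 × Fin 3,
      coincIndex latP (rot (word (pair c d) w)) =
        if w.1 + w.2 = δ then coincIndex latF (R c d) else 2 * coincIndex latF (R c d) := by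
  obtain ⟨k, M, hk, hM, hk0⟩ := exists_par hc.ne_zero hc.even
  obtain ⟨l, N, hl, hN, hl0⟩ := exists_par hd.ne_zero hd.even
  have hMN : IsSquare (M * N) := by
    have h1 := isSquare_mul_trans (nrm_pos hc.ne_zero).ne' (by rw [mul_comm] at hM; exact hM)
      (admissible_iff.1 h).2.2
    exact isSquare_mul_trans (nrm_pos hd.ne_zero).ne' h1 hN
  refine ⟨k - l, ?_, fun w => ?_⟩
  · by_cases hi : FreeType i
    · exact Or.inl hi
    · by_cases hj : FreeType j
      · exact Or.inr (Or.inl hj)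
      · rw [hk0 (form_zero_coordinate hi hc.mem), hl0 (form_zero_coordinate hj hd.mem)]
        exact Or.inr (Or.inr (sub_self 0))
  · have e : coincIndex latF (rot (word (pair c d) w)) = coincIndex latF (R c d) :=
      coincIndex_of_mem_dcoset (rot_mem_dcoset_rotF.2 (word_mem_dcoset_coverF _ _))
    rw [← e, word_pair, coincIndex_latP_of_par hk ((hl.omega_mul w.1).mul_omega w.2) hMN]
    have : ∀ a b k l : Fin 3, k = a + l + b ↔ a + b = k - l := by decide
    simp only [this]

/-! ### Fibres of the map from P-classes to F-classes -/

/-- The union of the double cosets of `rotF` that meet `D`. -/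
def saturate (D : Set Iso4) : Set Iso4 := {x | ∃ y ∈ D, x ∈ dcoset rotF y}

theorem rotP_le_rotF : rotP ≤ rotF := symGroup_latP_le_latF

theorem saturate_dcoset (A : Iso4) : saturate (dcoset rotP A) = dcoset rotF A := by
  ext x
  constructor
  · rintro ⟨y, hy, hx⟩
    rwa [dcoset_eq_of_mem (dcoset_mono rotP_le_rotF _ hy)] at hx
  · intro hx
    exact ⟨A, self_mem_dcoset _ _, hx⟩

theorem ncard_eq_mul {α β : Type*} {A : Set α} {B : Set β} (hA : A.Finite) (hB : B.Finite)
    (f : α → β) (hf : ∀ a ∈ A, f a ∈ B) {n : ℕ} (hn : ∀ b ∈ B, {a ∈ A | f a = b}.ncard = n) :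
    A.ncard = n * B.ncard := by
  classical
  rw [Set.ncard_eq_toFinset_card A hA, Set.ncard_eq_toFinset_card B hB,
    Finset.card_eq_sum_card_fiberwise (f := f) (t := hB.toFinset) (by
      intro a ha
      rw [Set.Finite.coe_toFinset] at ha ⊢
      exact hf a ha), Finset.sum_congr rfl (g := fun _ => n), Finset.sum_const, smul_eq_mul,
    mul_comm]
  intro b hb
  rw [← hn b (hB.mem_toFinset.1 hb), ← Set.ncard_coe_finset]
  congr 1
  ext a
  simp

/-- Over each F-class the fibre consists of the words of the splitting table that meet S and have
the prescribed a + b. Its cardinality n is the same for every F-class. -/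
theorem ncard_classesP {r : SplitRow} (hr : r ∈ splitTable) {S : Set (ℍ[ℤ] × ℍ[ℤ])}
    (hS : ∀ x ∈ S, HasType x.1 r.i ∧ HasType x.2 r.j) {P : Fin 3 × Fin 3 → Prop} [DecidablePred P]
    (hP : ∀ c d, Canon r.i c → Canon r.j d → Admissible c d → ∀ w,
      Contains S (word (pair c d) w) ↔ P w) {e : Bool} {n : ℕ}
    (hn : ∀ δ : Fin 3, FreeType r.i ∨ FreeType r.j ∨ δ = 0 →
      (selectWords r.words P δ e).length = n) {σ τ : ℕ} (hτ : τ = if e then σ else 2 * σ) :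
    (classesP S σ τ).ncard = n * nF r.i r.j σ := by
  refine ncard_eq_mul (finite_classesP _ _ _) (finite_classesF _ _ _) saturate ?_ ?_
  · rintro _ ⟨p, q, hpq, h, hσ, -, rfl⟩
    obtain ⟨h1, h2⟩ := hS _ hpq
    exact ⟨p, q, h, h1, h2, hσ, saturate_dcoset _⟩
  · rintro _ ⟨p, q, h, hp, hq, hσ, rfl⟩
    obtain ⟨c, d, hc, hd, hcd, hm⟩ := exists_canon_pair h hp hq
    have hm' := rot_mem_dcoset_rotF.2 hm
    have hσ0 : σ ≠ 0 := by rw [← hσ]; exact h.coincIndex_ne_zero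
    have hσ' : coincIndex latF (R c d) = σ := by
      rw [← hσ]
      exact (coincIndex_of_mem_dcoset hm').symm
    obtain ⟨δ, hδ, hw⟩ := exists_sum_eq hc hd hcd
    rw [hσ'] at hw
    have hC : dcoset rotF (R p q) = dcoset rotF (R c d) := dcoset_eq_of_mem hm'
    have hτ' : ∀ w : Fin 3 × Fin 3, coincIndex latP (rot (word (pair c d) w)) = τ ↔
        decide (w.1 + w.2 = δ) = e := by
      intro w
      rw [hw w, hτ]
      by_cases h1 : w.1 + w.2 = δ <;> cases e <;> simp [h1] <;> omega
    have hsplit := splitsAs_of_table hr (x := (c, d)) ⟨⟨hc.mem, hd.mem⟩, hc.hasType, hd.hasType⟩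
    -- Choosing a canonical pair (c,d) in the F-class turns its P-classes into words; the value of
    -- Σ_P is read off from a + b.
    have hset : {D ∈ classesP S σ τ | saturate D = dcoset rotF (R p q)} =
        (fun w => dcoset rotP (rot (word (pair c d) w))) ''
          ((selectWords r.words P δ e).toFinset : Set (Fin 3 × Fin 3)) := by
      ext D
      constructor
      · rintro ⟨⟨p', q', hpq', h', hσ1, hτ1, rfl⟩, hsat⟩
        rw [saturate_dcoset, hC] at hsat
        have hmem : R p' q' ∈ dcoset rotF (R c d) := by
          rw [← hsat]
          exact self_mem_dcoset _ _
        have hmem' : pair p' q' ∈ dcoset coverF (pair c d) := rot_mem_dcoset_rotF.1 hmem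
        rw [hsplit.1] at hmem'
        obtain ⟨w, hwr, hw1⟩ := hmem'
        have hw2 : R p' q' ∈ dcoset rotP (rot (word (pair c d) w)) := rot_mem_dcoset_rotP.2 hw1
        refine ⟨w, ?_, (dcoset_eq_of_mem hw2).symm⟩
        rw [List.coe_toFinset]
        refine List.mem_filter.2 ⟨hwr, decide_eq_true ⟨?_, ?_⟩⟩
        · exact (hP c d hc hd hcd w).1 ⟨p', q', hpq', h', hw1⟩
        · rw [← hτ' w, ← hτ1]
          exact (coincIndex_of_mem_dcoset hw2).symm
      · rintro ⟨w, hwr, rfl⟩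
        rw [List.coe_toFinset] at hwr
        obtain ⟨hwr, hw1⟩ := List.mem_filter.1 hwr
        obtain ⟨hPw, hδw⟩ := of_decide_eq_true hw1
        obtain ⟨p', q', hpq', h', hm1⟩ := (hP c d hc hd hcd w).2 hPw
        have hm2 : R p' q' ∈ dcoset rotP (rot (word (pair c d) w)) := rot_mem_dcoset_rotP.2 hm1
        have hm3 : rot (word (pair c d) w) ∈ dcoset rotF (R c d) :=
          rot_mem_dcoset_rotF.2 (word_mem_dcoset_coverF _ _)
        refine ⟨⟨p', q', hpq', h', ?_, ?_, (dcoset_eq_of_mem hm2).symm⟩, ?_⟩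
        · rw [← hσ', ← coincIndex_of_mem_dcoset hm3]
          exact coincIndex_of_mem_dcoset (dcoset_mono rotP_le_rotF _ hm2)
        · rw [← (hτ' w).2 hδw]
          exact coincIndex_of_mem_dcoset hm2
        · rw [saturate_dcoset, hC]
          exact dcoset_eq_of_mem hm3
    rw [hset, Set.InjOn.ncard_image, Set.ncard_coe_finset, List.toFinset_card_of_nodup, hn δ hδ]
    · exact (words_nodup r hr).filter _
    · intro w hwr w' hwr' hww
      rw [List.coe_toFinset] at hwr hwr'
      by_contra hne
      -- Distinct words of the splitting table have disjoint P-double cosets, so words are counted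
      -- without repetition.
      have hd := hsplit.2 w (List.mem_filter.1 hwr).1 w' (List.mem_filter.1 hwr').1 hne
      have h1 : rot (word (pair c d) w) ∈ dcoset rotP (rot (word (pair c d) w')) := by
        have hww' : dcoset rotP (rot (word (pair c d) w)) =
          dcoset rotP (rot (word (pair c d) w')) := hww
        rw [← hww']
        exact self_mem_dcoset _ _
      exact Set.disjoint_left.1 hd (self_mem_dcoset _ _) (rot_mem_dcoset_rotP.1 h1)

theorem not_admissible {i j : Fin 6} (hij : i = 0 ∧ j = 1 ∨ i = 1 ∧ j = 3) {p q : ℍ[ℤ]}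
    (hp : HasType p i) (hq : HasType q j) : ¬ Admissible p q := by
  intro h
  obtain ⟨c, d, hc, hd, hcd, -⟩ := exists_canon_pair h hp hq
  rcases hij with ⟨rfl, rfl⟩ | ⟨rfl, rfl⟩
  · exact not_admissible_zero_one hc.mem hd.mem hcd
  · exact not_admissible_one_three hc.mem hd.mem hcd

theorem ncard_classesP_of_not_admissible {S : Set (ℍ[ℤ] × ℍ[ℤ])}
    (hS : ∀ x ∈ S, ¬ Admissible x.1 x.2) (σ τ : ℕ) : (classesP S σ τ).ncard = 0 := by
  have : classesP S σ τ = ∅ := by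
    rw [Set.eq_empty_iff_forall_notMem]
    rintro _ ⟨p, q, hpq, h, -⟩
    exact hS _ hpq h
  rw [this, Set.ncard_empty]

theorem ncard_rows {r : PRow} (hr : r ∈ tableP) (σ : ℕ) :
    (classesP r.normPairs σ σ).ncard = r.countEq * nF r.i r.j σ ∧
      (classesP r.normPairs σ (2 * σ)).ncard = r.countDouble * nF r.i r.j σ := by
  obtain ⟨ρ, hρ, h⟩ := exists_matches hr
  have hS : ∀ x ∈ r.normPairs, HasType x.1 r.i ∧ HasType x.2 r.j := fun x hx => hx.1.2
  have hle : ∀ ρ ∈ rowSpecs, ρ.i ≤ ρ.j := by decide +kernel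
  by_cases h13 : ρ.i = 1 ∧ ρ.j = 3
  · have hz := (count_nonadmissible.1 ρ hρ).2 h13
    have hS' : ∀ x ∈ r.normPairs, ¬ Admissible x.1 x.2 := fun x hx =>
      not_admissible (Or.inr h13) (by rw [← h.i]; exact (hS x hx).1)
        (by rw [← h.j]; exact (hS x hx).2)
    rw [ncard_classesP_of_not_admissible hS', ncard_classesP_of_not_admissible hS', h.countEq,
      h.countDouble, hz.1, hz.2]
    simp
  · obtain ⟨t, ht, hti, htj⟩ := exists_splitRow ρ.i ρ.j (hle ρ hρ) (count_nonadmissible.1 ρ hρ).1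
    have hcount := count_row t ht ρ hρ hti.symm htj.symm h13
    have hP : ∀ c d, Canon t.i c → Canon t.j d → Admissible c d → ∀ w,
        Contains r.normPairs (word (pair c d) w) ↔ ρ.Meets w := by
      rw [hti, htj]
      exact fun c d hc hd hcd w => h.contains_iff hρ hc hd hcd w
    have hS' : ∀ x ∈ r.normPairs, HasType x.1 t.i ∧ HasType x.2 t.j := by
      rw [hti, htj, ← h.i, ← h.j]
      exact hS
    rw [h.countEq, h.countDouble, h.i, h.j, ← hti, ← htj]
    exact ⟨ncard_classesP ht hS' hP (fun δ hδ => (hcount δ hδ).1) rfl,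
      ncard_classesP ht hS' hP (fun δ hδ => (hcount δ hδ).2) rfl⟩

theorem total_eq (i j : Fin 6) :
    totalEq i j = ((rowSpecs.filter fun ρ => ρ.i = i ∧ ρ.j = j).map RowSpec.countEq).sum ∧
      totalDouble i j =
        ((rowSpecs.filter fun ρ => ρ.i = i ∧ ρ.j = j).map RowSpec.countDouble).sum :=
  Forall₂.sum_eq tableP_matches i j

theorem ncard_types {i j : Fin 6} (hij : i ≤ j) (σ : ℕ) :
    (classesP (typePairs i j) σ σ).ncard = totalEq i j * nF i j σ ∧
      (classesP (typePairs i j) σ (2 * σ)).ncard = totalDouble i j * nF i j σ := by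
  rw [(total_eq i j).1, (total_eq i j).2]
  by_cases hna : i = 0 ∧ j = 1 ∨ i = 1 ∧ j = 3
  · have hS' : ∀ x ∈ typePairs i j, ¬ Admissible x.1 x.2 := fun x hx =>
      not_admissible hna hx.1 hx.2
    rw [ncard_classesP_of_not_admissible hS', ncard_classesP_of_not_admissible hS']
    obtain ⟨-, h1, h2, h3, h4⟩ := count_nonadmissible
    rcases hna with ⟨rfl, rfl⟩ | ⟨rfl, rfl⟩
    · rw [h1, h2]
      simp
    · rw [h3, h4]
      simp
  · obtain ⟨t, ht, rfl, rfl⟩ := exists_splitRow i j hij (fun h => hna (Or.inl h))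
    have hcount := count_total t ht (fun h => hna (Or.inr h))
    have hP : ∀ c d, Canon t.i c → Canon t.j d → Admissible c d → ∀ w,
        Contains (typePairs t.i t.j) (word (pair c d) w) ↔ True := fun c d hc hd hcd w =>
      iff_true_intro (contains_typePairs hc.hasType hd.hasType hcd w)
    exact ⟨ncard_classesP ht (fun _ hx => hx) hP (fun δ hδ => (hcount δ hδ).1) rfl,
      ncard_classesP ht (fun _ hx => hx) hP (fun δ hδ => (hcount δ hδ).2) rfl⟩

/-! ### Representatives of the classes -/

theorem exists_of_rowSpec {ρ : RowSpec} (hρ : ρ ∈ rowSpecs) :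
    ∃ r ∈ tableP, RowSpec.Matches r ρ := by
  have := tableP_matches
  obtain ⟨n, hn, rfl⟩ := List.getElem_of_mem hρ
  have h2 := List.Forall₂.length_eq this
  exact ⟨_, List.getElem_mem (h2 ▸ hn), List.Forall₂.get this (h2 ▸ hn) hn⟩

theorem exists_splitRow_pair {i j : Fin 6} (hij : i ≤ j) {p q : ℍ[ℤ]} (h : Admissible p q)
    (hp : HasType p i) (hq : HasType q j) :
    ∃ r ∈ splitTable, ∃ c d, Canon r.i c ∧ Canon r.j d ∧ Admissible c d ∧ (c, d) ∈ r.pairs ∧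
      pair p q ∈ dcoset coverF (pair c d) := by
  have hn : ¬ (i = 0 ∧ j = 1) := fun hn => not_admissible (Or.inl hn) hp hq h
  obtain ⟨r, hr, rfl, rfl⟩ := exists_splitRow i j hij hn
  obtain ⟨c, d, hc, hd, hcd, hm⟩ := exists_canon_pair h hp hq
  exact ⟨r, hr, c, d, hc, hd, hcd, ⟨⟨hc.mem, hd.mem⟩, hc.hasType, hd.hasType⟩, hm⟩

theorem exists_tableP_pair {i j : Fin 6} (hij : i ≤ j) {p q : ℍ[ℤ]} (h : Admissible p q)
    (hp : HasType p i) (hq : HasType q j) :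
    ∃ r ∈ tableP, ∃ x ∈ r.normPairs, R p q ∈ dcoset rotP (R x.1 x.2) := by
  obtain ⟨t, ht, c, d, hc, hd, hcd, hx, hm⟩ := exists_splitRow_pair hij h hp hq
  rw [(splitsAs_of_table ht hx).1] at hm
  obtain ⟨w, hw, hm⟩ := hm
  obtain ⟨ρ, hρ, hi, hj, hmeet⟩ := exists_rowSpec t ht w hw
  obtain ⟨r, hr, hrρ⟩ := exists_of_rowSpec hρ
  rw [← hi] at hc
  rw [← hj] at hd
  obtain ⟨p', q', hx', -, hm'⟩ := (hrρ.contains_iff hρ hc hd hcd w).2 hmeet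
  refine ⟨r, hr, (p', q'), hx', rot_mem_dcoset_rotP.2 ?_⟩
  rw [dcoset_eq_of_mem hm']
  exact hm

theorem R_mem_dcoset_swap {G : Subgroup Iso4} (hG : ∀ A ∈ G, flip A ∈ G) {p q p' q' : ℍ[ℤ]}
    (h : R p q ∈ dcoset G (R p' q')) : R q p ∈ dcoset G (R q' p') := by
  rw [← flip_R p' q', ← image_flip_dcoset hG, ← flip_R p q]
  exact ⟨_, h, rfl⟩

theorem exists_classF_rep {p q : ℍ[ℤ]} (h : Admissible p q) :
    ∃ r ∈ splitTable, ∃ x ∈ r.pairs,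
      R p q ∈ dcoset rotF (R x.1 x.2) ∨ R p q ∈ dcoset rotF (R x.2 x.1) := by
  obtain ⟨i, hp⟩ := exists_hasType h.1
  obtain ⟨j, hq⟩ := exists_hasType h.2.1
  rcases le_total i j with hij | hij
  · obtain ⟨r, hr, c, d, -, -, -, hx, hm⟩ := exists_splitRow_pair hij h hp hq
    exact ⟨r, hr, _, hx, Or.inl (rot_mem_dcoset_rotF.2 hm)⟩
  · obtain ⟨r, hr, c, d, -, -, -, hx, hm⟩ := exists_splitRow_pair hij h.swap hq hp
    exact ⟨r, hr, _, hx, Or.inr (R_mem_dcoset_swap (fun _ => flip_mem_rotF)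
      (rot_mem_dcoset_rotF.2 hm))⟩

theorem exists_classP_rep {p q : ℍ[ℤ]} (h : Admissible p q) :
    ∃ r ∈ tableP, ∃ x ∈ r.normPairs,
      R p q ∈ dcoset rotP (R x.1 x.2) ∨ R p q ∈ dcoset rotP (R x.2 x.1) := by
  obtain ⟨i, hp⟩ := exists_hasType h.1
  obtain ⟨j, hq⟩ := exists_hasType h.2.1
  rcases le_total i j with hij | hij
  · obtain ⟨r, hr, x, hx, hm⟩ := exists_tableP_pair hij h hp hq
    exact ⟨r, hr, x, hx, Or.inl hm⟩
  · obtain ⟨r, hr, x, hx, hm⟩ := exists_tableP_pair hij h.swap hq hp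
    exact ⟨r, hr, x, hx, Or.inr (R_mem_dcoset_swap (fun _ => flip_mem_rotP) hm)⟩

theorem image_swap_typePairs (i j : Fin 6) : Prod.swap '' typePairs i j = typePairs j i := by
  ext ⟨p, q⟩
  constructor
  · rintro ⟨⟨a, b⟩, ⟨h1, h2⟩, h⟩
    obtain ⟨rfl, rfl⟩ := Prod.mk.inj h
    exact ⟨h2, h1⟩
  · rintro ⟨h1, h2⟩
    exact ⟨(q, p), ⟨h2, h1⟩, rfl⟩

/-! ### The types with a single class -/

/-- When the form has one member c, every admissible pair of type (i,i) is F-equivalent to (c,c), so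
there is a single class with a single index. -/
theorem nF_diag {i : Fin 6} {c : ℍ[ℤ]} (hc : HasType c i) (h : form i = {c}) (σ : ℕ) :
    nF i i σ = if σ = coincIndex latF (R c c) then 1 else 0 := by
  have key : ∀ p q, Admissible p q → HasType p i → HasType q i →
      R p q ∈ dcoset rotF (R c c) := by
    intro p q hpq hp hq
    obtain ⟨x, y, hx, hy, -, hm⟩ := exists_canon_pair hpq hp hq
    obtain rfl : x = c := by simpa [h] using hx.mem
    obtain rfl : y = x := by simpa [h] using hy.mem
    exact rot_mem_dcoset_rotF.2 hm
  rw [nF]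
  split_ifs with hσ
  · have : classesF i i σ = {dcoset rotF (R c c)} := by
      ext C
      constructor
      · rintro ⟨p, q, hpq, hp, hq, -, rfl⟩
        exact (dcoset_eq_of_mem (key p q hpq hp hq))
      · rintro rfl
        exact ⟨c, c, ⟨hc.1, hc.1, _, rfl⟩, hc, hc, hσ.symm, rfl⟩
    rw [this, Set.ncard_singleton]
  · have : classesF i i σ = ∅ := by
      rw [Set.eq_empty_iff_forall_notMem]
      rintro C ⟨p, q, hpq, hp, hq, hs, rfl⟩
      exact hσ (hs.symm.trans (coincIndex_of_mem_dcoset (key p q hpq hp hq)))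
    rw [this, Set.ncard_empty]

theorem sim_refl (p : ℍ[ℤ]) : Sim p p := ⟨1, one_mem _, 1, one_mem _, by rw [one_mul, mul_one]⟩

theorem hasType_one : HasType 1 0 :=
  ⟨one_ne_zero, ⟨1, rfl, one_ne_zero, sim_refl 1⟩, fun k _ => Fin.zero_le k⟩

theorem pureSum_ne_zero : (quat 0 1 1 1 : ℍ[ℤ]) ≠ 0 := by decide +kernel

/-- Equivalence to 1 would make 3 or 6 a square. -/
theorem hasType_pure : HasType (quat 0 1 1 1) 1 := by
  refine ⟨pureSum_ne_zero, ⟨_, rfl, pureSum_ne_zero, sim_refl _⟩, ?_⟩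
  rintro k ⟨c, hc, -, s, hs, s', hs', h⟩
  rcases Fin.eq_zero_or_eq_succ k with rfl | ⟨k, rfl⟩
  swap
  · exact Fin.succ_le_succ_iff.2 (Fin.zero_le k)
  obtain rfl : c = 1 := hc
  obtain ⟨d, hs⟩ := mem_octa_iff.1 hs
  obtain ⟨e, hs'⟩ := mem_octa_iff.1 hs'
  have := isSquare_of_unit_eq_mul one_ne_zero pureSum_ne_zero hs hs' h
  split_ifs at this
  · exact absurd this (by decide +kernel)
  · exact absurd this (by decide +kernel)

theorem nF_zero_zero (σ : ℕ) : nF 0 0 σ = if σ = 1 then 1 else 0 := by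
  have h : R 1 1 = 1 := by
    rw [R, pair, unit_one]
    exact map_one rot
  rw [nF_diag hasType_one rfl, h, coincIndex_one]

/-! ### The index of the half-turn about (1,1,1) -/

/-- The sum of the imaginary components modulo `3`. -/
def imSum : ℍ[ℤ] →+ ZMod 3 where
  toFun x := ((x.imI + x.imJ + x.imK : ℤ) : ZMod 3)
  map_zero' := by simp
  map_add' x y := by
    simp only [Quaternion.imI_add, Quaternion.imJ_add, Quaternion.imK_add]
    push_cast
    ring

theorem three_smul_R_apply (x : ℍ[ℤ]) :
    (3 : ℝ) • R (quat 0 1 1 1) (quat 0 1 1 1) (ofInt x) =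
      ofInt (quat (3 * x.re) (2 * (x.imI + x.imJ + x.imK) - 3 * x.imI)
        (2 * (x.imI + x.imJ + x.imK) - 3 * x.imJ) (2 * (x.imI + x.imJ + x.imK) - 3 * x.imK)) := by
  have := smul_R_apply pureSum_ne_zero pureSum_ne_zero (m := 3) rfl x
  rw [Nat.cast_ofNat] at this
  rw [this]
  congr 1
  obtain ⟨a, b, c, d⟩ := x
  have e : star (quat (0 : ℤ) 1 1 1) = quat 0 (-1) (-1) (-1) := by decide +kernel
  change quat 0 1 1 1 * quat a b c d * star (quat 0 1 1 1) = _
  rw [e, quat_mul_quat, quat_mul_quat]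
  apply QuaternionAlgebra.ext <;> simp only [quat] <;> ring

theorem three_smul_ofInt (x : ℍ[ℤ]) :
    (3 : ℝ) • ofInt x = ofInt (quat (3 * x.re) (3 * x.imI) (3 * x.imJ) (3 * x.imK)) := by
  rw [← Int.cast_ofNat, ← ofInt_zsmul]
  exact congrArg ofInt (zsmul_quat 3 x.re x.imI x.imJ x.imK)

/-- On imaginary parts the rotation is b ↦ (2S/3)(1,1,1) - b with S the coordinate sum, so
integrality amounts to 3 ∣ S. -/
theorem latF_inf_image_pure :
    latF ⊓ image (R (quat 0 1 1 1) (quat 0 1 1 1)) latF = (evenQuat ⊓ imSum.ker).map ofIntHom := by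
  have h3 : (3 : ℝ) ≠ 0 := by norm_num
  ext z
  constructor
  · rintro ⟨hz, y, hy, h⟩
    obtain ⟨x, hx, rfl⟩ := mem_latF_iff.1 hz
    obtain ⟨y, hy', rfl⟩ := mem_latF_iff.1 hy
    refine ⟨x, ⟨mem_evenQuat.2 hx, ?_⟩, rfl⟩
    change R (quat 0 1 1 1) (quat 0 1 1 1) (ofInt y) = ofInt x at h
    have e := three_smul_R_apply y
    rw [h, three_smul_ofInt] at e
    obtain ⟨-, e1, e2, e3⟩ := QuaternionAlgebra.mk.inj (ofInt_injective e)
    change ((x.imI + x.imJ + x.imK : ℤ) : ZMod 3) = 0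
    rw [ZMod.intCast_zmod_eq_zero_iff_dvd]
    omega
  · rintro ⟨x, ⟨hx, hs⟩, rfl⟩
    have hx := mem_evenQuat.1 hx
    change ((x.imI + x.imJ + x.imK : ℤ) : ZMod 3) = 0 at hs
    rw [ZMod.intCast_zmod_eq_zero_iff_dvd] at hs
    obtain ⟨t, ht⟩ := hs
    rw [Nat.cast_ofNat] at ht
    -- The half-turn is an involution, so the preimage of x is its image, computed with S = 3t.
    refine ⟨ofInt_mem_latF.2 hx, ofInt (quat x.re (2 * t - x.imI) (2 * t - x.imJ) (2 * t - x.imK)),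
      ofInt_mem_latF.2 ?_, ?_⟩
    · rw [even_nrm_iff] at hx ⊢
      simp only [quat]
      omega
    · change R (quat 0 1 1 1) (quat 0 1 1 1) _ = ofInt x
      refine smul_right_injective _ h3 ?_
      change (3 : ℝ) • _ = (3 : ℝ) • _
      rw [three_smul_R_apply, three_smul_ofInt]
      congr 1
      apply QuaternionAlgebra.ext <;> simp only [quat] <;> linarith

theorem coincIndex_latF_pure : coincIndex latF (R (quat 0 1 1 1) (quat 0 1 1 1)) = 3 := by
  rw [coincIndex, latF_inf_image_pure]
  conv_lhs => rw [← map_evenQuat]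
  rw [AddSubgroup.relIndex_map_map_of_injective _ _ ofInt_injective, inf_comm,
    AddSubgroup.inf_relIndex_right, AddSubgroup.relIndex_ker]
  have : evenQuat.map imSum = ⊤ := by
    rw [eq_top_iff]
    rintro k -
    -- The real part only serves to make the norm even; the sum modulo 3 ignores it.
    refine ⟨quat k.val k.val 0 0, mem_evenQuat.2 ?_, ?_⟩
    · rw [even_nrm_iff]
      simp only [quat]
      omega
    · change (((k.val : ℤ) + 0 + 0 : ℤ) : ZMod 3) = k
      simp
  rw [this, AddSubgroup.card_top, Nat.card_zmod]

theorem nF_one_one (σ : ℕ) : nF 1 1 σ = if σ = 3 then 1 else 0 := by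
  rw [nF_diag hasType_pure rfl, coincIndex_latF_pure]

end Hypercubic

open Hypercubic in
theorem mainTheorem6 :
    -- the coset decomposition of the double cover of `G_F` by that of `G_P`
    (coverP ≤ coverF ∧ coverP.relIndex coverF = 3 ∧
      (coverF : Set Spin) = (coverP : Set Spin)
        ∪ (fun x => pair 1 ⟨1, 1, 1, 1⟩ * x) '' (coverP : Set Spin)
        ∪ (fun x => pair 1 ⟨1, -1, -1, -1⟩ * x) '' (coverP : Set Spin)) ∧
    -- every F-class of admissible pairs contains a canonical pair, up to interchanging `p`, `q`
    (∀ p q : ℍ[ℤ], Admissible p q → ∃ r ∈ splitTable, ∃ x ∈ r.pairs,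
      R p q ∈ dcoset rotF (R x.1 x.2) ∨ R p q ∈ dcoset rotF (R x.2 x.1)) ∧
    -- splitting of the F-double cosets into P-double cosets, also for the interchanged pairs
    (∀ r ∈ splitTable, ∀ x ∈ r.pairs,
      SplitsAs (pair x.1 x.2) s r.words ∧
      SplitsAs (pair x.2 x.1) (fun k => (s k).swap) r.words) ∧
    -- every P-class of admissible pairs contains a pair of some row, up to interchanging `p`, `q`
    (∀ p q : ℍ[ℤ], Admissible p q → ∃ r ∈ tableP, ∃ x ∈ r.normPairs,
      R p q ∈ dcoset rotP (R x.1 x.2) ∨ R p q ∈ dcoset rotP (R x.2 x.1)) ∧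
    -- the stabilisers, their orders, and the sizes of the P-classes
    (∀ r ∈ tableP, ∀ x ∈ r.pairs,
      (stabP (pair x.1 x.2) = Subgroup.closure r.allGens ∧
        Nat.card (stabP (pair x.1 x.2)) = r.order ∧
        (dcoset rotP (R x.1 x.2)).ncard = r.mult * 192) ∧
      (stabP (pair x.2 x.1) = Subgroup.closure (Prod.swap '' r.allGens) ∧
        Nat.card (stabP (pair x.2 x.1)) = r.order ∧
        (dcoset rotP (R x.2 x.1)).ncard = r.mult * 192)) ∧
    -- `Σ_F` is odd, and `Σ_P` is `Σ_F` or `2 Σ_F`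
    (∀ p q : ℍ[ℤ], Admissible p q → Odd (coincIndex latF (R p q)) ∧
      (coincIndex latP (R p q) = coincIndex latF (R p q) ∨
        coincIndex latP (R p q) = 2 * coincIndex latF (R p q))) ∧
    -- for a given index there are only finitely many classes
    (∀ (i j : Fin 6) (σ : ℕ), (classesF i j σ).Finite ∧
      ∀ τ, (classesP (typePairs i j) σ τ).Finite) ∧
    -- the values of `n_{F00}` and `n_{F11}`, and the symmetry of the numbers `n_{Fij}`
    ((∀ σ, nF 0 0 σ = if σ = 1 then 1 else 0) ∧ (∀ σ, nF 1 1 σ = if σ = 3 then 1 else 0) ∧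
      ∀ i j σ, nF i j σ = nF j i σ) ∧
    -- the number of P-inequivalent admissible pairs of each row
    (∀ r ∈ tableP, ∀ σ : ℕ,
      (classesP r.normPairs σ σ).ncard = r.countEq * nF r.i r.j σ ∧
      (classesP r.normPairs σ (2 * σ)).ncard = r.countDouble * nF r.i r.j σ ∧
      (classesP (Prod.swap '' r.normPairs) σ σ).ncard = r.countEq * nF r.i r.j σ ∧
      (classesP (Prod.swap '' r.normPairs) σ (2 * σ)).ncard = r.countDouble * nF r.i r.j σ) ∧
    -- the number of all P-inequivalent admissible pairs of each type
    (∀ i j : Fin 6, i ≤ j → ∀ σ : ℕ,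
      (classesP (typePairs i j) σ σ).ncard = totalEq i j * nF i j σ ∧
      (classesP (typePairs i j) σ (2 * σ)).ncard = totalDouble i j * nF i j σ ∧
      (classesP (typePairs j i) σ σ).ncard = totalEq i j * nF i j σ ∧
      (classesP (typePairs j i) σ (2 * σ)).ncard = totalDouble i j * nF i j σ) := by
  refine ⟨⟨coverP_le_coverF, relIndex_coverP, coverF_eq_union⟩,
    fun p q h => exists_classF_rep h,
    fun r hr x hx => ⟨splitsAs_of_table hr hx, (splitsAs_of_table hr hx).swap⟩,
    fun p q h => exists_classP_rep h, fun r hr x hx => stabilisers hr hx,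
    fun p q h => ⟨h.odd_coincIndex, coincIndex_latP_cases _⟩,
    fun i j σ => ⟨finite_classesF i j σ, fun τ => finite_classesP _ σ τ⟩,
    ⟨nF_zero_zero, nF_one_one, nF_comm⟩, fun r hr σ => ?_, fun i j hij σ => ?_⟩
  · obtain ⟨h1, h2⟩ := ncard_rows hr σ
    rw [ncard_classesP_swap, ncard_classesP_swap]
    exact ⟨h1, h2, h1, h2⟩
  · obtain ⟨h1, h2⟩ := ncard_types hij σ
    rw [← image_swap_typePairs i j, ncard_classesP_swap, ncard_classesP_swap]
    exact ⟨h1, h2, h1, h2⟩
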